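/- Let $I=\{1,\dots,m\}$ be a set of binary issues and let $n$ voters each submit a conditional approval ballot. The ballot of voter $i$ consists of a directed graph $G_i=(I,E_i)$ (her dependency graph) and, for every issue $j$, of a set $A_i^j$ of approved statements $\{t:d\}$, where $t$ assigns a value in $\{0,1\}$ to every in-neighbour of $j$ in $G_i$ and $d\in\{0,1\}$ is a value of $j$. Under an outcome $s\in\{0,1\}^m$, voter $i$ is dissatisfied with issue $j$ if $\{t:s_j\}\notin A_i^j$, where $t$ is the restriction of $s$ to the in-neighbours of $j$ in $G_i$; let $\delta_i(s)$ be the number of issues that dissatisfy voter $i$. Conditional Minisum is the problem of computing, from the profile of all ballots (written with explicit truth tables for the sets $A_i^j$), an outcome $s^*$ with $\sum_{i=1}^n\delta_i(s^*)=\min_{s\in\{0,1\}^m}\sum_{i=1}^n\delta_i(s)$. The global dependency graph is the directed graph $(I,\bigcup_i E_i)$, and its undirected version is obtained by forgetting orientations, multiplicities and loops. Theorem. On the class of profiles in which every voter's dependency graph has maximum in-degree at most $1$ and the undirected version of the global dependency graph has treewidth at most $2$, Conditional Minisum is solvable exactly in polynomial time: there is a Turing machine that, given the written form of any profile of the class,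 outputs an optimal outcome within a number of steps polynomial in the length of the input. -/

import Mathlib

/-- A conditional approval ballot over `m` binary issues: a dependency digraph on the issues, where
an edge `k → j` says that issue `j` is affected by issue `k`, and for every issue `j` the set
`approved j` of approved statements `{t : d}`, where `t` assigns a value to every direct
predecessor of `j` and `d` is a value of `j`.  The value `true` is a vote in favour. -/
structure CondBallot (m : ℕ) where
  graph : Digraph (Fin m)
  approved : (j : Fin m) → Set (({k : Fin m // graph.Adj k j} → Bool) × Bool)

namespace CondBallot

variable {m : ℕ} (B : CondBallot m)

/-- The in-degree of issue `j` in the dependency graph. -/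
noncomputable def inDegree (j : Fin m) : ℕ :=
  Set.ncard {k : Fin m | B.graph.Adj k j}

/-- The maximum in-degree of the dependency graph (`0` if there are no issues). -/
noncomputable def maxInDegree : ℕ :=
  Finset.univ.sup B.inDegree

/-- The voter is dissatisfied with issue `j` under the outcome `s`: the statement formed by the
projection of `s` to the predecessors of `j` and the value `s j` is not approved. -/
def Dissatisfied (s : Fin m → Bool) (j : Fin m) : Prop :=
  ((fun k : {k : Fin m // B.graph.Adj k j} => s k.1), s j) ∉ B.approved j

/-- The number of issues that dissatisfy the voter under the outcome `s`. -/
noncomputable def dissatisfaction (s : Fin m → Bool) : ℕ :=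
  Set.ncard {j : Fin m | B.Dissatisfied s j}

/-- The `r`-th assignment of values to the predecessors of `j`: the `i`-th smallest predecessor
(counted from `0`) gets the `i`-th binary digit of `r`.  For `r < 2 ^ inDegree j` these are all the
assignments, each exactly once. -/
noncomputable def predAssignment (j : Fin m) (r : ℕ) : {k : Fin m // B.graph.Adj k j} → Bool :=
  fun k => r.testBit (Set.ncard {q : Fin m | B.graph.Adj q j ∧ q < k.1})

open scoped Classical in
/-- The row of issue `j` in the written ballot: the bits telling which issues are predecessors of
`j`, the separator `none`, the truth table of the approved statements (for every assignment to the
predecessors, first the bit of the value `false` of `j`, then that of `true`), and a separator. -/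
noncomputable def encodeRow (j : Fin m) : List (Option Bool) :=
  (List.ofFn fun k : Fin m => some (decide (B.graph.Adj k j))) ++ [none] ++
    (List.range (2 ^ B.inDegree j)).flatMap (fun r =>
      [some (decide ((B.predAssignment j r, false) ∈ B.approved j)),
       some (decide ((B.predAssignment j r, true) ∈ B.approved j))]) ++ [none]

/-- The written ballot: the rows of all issues in order, and a separator. -/
noncomputable def encode : List (Option Bool) :=
  (List.finRange m).flatMap B.encodeRow ++ [none]

end CondBallot

/-- A conditional approval voting profile: `m` binary issues and `n` voters with a conditional
approval ballot each. -/
structure VotingProfile where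
  m : ℕ
  n : ℕ
  ballot : Fin n → CondBallot m

namespace VotingProfile

variable (P : VotingProfile)

/-- The total number of dissatisfactions over all voters under the outcome `s`. -/
noncomputable def cost (s : Fin P.m → Bool) : ℕ :=
  ∑ i, (P.ballot i).dissatisfaction s

/-- The outcome `s` is a Conditional Minisum solution of the profile. -/
def IsOptimal (s : Fin P.m → Bool) : Prop :=
  ∀ s' : Fin P.m → Bool, P.cost s ≤ P.cost s'

/-- The global dependency graph: the union of the edges of all dependency graphs. -/
def globalGraph : Digraph (Fin P.m) :=
  ⨆ i, (P.ballot i).graph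

/-- The written profile, a word over an alphabet of three symbols: the number of issues in unary, a
separator, and the written ballots of all voters in order. -/
noncomputable def encode : List (Option Bool) :=
  List.replicate P.m (some true) ++ [none] ++
    (List.finRange P.n).flatMap (fun i => (P.ballot i).encode)

end VotingProfile

/-- A tree decomposition of a graph, with a finite tree. -/
structure TreeDecomp {V : Type} (G : SimpleGraph V) where
  node : Type
  finite_node : Finite node
  tree : SimpleGraph node
  isTree : tree.IsTree
  bag : node → Finset V
  vertex_mem : ∀ v, ∃ x, v ∈ bag x
  edge_mem : ∀ u v, G.Adj u v → ∃ x, u ∈ bag x ∧ v ∈ bag x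
  connected : ∀ v, (tree.induce {x | v ∈ bag x}).Connected

/-- The treewidth of `G` is at most `k`: some tree decomposition has all bags of size at most
`k + 1`. -/
def TreewidthLE {V : Type} (G : SimpleGraph V) (k : ℕ) : Prop :=
  ∃ D : TreeDecomp G, ∀ x, (D.bag x).card ≤ k + 1

/-- Conditional Minisum is solvable exactly in polynomial time on the profiles of the class `C`:
there is a function, computed by a Turing machine in time polynomial in the length of the written
profile, that maps every profile of the class to an optimal outcome, written as the list of its
values. -/
def MinisumSolvableInPolyTime (C : VotingProfile → Prop) : Prop :=
  ∃ f : {P : VotingProfile // C P} → List Bool,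
    (∀ P, ∃ s : Fin P.1.m → Bool, P.1.IsOptimal s ∧ f P = List.ofFn s) ∧
    Nonempty (Turing.TM2ComputableInPolyTime
      (fun P : {P : VotingProfile // C P} => P.1.encode) (fun l : List Bool => l) f)

/-! With in-degrees at most one, a voter's dissatisfaction with an issue depends on the value of
that issue and of at most one other. Adding up all ballots therefore turns the total dissatisfaction
into a sum of pairwise costs `W a b k j` (`readBallots_hasCost`), and two distinct issues share a
nonzero cost only if they are adjacent in the global dependency graph. What has to be minimised is a
sum of pairwise costs over a graph of treewidth at most two.

Such a graph has a vertex `v` with at most two neighbours `x` and `y` (`exists_small_neighborhood`).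
For fixed values of `x` and `y` the better value of `v` is found by comparing two costs, and the
smaller cost is a function of these two values, so it can be added to the pairwise cost of `x` and
`y`. The only new edge joins `x` and `y`; it arises by contracting `v` into `x`, which keeps the
treewidth at most two (`HasDecomp.contract`). Elimination can thus be repeated until no issue is
left. Throughout, the remaining sum is a lower bound of the cost, attained by every assignment that
gives all eliminated vertices their logged best values (`Inv.eliminate`). Reading the log backwards
produces such an assignment (`backtrackCmd_spec`), and it is optimal (`Inv.optimal`). No tree
decomposition is ever computed: all triples `v`, `x`, `y` are tried, and the treewidth only
guarantees that some triple succeeds (`Inv.exists_elig`).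

Polynomial time is proved once and for all for a small language `Cmd` with a memory of natural
numbers, in which every loop has as many iterations as the input has symbols, plus one. A command
raises the number of memory records and the bit length of their entries by an amount that depends on
the number `N` of iterations only, so nested loops cause polynomial growth (`runs_compile`).
Commands are compiled to structured stack programs, and these to Turing machines (`Exec.reachesIn`,
`computableInPolyTime`). The algorithm is one command, `Cmd.minisum`; only its correctness remains
to be shown (`Cmd.minisum_spec`). -/

/-! ### Structured programs over stacks and their compilation to Turing machines -/

/-- Structured programs over a family of stacks.  All choices depend on the stack tops only. -/
inductive StackProg {K : Type} (Γ : K → Type) : Type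
  | skip : StackProg Γ
  | push (k : K) (h : (∀ k, Option (Γ k)) → Γ k) : StackProg Γ
  | pop (k : K) : StackProg Γ
  | seq (c d : StackProg Γ) : StackProg Γ
  | ite (g : (∀ k, Option (Γ k)) → Bool) (c d : StackProg Γ) : StackProg Γ
  | while (g : (∀ k, Option (Γ k)) → Bool) (c : StackProg Γ) : StackProg Γ

namespace StackProg

variable {K : Type} {Γ : K → Type}

/-- The tops of all stacks. -/
def tops (S : ∀ k, List (Γ k)) : ∀ k, Option (Γ k) := fun k => (S k).head?

/-- `Exec c S t S'`: started on the stacks `S`, the program `c` stops with the stacks `S'` within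
`t` steps. -/
inductive Exec [DecidableEq K] :
    StackProg Γ → (∀ k, List (Γ k)) → ℕ → (∀ k, List (Γ k)) → Prop
  | skip (S) : Exec skip S 1 S
  | push (k h S) : Exec (push k h) S 1 (Function.update S k (h (tops S) :: S k))
  | pop (k S) : Exec (pop k) S 1 (Function.update S k (S k).tail)
  | seq {c d S t S' t' S''} : Exec c S t S' → Exec d S' t' S'' → Exec (seq c d) S (t + t') S''
  | ite_true {g c d S t S'} : g (tops S) = true → Exec c S t S' → Exec (ite g c d) S (t + 1) S'
  | ite_false {g c d S t S'} : g (tops S) = false → Exec d S t S' → Exec (ite g c d) S (t + 1) S'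
  | while_false {g c S} : g (tops S) = false → Exec (StackProg.while g c) S 1 S
  | while_true {g c S t S' t' S''} : g (tops S) = true → Exec c S t S' →
      Exec (StackProg.while g c) S' t' S'' → Exec (StackProg.while g c) S (t + 1 + t') S''
  | mono {c S t t' S'} : Exec c S t S' → t ≤ t' → Exec c S t' S'

/-- The labels of the compiled program. -/
def Lab : StackProg Γ → Type
  | skip => Unit
  | push _ _ => Unit
  | pop _ => Unit
  | seq c d => Lab c ⊕ Lab d
  | ite _ c d => Option (Lab c ⊕ Lab d)
  | StackProg.while _ c => Option (Lab c)

/-- The label at which the compiled program is entered. -/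
def entry : (c : StackProg Γ) → Lab c
  | skip => ()
  | push _ _ => ()
  | pop _ => ()
  | seq c _ => Sum.inl (entry c)
  | ite _ _ _ => none
  | StackProg.while _ _ => none

noncomputable instance fintypeLab : (c : StackProg Γ) → Fintype (Lab c)
  | skip => inferInstanceAs (Fintype Unit)
  | push _ _ => inferInstanceAs (Fintype Unit)
  | pop _ => inferInstanceAs (Fintype Unit)
  | seq c d =>
    letI := fintypeLab c; letI := fintypeLab d; inferInstanceAs (Fintype (Lab c ⊕ Lab d))
  | ite _ c d =>
    letI := fintypeLab c; letI := fintypeLab d; inferInstanceAs (Fintype (Option (Lab c ⊕ Lab d)))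
  | StackProg.while _ c => letI := fintypeLab c; inferInstanceAs (Fintype (Option (Lab c)))

open Turing Turing.TM2

variable [DecidableEq K]

/-- Record the tops of the listed stacks in the internal state. -/
def snapList {Λ : Type} (q : Stmt Γ Λ (∀ k, Option (Γ k))) :
    List K → Stmt Γ Λ (∀ k, Option (Γ k))
  | [] => q
  | k :: l => Stmt.peek k (fun v o => Function.update v k o) (snapList q l)

theorem stepAux_snapList {Λ : Type} (q : Stmt Γ Λ (∀ k, Option (Γ k))) (l : List K)
    (v : ∀ k, Option (Γ k)) (S : ∀ k, List (Γ k)) :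
    stepAux (snapList q l) v S =
      stepAux q (fun k => if k ∈ l then (S k).head? else v k) S := by
  induction l generalizing v with
  | nil => simp [snapList]
  | cons a l ih =>
    simp only [snapList, stepAux, ih]
    congr 1
    funext k
    by_cases hk : k ∈ l
    · simp [hk]
    · by_cases ha : k = a
      · subst ha; simp [hk]
      · simp [hk, ha]

/-- Reachability within a number of steps of the machine. -/
def ReachesIn {Λ : Type} (M : Λ → Stmt Γ Λ (∀ k, Option (Γ k)))
    (a : Cfg Γ Λ (∀ k, Option (Γ k))) (t : ℕ) (b : Cfg Γ Λ (∀ k, Option (Γ k))) : Prop :=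
  Nonempty (StateTransition.EvalsToInTime (step M) a (some b) t)

theorem ReachesIn.trans {Λ : Type} {M : Λ → Stmt Γ Λ (∀ k, Option (Γ k))}
    {a b c : Cfg Γ Λ (∀ k, Option (Γ k))} {t t' : ℕ} (h : ReachesIn M a t b)
    (h' : ReachesIn M b t' c) : ReachesIn M a (t + t') c := by
  obtain ⟨h⟩ := h
  obtain ⟨h'⟩ := h'
  have := StateTransition.EvalsToInTime.trans (step M) t t' a b _ h h'
  rw [add_comm] at this
  exact ⟨this⟩

theorem ReachesIn.mono {Λ : Type} {M : Λ → Stmt Γ Λ (∀ k, Option (Γ k))}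
    {a b : Cfg Γ Λ (∀ k, Option (Γ k))} {t t' : ℕ} (h : ReachesIn M a t b) (ht : t ≤ t') :
    ReachesIn M a t' b := by
  obtain ⟨h⟩ := h
  exact ⟨⟨h.toEvalsTo, h.steps_le_m.trans ht⟩⟩

theorem ReachesIn.single {Λ : Type} {M : Λ → Stmt Γ Λ (∀ k, Option (Γ k))}
    {l : Λ} {v : ∀ k, Option (Γ k)} {S : ∀ k, List (Γ k)} {b : Cfg Γ Λ (∀ k, Option (Γ k))}
    (h : stepAux (M l) v S = b) : ReachesIn M ⟨some l, v, S⟩ 1 b :=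
  ⟨⟨⟨1, by simp [flip, step, h]⟩, le_rfl⟩⟩

/-- Record the tops of all stacks in the internal state. -/
noncomputable def snap [Fintype K] {Λ : Type} (q : Stmt Γ Λ (∀ k, Option (Γ k))) :
    Stmt Γ Λ (∀ k, Option (Γ k)) :=
  snapList q Finset.univ.toList

/-- A machine step executes a whole statement up to the next jump, so reading all tops costs no
additional step, and the earlier internal state is forgotten. -/
theorem stepAux_snap [Fintype K] {Λ : Type} (q : Stmt Γ Λ (∀ k, Option (Γ k)))
    (v : ∀ k, Option (Γ k)) (S : ∀ k, List (Γ k)) :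
    stepAux (snap q) v S = stepAux q (tops S) S := by
  simp only [snap, stepAux_snapList, Finset.mem_toList, Finset.mem_univ, if_true]
  rfl

/-- The compiled program, with its labels embedded by `emb` and jumping to `next` at the end. -/
noncomputable def code [Fintype K] {Λ : Type} : (c : StackProg Γ) → (Lab c → Λ) → Λ → Lab c →
    Stmt Γ Λ (∀ k, Option (Γ k))
  | skip, _, next => fun _ => .goto fun _ => next
  | push k h, _, next => fun _ => snap (.push k h (.goto fun _ => next))
  | pop k, _, next => fun _ => .pop k (fun v _ => v) (.goto fun _ => next)
  | seq c d, emb, next => fun l => match l with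
    | Sum.inl l => code c (fun l => emb (Sum.inl l)) (emb (Sum.inr (entry d))) l
    | Sum.inr l => code d (fun l => emb (Sum.inr l)) next l
  | ite g c d, emb, next => fun l => match l with
    | none => snap (.branch g (.goto fun _ => emb (some (Sum.inl (entry c))))
        (.goto fun _ => emb (some (Sum.inr (entry d)))))
    | some (Sum.inl l) => code c (fun l => emb (some (Sum.inl l))) next l
    | some (Sum.inr l) => code d (fun l => emb (some (Sum.inr l))) next l
  | StackProg.while g c, emb, next => fun l => match l with
    | none => snap (.branch g (.goto fun _ => emb (some (entry c))) (.goto fun _ => next))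
    | some l => code c (fun l => emb (some l)) (emb none) l

/-- Induction on the execution. The machine, the embedding of the labels and the exit label are
arbitrary, so that the hypothesis applies to a subprogram inside a larger program. The internal
state may be arbitrary because pushes and branches read the tops afresh. -/
theorem Exec.reachesIn [Fintype K] {c : StackProg Γ} {S : ∀ k, List (Γ k)} {t : ℕ} {S' : ∀ k, List (Γ k)}
    (H : Exec c S t S') : ∀ {Λ : Type} (M : Λ → Stmt Γ Λ (∀ k, Option (Γ k)))
    (emb : Lab c → Λ) (next : Λ), (∀ l, M (emb l) = code c emb next l) →
    ∀ v, ∃ v', ReachesIn M ⟨some (emb (entry c)), v, S⟩ t ⟨some next, v', S'⟩ := by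
  induction H with
  | skip S =>
    intro Λ M emb next hM v
    exact ⟨v, .single (by rw [hM]; rfl)⟩
  | push k h S =>
    intro Λ M emb next hM v
    exact ⟨tops S, .single (by rw [hM]; simp [code, stepAux_snap])⟩
  | pop k S =>
    intro Λ M emb next hM v
    exact ⟨v, .single (by rw [hM]; simp [code])⟩
  | @seq c d S t S' t' S'' h1 h2 ih1 ih2 =>
    intro Λ M emb next hM v
    obtain ⟨v1, r1⟩ := ih1 M (fun l => emb (Sum.inl l)) (emb (Sum.inr (entry d)))
      (fun l => hM (Sum.inl l)) v
    obtain ⟨v2, r2⟩ := ih2 M (fun l => emb (Sum.inr l)) next (fun l => hM (Sum.inr l)) v1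
    exact ⟨v2, r1.trans r2⟩
  | @ite_true g c d S t S' hg h ih =>
    intro Λ M emb next hM v
    obtain ⟨v1, r1⟩ := ih M (fun l => emb (some (Sum.inl l))) next
      (fun l => hM (some (Sum.inl l))) (tops S)
    refine ⟨v1, ReachesIn.mono (ReachesIn.trans (.single (l := emb none) ?_) r1)
      (add_comm 1 t).le⟩
    rw [hM none]; simp [code, stepAux_snap, hg]
  | @ite_false g c d S t S' hg h ih =>
    intro Λ M emb next hM v
    obtain ⟨v1, r1⟩ := ih M (fun l => emb (some (Sum.inr l))) next
      (fun l => hM (some (Sum.inr l))) (tops S)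
    refine ⟨v1, ReachesIn.mono (ReachesIn.trans (.single (l := emb none) ?_) r1)
      (add_comm 1 t).le⟩
    rw [hM none]; simp [code, stepAux_snap, hg]
  | @while_false g c S hg =>
    intro Λ M emb next hM v
    exact ⟨tops S, .single (l := emb none) (by rw [hM none]; simp [code, stepAux_snap, hg])⟩
  | @while_true g c S t S' t' S'' hg h1 h2 ih1 ih2 =>
    intro Λ M emb next hM v
    obtain ⟨v1, r1⟩ := ih1 M (fun l => emb (some l)) (emb none) (fun l => hM (some l)) (tops S)
    obtain ⟨v2, r2⟩ := ih2 M emb next hM v1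
    have r0 : ReachesIn M ⟨some (emb none), v, S⟩ 1 ⟨some (emb (some (entry c))), tops S, S⟩ :=
      .single (by rw [hM none]; simp [code, stepAux_snap, hg])
    exact ⟨v2, ((r0.trans r1).trans r2).mono (by omega)⟩
  | mono _ ht ih =>
    intro Λ M emb next hM v
    obtain ⟨v1, r1⟩ := ih M emb next hM v
    exact ⟨v1, r1.mono ht⟩

/-- The Turing machine running a stack program. -/
noncomputable def toFinTM2 [Fintype K] [∀ k, Fintype (Γ k)] (c : StackProg Γ) (k₀ k₁ : K) : FinTM2 where
  K := K
  k₀ := k₀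
  k₁ := k₁
  Γ := Γ
  Λ := Option (Lab c)
  main := some (entry c)
  σ := ∀ k, Option (Γ k)
  initialState := fun _ => none
  m l := match l with
    | some l => code c some none l
    -- A halting configuration has to carry the initial internal state.
    | none => .load (fun _ _ => none) .halt

/-- The left side is the form of the stacks in the initial and halting configurations of a `FinTM2`.
-/
theorem dite_eq_update {k₀ : K} (w : List (Γ k₀)) :
    (fun k => @dite (List (Γ k)) (k = k₀) (inferInstance) (fun h => by rw [h]; exact w)
      fun _ => []) = Function.update (fun _ => []) k₀ w := by
  funext k
  by_cases hk : k = k₀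
  · subst hk
    simp
  · simp [hk]

/-- The additional step is the halting statement. All stacks except the output must be empty at the
end, so programs have to clean up after themselves. -/
theorem Exec.outputsInTime [Fintype K] [∀ k, Fintype (Γ k)] {c : StackProg Γ} {k₀ k₁ : K}
    {w : List (Γ k₀)} {w' : List (Γ k₁)} {t : ℕ}
    (H : Exec c (Function.update (fun _ => []) k₀ w) t (Function.update (fun _ => []) k₁ w')) :
    Nonempty (TM2OutputsInTime (toFinTM2 c k₀ k₁) w (some w') (t + 1)) := by
  rw [← dite_eq_update w, ← dite_eq_update w'] at H
  obtain ⟨v, hv⟩ := H.reachesIn (toFinTM2 c k₀ k₁).m some none (fun l => rfl) (fun _ => none)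
  obtain ⟨h⟩ := hv.trans (.single rfl)
  exact ⟨h⟩

end StackProg

/-! ### Macros on a concrete family of stacks -/

/-- The work stacks. -/
inductive WorkStack | E | X | Y | Z | F | T | M | M2 | N | C
  deriving DecidableEq

instance : Fintype WorkStack :=
  ⟨{.E, .X, .Y, .Z, .F, .T, .M, .M2, .N, .C}, fun r => by cases r <;> simp⟩

/-- The input stack, the output stack and the work stacks. -/
inductive Reg | inp | out | w (r : WorkStack)
  deriving DecidableEq

instance : Fintype Reg :=
  ⟨insert .inp (insert .out (Finset.univ.image .w)), fun r => by cases r <;> simp⟩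

/-- Work symbols: bits, a comma `some none` and an end marker `none`. -/
abbrev Symb := Option (Option Bool)

/-- The alphabets of the stacks. -/
def Alph : Reg → Type
  | .inp => Option Bool
  | .out => Bool
  | .w _ => Symb

instance : ∀ k, Fintype (Alph k)
  | .inp => inferInstanceAs (Fintype (Option Bool))
  | .out => inferInstanceAs (Fintype Bool)
  | .w _ => inferInstanceAs (Fintype Symb)

/-- The contents of all stacks. -/
structure Conf where
  inp : List (Option Bool) := []
  out : List Bool := []
  E : List Symb := []
  X : List Symb := []
  Y : List Symb := []
  Z : List Symb := []
  F : List Symb := []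
  T : List Symb := []
  M : List Symb := []
  M2 : List Symb := []
  N : List Symb := []
  C : List Symb := []

namespace Conf

/-- The contents of a work stack. -/
def get (s : Conf) : WorkStack → List Symb
  | .E => s.E
  | .X => s.X
  | .Y => s.Y
  | .Z => s.Z
  | .F => s.F
  | .T => s.T
  | .M => s.M
  | .M2 => s.M2
  | .N => s.N
  | .C => s.C

/-- Replace the contents of a work stack. -/
def set (s : Conf) (A : WorkStack) (l : List Symb) : Conf :=
  match A with
  | .E => {s with E := l}
  | .X => {s with X := l}
  | .Y => {s with Y := l}
  | .Z => {s with Z := l}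
  | .F => {s with F := l}
  | .T => {s with T := l}
  | .M => {s with M := l}
  | .M2 => {s with M2 := l}
  | .N => {s with N := l}
  | .C => {s with C := l}

/-- The contents of all stacks as a function. -/
def fn (s : Conf) : ∀ k, List (Alph k)
  | .inp => s.inp
  | .out => s.out
  | .w A => s.get A

variable (s : Conf)

@[simp] theorem get_E : s.get .E = s.E := rfl
@[simp] theorem get_X : s.get .X = s.X := rfl
@[simp] theorem get_Y : s.get .Y = s.Y := rfl
@[simp] theorem get_Z : s.get .Z = s.Z := rfl
@[simp] theorem get_F : s.get .F = s.F := rfl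
@[simp] theorem get_T : s.get .T = s.T := rfl
@[simp] theorem get_M : s.get .M = s.M := rfl
@[simp] theorem get_M2 : s.get .M2 = s.M2 := rfl
@[simp] theorem get_N : s.get .N = s.N := rfl
@[simp] theorem get_C : s.get .C = s.C := rfl
@[simp] theorem set_E (l : List Symb) : s.set .E l = {s with E := l} := rfl
@[simp] theorem set_X (l : List Symb) : s.set .X l = {s with X := l} := rfl
@[simp] theorem set_Y (l : List Symb) : s.set .Y l = {s with Y := l} := rfl
@[simp] theorem set_Z (l : List Symb) : s.set .Z l = {s with Z := l} := rfl
@[simp] theorem set_F (l : List Symb) : s.set .F l = {s with F := l} := rfl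
@[simp] theorem set_T (l : List Symb) : s.set .T l = {s with T := l} := rfl
@[simp] theorem set_M (l : List Symb) : s.set .M l = {s with M := l} := rfl
@[simp] theorem set_M2 (l : List Symb) : s.set .M2 l = {s with M2 := l} := rfl
@[simp] theorem set_N (l : List Symb) : s.set .N l = {s with N := l} := rfl
@[simp] theorem set_C (l : List Symb) : s.set .C l = {s with C := l} := rfl

@[simp] theorem get_set_self (A : WorkStack) (l : List Symb) : (s.set A l).get A = l := by
  cases A <;> rfl

@[simp] theorem set_get (A : WorkStack) : s.set A (s.get A) = s := by
  cases A <;> rfl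

@[simp] theorem set_set (A : WorkStack) (l l' : List Symb) : (s.set A l).set A l' = s.set A l' := by
  cases A <;> rfl

theorem get_set_ne {A B : WorkStack} (h : A ≠ B) (l : List Symb) :
    (s.set A l).get B = s.get B := by
  cases A <;> cases B <;> first | rfl | exact absurd rfl h

theorem set_comm {A B : WorkStack} (h : A ≠ B) (l l' : List Symb) :
    (s.set A l).set B l' = (s.set B l').set A l := by
  cases A <;> cases B <;> first | rfl | exact absurd rfl h

theorem update_work (A : WorkStack) (l : List Symb) :
    Function.update s.fn (.w A) l = (s.set A l).fn := by
  funext k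
  rcases k with _ | _ | B
  · cases A <;> rfl
  · cases A <;> rfl
  · by_cases h : A = B
    · subst h
      exact (Function.update_self (β := fun k => List (Alph k)) _ _ _).trans
        (s.get_set_self A l).symm
    · exact (Function.update_of_ne (β := fun k => List (Alph k)) (by simpa using Ne.symm h)
        _ _).trans (s.get_set_ne h l).symm

theorem update_inp (l : List (Option Bool)) :
    Function.update s.fn .inp l = ({s with inp := l} : Conf).fn := by
  funext k; rcases k with _ | _ | r <;> (try cases r) <;> rfl

theorem update_out (l : List Bool) :
    Function.update s.fn .out l = ({s with out := l} : Conf).fn := by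
  funext k; rcases k with _ | _ | r <;> (try cases r) <;> rfl

end Conf

namespace StackProg

abbrev Prog := StackProg Alph

open WorkStack

/-- The top of a work stack. -/
def top (A : WorkStack) (v : ∀ k, Option (Alph k)) : Option Symb := v (.w A)

@[simp] theorem top_tops (A : WorkStack) (s : Conf) : top A (tops s.fn) = (s.get A).head? := rfl

/-- The program `c` turns the stacks `s` into `s'` within `t` steps. -/
def Runs (c : Prog) (s : Conf) (t : ℕ) (s' : Conf) : Prop := Exec c s.fn t s'.fn

namespace Runs

theorem cast {c : Prog} {s s' s'' : Conf} {t t' : ℕ} (h : Runs c s t s')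
    (hS : s' = s'') (ht : t ≤ t') : Runs c s t' s'' := hS ▸ Exec.mono h ht

theorem skip (s : Conf) : Runs StackProg.skip s 1 s := Exec.skip _

theorem seq {c d : Prog} {s s' s'' : Conf} {t t' : ℕ} (h : Runs c s t s') (h' : Runs d s' t' s'') :
    Runs (StackProg.seq c d) s (t + t') s'' := Exec.seq h h'

theorem ite_true {g : (∀ k, Option (Alph k)) → Bool} {c d : Prog} {s s' : Conf} {t : ℕ}
    (hg : g (tops s.fn) = true) (h : Runs c s t s') : Runs (ite g c d) s (t + 1) s' :=
  Exec.ite_true hg h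

theorem ite_false {g : (∀ k, Option (Alph k)) → Bool} {c d : Prog} {s s' : Conf} {t : ℕ}
    (hg : g (tops s.fn) = false) (h : Runs d s t s') : Runs (ite g c d) s (t + 1) s' :=
  Exec.ite_false hg h

theorem while_false {g : (∀ k, Option (Alph k)) → Bool} {c : Prog} {s : Conf}
    (hg : g (tops s.fn) = false) : Runs (StackProg.while g c) s 1 s :=
  Exec.while_false hg

theorem while_true {g : (∀ k, Option (Alph k)) → Bool} {c : Prog} {s s' s'' : Conf} {t t' : ℕ}
    (hg : g (tops s.fn) = true) (h : Runs c s t s') (h' : Runs (StackProg.while g c) s' t' s'') :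
    Runs (StackProg.while g c) s (t + 1 + t') s'' :=
  Exec.while_true hg h h'

theorem push (A : WorkStack) (h : (∀ k, Option (Alph k)) → Symb) (s : Conf) :
    Runs (StackProg.push (.w A) h) s 1 (s.set A (h (tops s.fn) :: s.get A)) := by
  unfold Runs
  rw [← Conf.update_work]
  exact Exec.push (Γ := Alph) (.w A) h s.fn

theorem pop (A : WorkStack) (s : Conf) :
    Runs (StackProg.pop (.w A)) s 1 (s.set A (s.get A).tail) := by
  unfold Runs
  rw [← Conf.update_work]
  exact Exec.pop (Γ := Alph) (.w A) s.fn

theorem pop_inp (s : Conf) :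
    Runs (StackProg.pop .inp) s 1 {s with inp := s.inp.tail} := by
  unfold Runs
  rw [← Conf.update_inp s s.inp.tail]
  exact Exec.pop (Γ := Alph) .inp s.fn

theorem push_inp (h : (∀ k, Option (Alph k)) → Option Bool) (s : Conf) :
    Runs (StackProg.push .inp h) s 1 {s with inp := h (tops s.fn) :: s.inp} := by
  unfold Runs
  rw [← Conf.update_inp s (h (tops s.fn) :: s.inp)]
  exact Exec.push (Γ := Alph) .inp h s.fn

theorem push_out (h : (∀ k, Option (Alph k)) → Bool) (s : Conf) :
    Runs (StackProg.push .out h) s 1 {s with out := h (tops s.fn) :: s.out} := by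
  unfold Runs
  rw [← Conf.update_out s (h (tops s.fn) :: s.out)]
  exact Exec.push (Γ := Alph) .out h s.fn

end Runs

/-- Push a constant symbol. -/
def pushc (A : WorkStack) (a : Symb) : Prog := push (.w A) (fun _ => a)

/-- Copy the top of `A` to `B`. -/
def copyTop (A B : WorkStack) : Prog := push (.w B) (fun v => (top A v).getD none)

/-- Move the top of `A` to `B`. -/
def moveTop (A B : WorkStack) : Prog := seq (copyTop A B) (pop (.w A))

theorem runs_pushc (A : WorkStack) (a : Symb) (s : Conf) :
    Runs (pushc A a) s 1 (s.set A (a :: s.get A)) :=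
  Runs.push _ _ _

theorem runs_copyTop {A B : WorkStack} {s : Conf} {a : Symb} {l : List Symb}
    (h : s.get A = a :: l) : Runs (copyTop A B) s 1 (s.set B (a :: s.get B)) :=
  (Runs.push _ _ _).cast (by simp [h]) le_rfl

theorem runs_moveTop {A B : WorkStack} (hAB : A ≠ B) {s : Conf} {a : Symb}
    {l : List Symb} (h : s.get A = a :: l) :
    Runs (moveTop A B) s 2 ((s.set A l).set B (a :: s.get B)) := by
  refine ((runs_copyTop (B := B) h).seq (Runs.pop A _)).cast ?_ le_rfl
  rw [Conf.get_set_ne _ hAB.symm, h, Conf.set_comm _ hAB.symm]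
  rfl

/-- Empty the work stack `A`. -/
def clear (A : WorkStack) : Prog := .while (fun v => (top A v).isSome) (pop (.w A))

theorem runs_clear (A : WorkStack) (s : Conf) :
    Runs (clear A) s (2 * (s.get A).length + 1) (s.set A []) := by
  generalize hl : s.get A = l
  induction l generalizing s with
  | nil =>
    refine (Runs.while_false (by simp [hl])).cast ?_ (by simp)
    rw [← hl, Conf.set_get]
  | cons a l ih =>
    refine (Runs.while_true (by simp [hl]) (Runs.pop A s)
      (ih (s.set A (s.get A).tail) (by simp [hl]))).cast ?_ (by simp; omega)
    simp

/-- Move the contents of `A` to `B`, reversing their order. -/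
def mv (A B : WorkStack) : Prog := .while (fun v => (top A v).isSome) (moveTop A B)

theorem runs_mv {A B : WorkStack} (hAB : A ≠ B) {s : Conf} {a : List Symb} (h : s.get A = a) :
    Runs (mv A B) s (3 * a.length + 1) ((s.set A []).set B (a.reverse ++ s.get B)) := by
  induction a generalizing s with
  | nil =>
    refine (Runs.while_false (by simp [h])).cast ?_ (by simp)
    rw [← h, Conf.set_get, h]; simp
  | cons a l ih =>
    refine (Runs.while_true (by simp [h]) (runs_moveTop hAB h) (ih ?_)).cast ?_ (by simp; omega)
    · rw [Conf.get_set_ne _ hAB.symm, Conf.get_set_self]; try rfl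
    · rw [Conf.get_set_self, Conf.set_comm _ hAB.symm, Conf.set_set, Conf.set_set]
      simp

/-- Move the symbols of `A` before the first end marker to `B`, reversing their order. -/
def mvw (A B : WorkStack) : Prog := .while (fun v => top A v != some none) (moveTop A B)

theorem runs_mvw {A B : WorkStack} (hAB : A ≠ B) {s : Conf} {a r : List Symb}
    (ha : none ∉ a) (h : s.get A = a ++ none :: r) :
    Runs (mvw A B) s (3 * a.length + 1) ((s.set A (none :: r)).set B (a.reverse ++ s.get B)) := by
  induction a generalizing s with
  | nil =>
    refine (Runs.while_false (by simp [h])).cast ?_ (by simp)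
    rw [List.nil_append] at h
    rw [← h]; simp
  | cons a l ih =>
    simp only [List.mem_cons, not_or] at ha
    refine (Runs.while_true (by simpa [h] using Ne.symm ha.1) (runs_moveTop hAB h)
      (ih ha.2 ?_)).cast ?_ (by simp; omega)
    · rw [Conf.get_set_ne _ hAB.symm, Conf.get_set_self]; try rfl
    · rw [Conf.get_set_self, Conf.set_comm _ hAB.symm, Conf.set_set, Conf.set_set]
      simp

/-- Move the word on top of `A` to the top of `B`, without its end marker. -/
def pull (A B : WorkStack) : Prog := seq (mvw A T) (seq (pop (.w A)) (mv T B))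

theorem runs_pull {A B : WorkStack} (hA : A ≠ T) (hB : B ≠ T) (hAB : A ≠ B)
    {s : Conf} {a r : List Symb} (ha : none ∉ a) (h : s.get A = a ++ none :: r) (hT : s.T = []) :
    Runs (pull A B) s (6 * a.length + 3) ((s.set A r).set B (a ++ s.get B)) := by
  refine ((runs_mvw hA ha h).seq ((Runs.pop _ _).seq (runs_mv (a := a.reverse) hB.symm ?_))).cast
    ?_ (by simp; omega)
  · rw [Conf.get_set_ne _ hA, Conf.get_set_self, Conf.get_T, hT, List.append_nil]
  · have hC : ((s.set A (none :: r)).set T (a.reverse ++ s.get T)).set A r = (s.set A r).set T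
        (a.reverse ++ s.get T) := by
      rw [Conf.set_comm _ hA.symm, Conf.set_set]
    have hT' : s.set T [] = s := by rw [← hT]; exact s.set_get T
    simp only [Conf.get_set_ne _ hA.symm, Conf.get_set_self, List.tail_cons, hC, Conf.set_set,
      List.reverse_reverse, Conf.get_set_ne _ hB.symm, Conf.get_set_ne _ hAB]
    rw [Conf.set_comm _ hA, hT']

end StackProg

namespace StackProg

open WorkStack

/-! ### Binary numbers on stacks -/

/-- The work symbol of a bit. -/
abbrev fl (b : Bool) : Symb := some (some b)

/-- The binary digits of `n`, the least significant first. -/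
def nb (n : ℕ) : List Symb := n.bits.map fl

@[simp] theorem nb_zero : nb 0 = [] := by simp [nb]

theorem nb_of_ne_zero {n : ℕ} (h : n ≠ 0) : nb n = fl (decide (n % 2 = 1)) :: nb (n / 2) := by
  obtain ⟨b, m, rfl⟩ : ∃ b m, n = Nat.bit b m := ⟨n.bodd, n.div2, (Nat.bit_bodd_div2 n).symm⟩
  have h' : m = 0 → b = true := by
    rintro rfl
    cases b <;> simp_all
  rw [nb, Nat.bits_append_bit m b h', List.map_cons, nb]
  cases b <;> simp [Nat.bit_val]
  congr 3; omega

@[simp] theorem nb_head_isSome (n : ℕ) : (nb n).head?.isSome = decide (n ≠ 0) := by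
  by_cases h : n = 0
  · simp [h]
  · simp [nb_of_ne_zero h, h]

@[simp] theorem nb_head_eq (n : ℕ) : ((nb n).head? == some (fl true)) = decide (n % 2 = 1) := by
  by_cases h : n = 0
  · simp [h]
  · by_cases h' : n % 2 = 1 <;> simp [nb_of_ne_zero h, h']

@[simp] theorem nb_tail (n : ℕ) : (nb n).tail = nb (n / 2) := by
  by_cases h : n = 0
  · simp [h]
  · simp [nb_of_ne_zero h]

theorem none_notMem_nb (n : ℕ) : none ∉ nb n := by simp [nb]

theorem comma_notMem_nb (n : ℕ) : (some none : Symb) ∉ nb n := by simp [nb]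

theorem nb_injective : Function.Injective nb := by
  intro a b h
  have : a.bits = b.bits := List.map_injective_iff.2 (fun x y hxy => by simpa using hxy) h
  exact Nat.eq_of_testBit_eq fun i => by rw [Nat.testBit_eq_inth, Nat.testBit_eq_inth, this]

theorem length_nb_le {n z : ℕ} (h : n < 2 ^ z) : (nb n).length ≤ z := by
  rw [nb, List.length_map, Nat.size_eq_bits_len]
  exact Nat.size_le.2 h

/-- Whether the top of `A` is the bit `true`. -/
def isT (A : WorkStack) (v : ∀ k, Option (Alph k)) : Bool := top A v == some (fl true)

@[simp] theorem isT_tops (A : WorkStack) (s : Conf) :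
    isT A (tops s.fn) = ((s.get A).head? == some (fl true)) := rfl

/-- Replace the top of `F` by the bit computed by `g`. -/
def setF (g : (∀ k, Option (Alph k)) → Bool) : Prog :=
  ite g (seq (pop (.w F)) (pushc F (fl true))) (seq (pop (.w F)) (pushc F (fl false)))

theorem runs_setF (g : (∀ k, Option (Alph k)) → Bool) (s : Conf) :
    Runs (setF g) s 3 {s with F := fl (g (tops s.fn)) :: s.F.tail} := by
  cases h : g (tops s.fn)
  · exact (Runs.ite_false h ((Runs.pop F s).seq (runs_pushc _ _ _))).cast (by simp) (by simp)
  · exact (Runs.ite_true h ((Runs.pop F s).seq (runs_pushc _ _ _))).cast (by simp) (by simp)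

/-- Add the numbers on `X` and `Y` and the carry on `F`; the reversed sum is put on `Z`. -/
def addLoop : Prog :=
  .while (fun v => (top X v).isSome || (top Y v).isSome || isT F v)
    (seq (push (.w Z) (fun v => fl (xor (isT X v) (xor (isT Y v) (isT F v)))))
    (seq (setF (fun v => (isT X v && isT Y v) || (isT X v && isT F v) || (isT Y v && isT F v)))
    (seq (pop (.w X)) (pop (.w Y)))))

/-- The loop stops as soon as both numbers and the carry vanish, so no leading zero is written and
the result is the canonical word `nb`. A bound on the sum bounds the number of its digits, hence of
iterations. -/
theorem runs_addLoop (k : ℕ) : ∀ (a b : ℕ) (c : Bool) (s : Conf), a + b + c.toNat < 2 ^ k →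
    s.X = nb a → s.Y = nb b → s.F = [fl c] →
    Runs addLoop s (7 * k + 1) {s with
      X := [], Y := [], F := [fl false], Z := (nb (a + b + c.toNat)).reverse ++ s.Z} := by
  induction k with
  | zero =>
    intro a b c s h hX hY hF
    obtain ⟨rfl, rfl, rfl⟩ : a = 0 ∧ b = 0 ∧ c = false := by
      cases c <;> simp at h ⊢
      exact h
    refine (Runs.while_false (by simp [hX, hY, hF])).cast ?_ le_rfl
    simp only [nb_zero] at hX hY
    obtain ⟨⟩ := s
    simp_all
  | succ k ih =>
    intro a b c s h hX hY hF
    by_cases h0 : a + b + c.toNat = 0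
    · have : a + b + c.toNat < 2 ^ k := by rw [h0]; positivity
      exact (ih a b c s this hX hY hF).cast rfl (by omega)
    · set c' : Bool := (decide (a % 2 = 1) && decide (b % 2 = 1)) || (decide (a % 2 = 1) && c) ||
        (decide (b % 2 = 1) && c) with hc'
      -- The full adder: this is the carry equation, and `hdig` is the digit equation.
      have hsum : a / 2 + b / 2 + c'.toNat = (a + b + c.toNat) / 2 := by
        rcases Nat.mod_two_eq_zero_or_one a with ha | ha <;>
        rcases Nat.mod_two_eq_zero_or_one b with hb | hb <;> cases c <;>
        simp [hc', ha, hb] <;> omega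
      have hdig : (xor (decide (a % 2 = 1)) (xor (decide (b % 2 = 1)) c)) =
          decide ((a + b + c.toNat) % 2 = 1) := by
        rcases Nat.mod_two_eq_zero_or_one a with ha | ha <;>
        rcases Nat.mod_two_eq_zero_or_one b with hb | hb <;> cases c <;>
        simp [ha, hb] <;> omega
      have hg : a ≠ 0 ∨ b ≠ 0 ∨ c = true := by
        by_contra! hh
        apply h0
        simp [hh.1, hh.2.1, hh.2.2]
      have hcc : (([fl c] : List Symb).head? == some (fl true)) = c := by cases c <;> rfl
      refine (Runs.while_true (by simp [hX, hY, hF]; tauto)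
        ((Runs.push Z _ s).seq ((runs_setF _ _).seq ((Runs.pop X _).seq (Runs.pop Y _))))
        (ih (a / 2) (b / 2) c' _ ?_ ?_ ?_ ?_)).cast ?_ ?_
      · rw [hsum, Nat.div_lt_iff_lt_mul (by norm_num), ← pow_succ]; exact h
      · simp [hX]
      · simp [hY]
      · simp [hX, hY, hF, hc']
      · rw [hsum]
        simp only [Conf.set_X, Conf.set_Y, Conf.set_Z, Conf.get_Z, isT_tops, Conf.get_X, Conf.get_Y,
          Conf.get_F, hX, hY, hF, nb_head_eq, hcc, hdig]
        rw [nb_of_ne_zero h0]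
        simp
      · omega

/-- Update the flag on `F` with `φ` along the digits of the numbers on `X` and `Y`. -/
def cmpLoop (φ : Bool → Bool → Bool → Bool) : Prog :=
  .while (fun v => (top X v).isSome || (top Y v).isSome)
    (seq (setF (fun v => φ (isT X v) (isT Y v) (isT F v))) (seq (pop (.w X)) (pop (.w Y))))

/-- Digits arrive with the least significant one first, and the flag is carried towards the higher
ones. The hypotheses say that `ρ` is computed digit by digit; order and equality are both of this
kind. -/
theorem runs_cmpLoop {φ : Bool → Bool → Bool → Bool} {ρ : ℕ → ℕ → Bool → Bool}
    (h0 : ∀ f, ρ 0 0 f = f)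
    (h1 : ∀ a b f, ρ a b f = ρ (a / 2) (b / 2) (φ (decide (a % 2 = 1)) (decide (b % 2 = 1)) f))
    (k : ℕ) : ∀ (a b : ℕ) (c : Bool) (s : Conf), a < 2 ^ k → b < 2 ^ k →
    s.X = nb a → s.Y = nb b → s.F = [fl c] →
    Runs (cmpLoop φ) s (6 * k + 1) {s with X := [], Y := [], F := [fl (ρ a b c)]} := by
  induction k with
  | zero =>
    intro a b c s ha hb hX hY hF
    obtain ⟨rfl, rfl⟩ : a = 0 ∧ b = 0 := by simp at ha hb; exact ⟨ha, hb⟩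
    refine (Runs.while_false (by simp [hX, hY])).cast ?_ le_rfl
    simp only [nb_zero] at hX hY
    rw [h0]
    clear h0 h1
    obtain ⟨⟩ := s
    simp_all
  | succ k ih =>
    intro a b c s ha hb hX hY hF
    by_cases hab : a = 0 ∧ b = 0
    · obtain ⟨rfl, rfl⟩ := hab
      exact (ih 0 0 c s (by positivity) (by positivity) hX hY hF).cast rfl (by omega)
    · have hcc : (([fl c] : List Symb).head? == some (fl true)) = c := by cases c <;> rfl
      refine (Runs.while_true (by simp [hX, hY]; tauto)
        ((runs_setF _ _).seq ((Runs.pop X _).seq (Runs.pop Y _)))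
        (ih (a / 2) (b / 2) (φ (decide (a % 2 = 1)) (decide (b % 2 = 1)) c)
        _ ?_ ?_ ?_ ?_ ?_)).cast ?_ (by omega)
      · rw [Nat.div_lt_iff_lt_mul (by norm_num), ← pow_succ]; exact ha
      · rw [Nat.div_lt_iff_lt_mul (by norm_num), ← pow_succ]; exact hb
      · simp [hX]
      · simp [hY]
      · simp [hX, hY, hF]
      · rw [h1 a b c]
        simp

/-! ### The memory -/

/-- The written form of a memory address. -/
def keyWord (k : ℕ × ℕ × ℕ) : List Symb :=
  nb k.1 ++ some none :: (nb k.2.1 ++ some none :: nb k.2.2)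

theorem append_cons_inj {α : Type} {c : α} : ∀ {a a' b b' : List α}, c ∉ a → c ∉ a' →
    a ++ c :: b = a' ++ c :: b' → a = a' ∧ b = b'
  | [], [], _, _, _, _, h => by simpa using h
  | [], x :: a', _, _, _, h2, h => by
    simp only [List.nil_append, List.cons_append, List.cons.injEq] at h
    simp [← h.1] at h2
  | x :: a, [], _, _, h1, _, h => by
    simp only [List.nil_append, List.cons_append, List.cons.injEq] at h
    simp [h.1] at h1
  | x :: a, y :: a', _, _, h1, h2, h => by
    simp only [List.cons_append, List.cons.injEq] at h
    simp only [List.mem_cons, not_or] at h1 h2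
    obtain ⟨e1, e2⟩ := append_cons_inj h1.2 h2.2 h.2
    exact ⟨by rw [h.1, e1], e2⟩

/-- Digits are never commas, so the word splits uniquely at its commas. Hence addresses can be
compared as words. -/
theorem keyWord_injective : Function.Injective keyWord := by
  rintro ⟨a, b, c⟩ ⟨a', b', c'⟩ h
  obtain ⟨h1, h⟩ := append_cons_inj (comma_notMem_nb _) (comma_notMem_nb _) h
  obtain ⟨h2, h3⟩ := append_cons_inj (comma_notMem_nb _) (comma_notMem_nb _) h
  simp only at h1 h2 h3
  rw [nb_injective h1, nb_injective h2, nb_injective h3]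

theorem none_notMem_keyWord (k : ℕ × ℕ × ℕ) : none ∉ keyWord k := by
  simp [keyWord, none_notMem_nb]

/-- The written form of a list of memory records. -/
def memWord (recs : List ((ℕ × ℕ × ℕ) × ℕ)) : List Symb :=
  recs.flatMap fun r => keyWord r.1 ++ none :: (nb r.2 ++ [none])

/-- The value at an address: that of the last record with this address. -/
def lookupFrom (recs : List ((ℕ × ℕ × ℕ) × ℕ)) (k : ℕ × ℕ × ℕ) (v : ℕ) : ℕ :=
  recs.foldl (fun acc r => if r.1 = k then r.2 else acc) v

/-- The contents of the memory with the given records. -/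
def memOf (recs : List ((ℕ × ℕ × ℕ) × ℕ)) (t i j : ℕ) : ℕ := lookupFrom recs (t, i, j) 0

/-- Compare the word on `M` with the word on `X`. -/
def cmpKey : Prog :=
  .while (fun v => top M v != some none)
    (seq (ite (fun v => top M v != top X v) (seq (pop (.w F)) (pushc F (fl false))) skip)
    (seq (ite (fun v => (top X v).isSome) (moveTop X Y) skip) (moveTop M M2)))

/-- If `X` is too short, its missing top matches no symbol and the flag becomes `false`. If it is
too long, a remainder stays on `X`, for which the caller must test. Consumed symbols are kept on
`M2` and `Y` so that both words can be restored. -/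
theorem runs_cmpKey {r : List Symb} (k : List Symb) (hk : none ∉ k) :
    ∀ (s : Conf) (f : Bool), s.M = k ++ none :: r → s.F = [fl f] →
    Runs cmpKey s (9 * k.length + 1) {s with
      M := none :: r, M2 := k.reverse ++ s.M2, X := s.X.drop k.length,
      Y := (s.X.take k.length).reverse ++ s.Y,
      F := [fl (f && decide (s.X.take k.length = k))]} := by
  induction k with
  | nil =>
    intro s f hM hF
    refine (Runs.while_false (by simp [hM])).cast ?_ (by simp)
    rw [List.nil_append] at hM
    simp [← hM, ← hF]
  | cons a k ih =>
    intro s f hM hF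
    simp only [List.mem_cons, not_or] at hk
    have hA : Runs (ite (fun v => top M v != top X v)
        (seq (pop (.w F)) (pushc F (fl false))) skip) s 3
        {s with F := [fl (f && decide (s.X.head? = some a))]} := by
      by_cases h : s.X.head? = some a
      · exact (Runs.ite_false (by simp [hM, h]) (Runs.skip _)).cast (by simp [h, ← hF]) (by simp)
      · exact (Runs.ite_true (by simpa [hM] using Ne.symm h)
          ((Runs.pop F s).seq (runs_pushc _ _ _))).cast (by simp [h, hF]) (by simp)
    have hB : ∀ s' : Conf, Runs (ite (fun v => (top X v).isSome) (moveTop X Y) skip) s' 3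
        {s' with X := s'.X.tail, Y := s'.X.head?.toList ++ s'.Y} := by
      intro s'
      cases h : s'.X with
      | nil =>
        exact (Runs.ite_false (by simp [h]) (Runs.skip _)).cast (by obtain ⟨⟩ := s'; simp_all) (by simp)
      | cons b l =>
        exact (Runs.ite_true (by simp [h]) (runs_moveTop (by simp) (s := s') (A := X) h)).cast
          (by simp) (by simp)
    refine (Runs.while_true (by simpa [hM] using Ne.symm hk.1)
      (hA.seq ((hB _).seq (runs_moveTop (A := M) (B := M2) (by simp) (a := a)
      (l := k ++ none :: r) (by simpa using hM))))
      (ih hk.2 _ (f && decide (s.X.head? = some a)) (by simp) (by simp))).cast ?_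
      (by simp; omega)
    cases h : s.X with
    | nil => simp
    | cons b l =>
      by_cases hab : b = a <;> simp [hab]

/-- Copy the word on `M` to `Z`, moving it to `M2`. -/
def copyWord : Prog :=
  .while (fun v => top M v != some none) (seq (copyTop M Z) (moveTop M M2))

theorem runs_copyWord {r : List Symb} (k : List Symb) (hk : none ∉ k) :
    ∀ (s : Conf), s.M = k ++ none :: r →
    Runs copyWord s (4 * k.length + 1) {s with
      M := none :: r, M2 := k.reverse ++ s.M2, Z := k.reverse ++ s.Z} := by
  induction k with
  | nil =>
    intro s hM
    refine (Runs.while_false (by simp [hM])).cast ?_ (by simp)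
    rw [List.nil_append] at hM
    simp [← hM]
  | cons a k ih =>
    intro s hM
    simp only [List.mem_cons, not_or] at hk
    refine (Runs.while_true (by simpa [hM] using Ne.symm hk.1)
      ((runs_copyTop (A := M) (B := Z) hM).seq (runs_moveTop (A := M) (B := M2) (by simp) (a := a)
      (l := k ++ none :: r) (by simpa using hM)))
      (ih hk.2 _ (by simp))).cast ?_ (by simp; omega)
    simp

/-- Process a memory record: if its address is the word on `X`, put its value on `Z`. -/
def scanRecord : Prog :=
  seq (pushc F (fl true)) <| seq cmpKey <|
  seq (ite (fun v => (top X v).isSome) (seq (pop (.w F)) (pushc F (fl false))) skip) <|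
  seq (mv Y X) <| seq (moveTop M M2) <|
  seq (ite (isT F) (seq (clear Z) copyWord) (mvw M M2)) <|
  seq (moveTop M M2) (pop (.w F))

/-- A match replaces the value found earlier on `Z`; the bound on `Z` pays for discarding it. -/
theorem runs_scanRecord (s : Conf) {k v r : List Symb} (hk : none ∉ k) (hv : none ∉ v) {B : ℕ}
    (hkB : k.length ≤ B) (hvB : v.length ≤ B) (hzB : s.Z.length ≤ B)
    (hM : s.M = k ++ none :: (v ++ none :: r)) (hF : s.F = []) (hY : s.Y = []) :
    Runs scanRecord s (20 * B + 20) {s with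
      M := r, M2 := (k ++ none :: (v ++ [none])).reverse ++ s.M2,
      Z := if s.X = k then v.reverse else s.Z} := by
  -- Equality of words is agreement of the compared prefix together with an empty remainder.
  have key : (decide (s.X.take k.length = k) && !(s.X.drop k.length).head?.isSome) =
      decide (s.X = k) := by
    rw [Bool.eq_iff_iff]
    simp only [Bool.and_eq_true, decide_eq_true_eq, Bool.not_eq_true', Option.isSome_eq_false_iff,
      Option.isNone_iff_eq_none, List.head?_eq_none_iff]
    constructor
    · rintro ⟨h1, h2⟩
      have := List.take_append_drop k.length s.X
      rw [h1, h2] at this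
      simpa using this.symm
    · intro h
      rw [h]; simp
  have hA : ∀ (s' : Conf) (f : Bool), s'.F = [fl f] →
      Runs (ite (fun v => (top X v).isSome) (seq (pop (.w F)) (pushc F (fl false))) skip) s' 3
        {s' with F := [fl (f && !s'.X.head?.isSome)]} := by
    intro s' f hF
    cases h : s'.X.head?.isSome
    · exact (Runs.ite_false (by simp [h]) (Runs.skip _)).cast (by obtain ⟨⟩ := s'; simp_all) (by simp)
    · exact (Runs.ite_true (by simp [h])
        ((Runs.pop F s').seq (runs_pushc _ _ _))).cast (by simp [hF]) (by simp)
  have hB : ∀ (s' : Conf) (f : Bool), s'.F = [fl f] → s'.M = v ++ none :: r → s'.Z = s.Z →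
      Runs (ite (isT F) (seq (clear Z) copyWord) (mvw M M2)) s' (6 * B + 3)
        {s' with M := none :: r, M2 := v.reverse ++ s'.M2,
                 Z := if f then v.reverse else s'.Z} := by
    intro s' f hF hM hZ
    cases f
    · exact (Runs.ite_false (by simp [hF]) (runs_mvw (by simp) hv (by simpa using hM))).cast
        (by simp) (by omega)
    · exact (Runs.ite_true (by simp [hF]) ((runs_clear Z s').seq (runs_copyWord v hv _
        (by simpa using hM)))).cast (by simp) (by simp [hZ]; omega)
  refine ((runs_pushc F _ s).seq <| (runs_cmpKey k hk _ true (by simpa using hM)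
    (by simp [hF])).seq <| (hA _ _ rfl).seq <| (runs_mv (by simp) rfl).seq <|
    (runs_moveTop (by simp) (by simp; exact ⟨rfl, rfl⟩)).seq <|
    (hB _ (decide (s.X = k)) ?_ ?_ ?_).seq <|
    (runs_moveTop (by simp) (by simp; exact ⟨rfl, rfl⟩)).seq (Runs.pop F _)).cast ?_ ?_
  · simp [← key]
    congr!
  · simp
  · simp
  · have e := List.take_append_drop k.length s.X
    simp [hY, hF, e]
  · have : (s.X.take k.length).length ≤ B := (List.length_take_le _ _).trans hkB
    simp [hY] at this ⊢
    omega

end StackProg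

/-! ### A programming language whose programs run in polynomial time -/

/-- Expressions over a memory with addresses consisting of a table number and two indices. -/
inductive Expr
  | const (n : ℕ)
  | get (t : ℕ) (e₁ e₂ : Expr)
  | add (e₁ e₂ : Expr)
  | lt (e₁ e₂ : Expr)
  | eq (e₁ e₂ : Expr)

/-- The value of an expression. -/
def Expr.eval (m : ℕ → ℕ → ℕ → ℕ) : Expr → ℕ
  | const n => n
  | get t e₁ e₂ => m t (e₁.eval m) (e₂.eval m)
  | add e₁ e₂ => e₁.eval m + e₂.eval m
  | lt e₁ e₂ => if e₁.eval m < e₂.eval m then 1 else 0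
  | eq e₁ e₂ => if e₁.eval m = e₂.eval m then 1 else 0

/-- A size measure of expressions. -/
def Expr.size : Expr → ℕ
  | const n => n + 1
  | get t e₁ e₂ => e₁.size + e₂.size + t + 1
  | add e₁ e₂ => e₁.size + e₂.size + 1
  | lt e₁ e₂ => e₁.size + e₂.size + 1
  | eq e₁ e₂ => e₁.size + e₂.size + 1

/-- Commands: assignments, choices, a loop with a fixed number of iterations, reading an input
symbol, writing an output bit. -/
inductive Cmd
  | skip
  | seq (c d : Cmd)
  | set (t : ℕ) (e₁ e₂ e : Expr)
  | ite (e : Expr) (c d : Cmd)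
  | loop (c : Cmd)
  | read (t : ℕ)
  | out (e : Expr)

/-- A state: the memory, the remaining input, and the output written so far. -/
@[ext] structure MemState where
  mem : ℕ → ℕ → ℕ → ℕ
  inp : List (Option Bool)
  out : List Bool

/-- The memory after writing `v` at an address. -/
def setMem (m : ℕ → ℕ → ℕ → ℕ) (t i j v : ℕ) : ℕ → ℕ → ℕ → ℕ :=
  fun t' i' j' => if t' = t ∧ i' = i ∧ j' = j then v else m t' i' j'

/-- The number that represents an input symbol. -/
def inputCode : Option (Option Bool) → ℕ
  | none => 0
  | some none => 1
  | some (some false) => 2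
  | some (some true) => 3

/-- The semantics of commands, where loops have `N` iterations.  The output is written from its end
to its beginning. -/
def Cmd.eval (N : ℕ) : Cmd → MemState → MemState
  | skip, s => s
  | seq c d, s => d.eval N (c.eval N s)
  | set t e₁ e₂ e, s =>
    {s with mem := setMem s.mem t (e₁.eval s.mem) (e₂.eval s.mem) (e.eval s.mem)}
  | ite e c d, s => if e.eval s.mem ≠ 0 then c.eval N s else d.eval N s
  | loop c, s => (c.eval N)^[N] s
  | read t, s =>
    {s with mem := setMem s.mem t 0 0 (inputCode s.inp.head?), inp := s.inp.tail}
  | out e, s => {s with out := decide (e.eval s.mem ≠ 0) :: s.out}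

/-! ### Memory bounds and the compilation of expressions -/

namespace StackProg

open WorkStack

/-- A bound on the number of records and their entries. -/
def MemBdd (recs : List ((ℕ × ℕ × ℕ) × ℕ)) (z : ℕ) : Prop :=
  recs.length ≤ z ∧
    ∀ r ∈ recs, r.1.1 < 2 ^ z ∧ r.1.2.1 < 2 ^ z ∧ r.1.2.2 < 2 ^ z ∧ r.2 < 2 ^ z

theorem MemBdd.mono {recs : List ((ℕ × ℕ × ℕ) × ℕ)} {z z' : ℕ} (h : MemBdd recs z) (hz : z ≤ z') :
    MemBdd recs z' := by
  have := Nat.pow_le_pow_right (n := 2) (by norm_num) hz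
  refine ⟨h.1.trans hz, fun r hr => ?_⟩
  obtain ⟨h1, h2, h3, h4⟩ := h.2 r hr
  exact ⟨h1.trans_le this, h2.trans_le this, h3.trans_le this, h4.trans_le this⟩

theorem lookupFrom_lt {z : ℕ} (k : ℕ × ℕ × ℕ) : ∀ (recs : List ((ℕ × ℕ × ℕ) × ℕ)) (v : ℕ),
    (∀ r ∈ recs, r.2 < 2 ^ z) → v < 2 ^ z → lookupFrom recs k v < 2 ^ z
  | [], v, _, hv => hv
  | r :: recs, v, h, hv => by
    unfold lookupFrom
    rw [List.foldl_cons]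
    refine lookupFrom_lt k recs _ (fun r' hr' => h r' (by simp [hr'])) ?_
    split
    · exact h r (by simp)
    · exact hv

theorem memOf_lt {z : ℕ} {recs : List ((ℕ × ℕ × ℕ) × ℕ)} (h : MemBdd recs z) (t i j : ℕ) :
    memOf recs t i j < 2 ^ z :=
  lookupFrom_lt _ _ _ (fun r hr => (h.2 r hr).2.2.2) (by positivity)

/-- Since the last record with an address counts, a write never has to find or remove the old
record. -/
theorem memOf_append (recs : List ((ℕ × ℕ × ℕ) × ℕ)) (t i j v : ℕ) :
    memOf (recs ++ [((t, i, j), v)]) = setMem (memOf recs) t i j v := by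
  funext t' i' j'
  simp only [memOf, lookupFrom, List.foldl_append, List.foldl_cons, List.foldl_nil, setMem,
    Prod.mk.injEq]
  congr 1
  simp only [eq_comm]

theorem length_keyWord_le {z t i j : ℕ} (ht : t < 2 ^ z) (hi : i < 2 ^ z) (hj : j < 2 ^ z) :
    (keyWord (t, i, j)).length ≤ 3 * z + 2 := by
  have h1 := length_nb_le ht
  have h2 := length_nb_le hi
  have h3 := length_nb_le hj
  simp only [keyWord, List.length_append, List.length_cons]
  omega

theorem memWord_cons (r : (ℕ × ℕ × ℕ) × ℕ) (recs : List ((ℕ × ℕ × ℕ) × ℕ)) :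
    memWord (r :: recs) = keyWord r.1 ++ none :: (nb r.2 ++ none :: memWord recs) := by
  simp [memWord]

theorem memWord_append (recs recs' : List ((ℕ × ℕ × ℕ) × ℕ)) :
    memWord (recs ++ recs') = memWord recs ++ memWord recs' := by
  simp [memWord]

theorem length_memWord_le {z : ℕ} : ∀ {recs : List ((ℕ × ℕ × ℕ) × ℕ)},
    (∀ r ∈ recs, r.1.1 < 2 ^ z ∧ r.1.2.1 < 2 ^ z ∧ r.1.2.2 < 2 ^ z ∧ r.2 < 2 ^ z) →
    (memWord recs).length ≤ recs.length * (4 * z + 4)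
  | [], _ => by simp [memWord]
  | r :: recs, h => by
    have h1 := length_memWord_le (recs := recs) fun r' hr' => h r' (by simp [hr'])
    obtain ⟨h2, h3, h4, h5⟩ := h r (by simp)
    have h6 : (keyWord r.1).length ≤ _ := length_keyWord_le h2 h3 h4
    have h7 := length_nb_le h5
    rw [memWord_cons]
    simp only [List.length_append, List.length_cons, add_mul] at h6 ⊢
    omega

/-- `Z` holds the accumulator of the fold in `lookupFrom`; injectivity of `keyWord` makes the
comparison of words a comparison of addresses. -/
theorem runs_scan (k : ℕ × ℕ × ℕ) {B : ℕ} : ∀ (recs : List ((ℕ × ℕ × ℕ) × ℕ)) (s : Conf) (v : ℕ),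
    (∀ r ∈ recs, (keyWord r.1).length ≤ B ∧ r.2 < 2 ^ B) → v < 2 ^ B →
    s.M = memWord recs → s.X = keyWord k → s.Y = [] → s.F = [] → s.Z = (nb v).reverse →
    Runs (.while (fun v => (top M v).isSome) scanRecord) s (recs.length * (20 * B + 21) + 1)
      {s with M := [], M2 := (memWord recs).reverse ++ s.M2,
              Z := (nb (lookupFrom recs k v)).reverse}
  | [], s, v, _, _, hM, _, _, _, hZ => by
    refine (Runs.while_false (by simp [hM, memWord])).cast ?_ (by simp)
    obtain ⟨⟩ := s
    simp_all [memWord, lookupFrom]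
  | r :: recs, s, v, h, hv, hM, hX, hY, hF, hZ => by
    have hM' := hM
    rw [memWord_cons] at hM
    have h1 := runs_scanRecord s (B := B) (none_notMem_keyWord _) (none_notMem_nb _)
      (h r (by simp)).1 (length_nb_le (h r (by simp)).2)
      (by rw [hZ, List.length_reverse]; exact length_nb_le hv) hM hF hY
    have e : (if s.X = keyWord r.1 then (nb r.2).reverse else s.Z) =
        (nb (if r.1 = k then r.2 else v)).reverse := by
      rw [hX, hZ]
      by_cases hk : r.1 = k
      · simp [hk]
      · have : keyWord k ≠ keyWord r.1 := fun h => hk (keyWord_injective h).symm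
        simp [hk, this]
    rw [e] at h1
    refine (Runs.while_true ?_ h1 (runs_scan k recs _ (if r.1 = k then r.2 else v)
      (fun r' hr' => h r' (by simp [hr'])) ?_ rfl hX hY hF rfl)).cast ?_ ?_
    · rw [top_tops, Conf.get_M, hM]
      cases keyWord r.1 <;> simp
    · split
      · exact (h r (by simp)).2
      · exact hv
    · rw [memWord_cons]
      simp [lookupFrom]
    · simp only [List.length_cons, add_mul]
      omega

/-- Replace the address on `X` by its value, which is put on `E`. -/
def lookup : Prog :=
  seq (.while (fun v => (top M v).isSome) scanRecord) <|
  seq (mv M2 M) <| seq (clear X) <| seq (pushc E none) (mv Z E)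

/-- The stacks between two commands. -/
def base (inp : List (Option Bool)) (out : List Bool) (R : List Symb)
    (recs : List ((ℕ × ℕ × ℕ) × ℕ)) (N : ℕ) (C : List Symb) : Conf :=
  {inp := inp, out := out, E := R, M := memWord recs, N := List.replicate N none, C := C}

variable {inp : List (Option Bool)} {out : List Bool} {R : List Symb}
  {recs : List ((ℕ × ℕ × ℕ) × ℕ)} {N : ℕ} {C : List Symb}

/-- The time is quadratic because at most `k` records of length linear in `k` are scanned. The empty
`Z` at the start is the default value zero. -/
theorem runs_lookup {t i j k z : ℕ} (hz : MemBdd recs z) (hzk : z ≤ k) (ht : t < 2 ^ k)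
    (hi : i < 2 ^ k) (hj : j < 2 ^ k) :
    Runs lookup {base inp out R recs N C with X := keyWord (t, i, j)} (150 * (k + 1) ^ 2)
      (base inp out (nb (memOf recs t i j) ++ none :: R) recs N C) := by
  have hk := hz.mono hzk
  -- Three numbers of at most `k` digits and two commas.
  have hB : ∀ r ∈ recs, (keyWord r.1).length ≤ 3 * k + 2 ∧ r.2 < 2 ^ (3 * k + 2) := by
    intro r hr
    obtain ⟨h1, h2, h3, h4⟩ := hk.2 r hr
    exact ⟨length_keyWord_le h1 h2 h3, h4.trans_le (Nat.pow_le_pow_right (by norm_num) (by omega))⟩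
  refine Runs.cast (Runs.seq (runs_scan (t, i, j) (B := 3 * k + 2) recs _ 0 hB (by positivity) rfl rfl rfl rfl
    (by simp [base])) <|
    Runs.seq (runs_mv (by simp) rfl) <|
    Runs.seq (runs_clear _ _) <|
    Runs.seq (runs_pushc _ _ _)
    (runs_mv (by simp) rfl)) ?_ ?_
  · simp [base, memOf]
  · have h1 := length_memWord_le hk.2
    have h2 := length_keyWord_le ht hi hj
    have h3 := length_nb_le (memOf_lt hk t i j)
    have h4 := hk.1
    have h5 : recs.length * (20 * (3 * k + 2) + 21) ≤ k * (20 * (3 * k + 2) + 21) := by gcongr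
    have h6 : recs.length * (4 * k + 4) ≤ k * (4 * k + 4) := by gcongr
    simp [base, memOf] at h1 h2 h3 ⊢
    nlinarith

/-- Push a constant word. -/
def pushList (A : WorkStack) : List Symb → Prog
  | [] => skip
  | a :: l => seq (pushList A l) (pushc A a)

theorem runs_pushList (A : WorkStack) (s : Conf) : ∀ (l : List Symb),
    Runs (pushList A l) s (l.length + 1) (s.set A (l ++ s.get A))
  | [] => (Runs.skip s).cast (by simp) (by simp)
  | a :: l => ((runs_pushList A s l).seq (runs_pushc A a _)).cast (by simp) (by simp)

/-- Replace two indices on `E` by the address on `X` of the entry of table `t`. -/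
def mkKey (t : ℕ) : Prog :=
  seq (pull E X) <| seq (pushc X (some none)) <| seq (pull E X) <|
  seq (pushc X (some none)) (pushList X (nb t))

theorem runs_mkKey {t i j k : ℕ} (ht : t < 2 ^ k) (hi : i < 2 ^ k) (hj : j < 2 ^ k) :
    Runs (mkKey t) (base inp out (nb j ++ none :: (nb i ++ none :: R)) recs N C) (20 * (k + 1))
      {base inp out R recs N C with X := keyWord (t, i, j)} := by
  refine Runs.cast (Runs.seq (runs_pull (A := .E) (B := X) (by simp) (by simp) (by simp) (none_notMem_nb j) rfl rfl) <|
    Runs.seq (runs_pushc _ _ _) <|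
    Runs.seq (runs_pull (A := .E) (B := X) (by simp) (by simp) (by simp) (none_notMem_nb i) rfl rfl) <|
    Runs.seq (runs_pushc _ _ _)
    (runs_pushList _ _ _)) ?_ ?_
  · simp [base, keyWord]
  · have h1 := length_nb_le ht
    have h2 := length_nb_le hi
    have h3 := length_nb_le hj
    omega

/-- Replace two numbers on `E` by the result of a comparison with the initial flag `f`. -/
def compare (φ : Bool → Bool → Bool → Bool) (f : Bool) : Prog :=
  seq (pull E Y) <| seq (pull E X) <| seq (pushc F (fl f)) <| seq (cmpLoop φ) <|
  seq (pushc E none) <| seq (ite (isT F) (pushc E (fl true)) skip) (pop (.w F))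

theorem nb_one : nb 1 = [fl true] := by
  rw [nb_of_ne_zero (by norm_num)]
  simp

theorem runs_compare {φ : Bool → Bool → Bool → Bool} {ρ : ℕ → ℕ → Bool → Bool}
    (h0 : ∀ f, ρ 0 0 f = f)
    (h1 : ∀ a b f, ρ a b f = ρ (a / 2) (b / 2) (φ (decide (a % 2 = 1)) (decide (b % 2 = 1)) f))
    {a b k : ℕ} (ha : a < 2 ^ k) (hb : b < 2 ^ k) (f : Bool) :
    Runs (compare φ f) (base inp out (nb b ++ none :: (nb a ++ none :: R)) recs N C) (30 * (k + 1))
      (base inp out (nb (if ρ a b f then 1 else 0) ++ none :: R) recs N C) := by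
  have hite : ∀ (s : Conf) (f : Bool), s.F = [fl f] →
      Runs (ite (isT F) (pushc .E (fl true)) skip) s 2
        {s with E := nb (if f then 1 else 0) ++ s.E} := by
    intro s f hF
    cases f
    · exact (Runs.ite_false (by simp [hF]) (Runs.skip _)).cast (by simp) (by simp)
    · exact (Runs.ite_true (by simp [hF]) (runs_pushc _ _ _)).cast (by simp [nb_one]) (by simp)
  refine Runs.cast (Runs.seq (runs_pull (A := .E) (B := Y) (by simp) (by simp) (by simp) (none_notMem_nb b) rfl rfl) <|
    Runs.seq (runs_pull (A := .E) (B := X) (by simp) (by simp) (by simp) (none_notMem_nb a) rfl rfl) <|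
    Runs.seq (runs_pushc _ _ _) <|
    Runs.seq (runs_cmpLoop h0 h1 k a b f _ ha hb (by simp [base]) (by simp [base]) (by simp [base])) <|
    Runs.seq (runs_pushc _ _ _) <|
    Runs.seq (hite _ (ρ a b f) (by simp))
    (Runs.pop F _)) ?_ ?_
  · simp [base]
  · have h2 := length_nb_le ha
    have h3 := length_nb_le hb
    omega

/-- Replace two numbers on `E` by their sum. -/
def plus : Prog :=
  seq (pull E Y) <| seq (pull E X) <| seq (pushc F (fl false)) <| seq addLoop <|
  seq (pop (.w F)) <| seq (pushc E none) (mv Z E)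

theorem runs_plus {a b k : ℕ} (ha : a < 2 ^ k) (hb : b < 2 ^ k) :
    Runs plus (base inp out (nb b ++ none :: (nb a ++ none :: R)) recs N C) (40 * (k + 1))
      (base inp out (nb (a + b) ++ none :: R) recs N C) := by
  have hab : a + b + Bool.toNat false < 2 ^ (k + 1) := by rw [pow_succ]; simp; omega
  refine Runs.cast (Runs.seq (runs_pull (A := .E) (B := Y) (by simp) (by simp) (by simp) (none_notMem_nb b) rfl rfl) <|
    Runs.seq (runs_pull (A := .E) (B := X) (by simp) (by simp) (by simp) (none_notMem_nb a) rfl rfl) <|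
    Runs.seq (runs_pushc _ _ _) <|
    Runs.seq (runs_addLoop (k + 1) a b false _ hab (by simp [base]) (by simp [base]) (by simp [base])) <|
    Runs.seq (Runs.pop F _) <|
    Runs.seq (runs_pushc _ _ _)
    (runs_mv (by simp) rfl)) ?_ ?_
  · simp [base]
  · have h2 := length_nb_le ha
    have h3 := length_nb_le hb
    have h4 := length_nb_le hab
    simp [base] at h4 ⊢
    omega

/-- The stack program that puts the value of an expression on `E`. -/
def compileExpr : Expr → Prog
  | .const n => seq (pushc E none) (pushList E (nb n))
  | .get t e₁ e₂ => seq (compileExpr e₁) (seq (compileExpr e₂) (seq (mkKey t) lookup))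
  | .add e₁ e₂ => seq (compileExpr e₁) (seq (compileExpr e₂) plus)
  | .lt e₁ e₂ => seq (compileExpr e₁) (seq (compileExpr e₂)
      (compare (fun x y f => if x = y then f else y) false))
  | .eq e₁ e₂ => seq (compileExpr e₁) (seq (compileExpr e₂)
      (compare (fun x y f => if x = y then f else false) true))

/-- The halves have priority; if they agree, the lowest digits decide, and if these agree as well,
the flag from the digits further below does. -/
theorem lt_recursion (a b : ℕ) (f : Bool) :
    (decide (a < b) || (decide (a = b) && f)) = (decide (a / 2 < b / 2) || (decide (a / 2 = b / 2) &&
      (if decide (a % 2 = 1) = decide (b % 2 = 1) then f else decide (b % 2 = 1)))) := by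
  rcases Nat.mod_two_eq_zero_or_one a with ha | ha <;>
  rcases Nat.mod_two_eq_zero_or_one b with hb | hb <;> cases f <;>
  simp [ha, hb] <;> grind

theorem eq_recursion (a b : ℕ) (f : Bool) :
    (decide (a = b) && f) = (decide (a / 2 = b / 2) &&
      (if decide (a % 2 = 1) = decide (b % 2 = 1) then f else false)) := by
  rcases Nat.mod_two_eq_zero_or_one a with ha | ha <;>
  rcases Nat.mod_two_eq_zero_or_one b with hb | hb <;> cases f <;>
  simp [ha, hb] <;> omega

/-- Superadditivity of the time bound in the size of the expression: the spare unit in `a + b + 1 ≤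
c` pays for the operation at the root. -/
theorem expr_cost {z a b c t : ℕ} (hc : a + b + 1 ≤ c)
    (ht : t ≤ 200 * (z + c + 1) ^ 2) :
    200 * a * (z + a + 1) ^ 2 + (200 * b * (z + b + 1) ^ 2 + t) ≤ 200 * c * (z + c + 1) ^ 2 := by
  have h1 : 200 * a * (z + a + 1) ^ 2 ≤ 200 * a * (z + c + 1) ^ 2 := by gcongr; omega
  have h2 : 200 * b * (z + b + 1) ^ 2 ≤ 200 * b * (z + c + 1) ^ 2 := by gcongr; omega
  have h3 : 200 * (a + b + 1) * (z + c + 1) ^ 2 ≤ 200 * c * (z + c + 1) ^ 2 := by gcongr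
  nlinarith

theorem linear_le_cost {z c t : ℕ} (ht : t ≤ 40 * (z + c + 1)) : t ≤ 200 * (z + c + 1) ^ 2 := by
  nlinarith

/-- Time and size are proved together, since the time of an operation depends on the length of its
operands. An addition lengthens them by at most one bit, a constant `n` has at most `n` digits, and
a value from the memory has at most `z`. -/
theorem runs_compileExpr {z : ℕ} (hz : MemBdd recs z) : ∀ (e : Expr) (R : List Symb),
    Runs (compileExpr e) (base inp out R recs N C) (200 * e.size * (z + e.size + 1) ^ 2)
      (base inp out (nb (e.eval (memOf recs)) ++ none :: R) recs N C) ∧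
    e.eval (memOf recs) < 2 ^ (z + e.size) := by
  have pow_le : ∀ {a b x : ℕ}, x < 2 ^ a → a ≤ b → x < 2 ^ b := fun h hab =>
    h.trans_le (Nat.pow_le_pow_right (by norm_num) hab)
  intro e
  induction e with
  | const n =>
    intro R
    have hn : n < 2 ^ n := Nat.lt_two_pow_self
    refine ⟨((runs_pushc _ _ _).seq (runs_pushList _ _ _)).cast (by simp [base, Expr.eval]) ?_,
      pow_le hn (by simp only [Expr.size]; omega)⟩
    have := length_nb_le hn
    simp only [Expr.size]
    nlinarith [Nat.zero_le (z * n), Nat.zero_le (z^2)]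
  | get t e₁ e₂ ih₁ ih₂ =>
    intro R
    obtain ⟨r1, h1⟩ := ih₁ R
    obtain ⟨r2, h2⟩ := ih₂ (nb (e₁.eval (memOf recs)) ++ none :: R)
    refine ⟨(r1.seq (r2.seq ((runs_mkKey (k := z + (Expr.get t e₁ e₂).size) ?_ ?_ ?_).seq
      (runs_lookup (k := z + (Expr.get t e₁ e₂).size) hz ?_ ?_ ?_ ?_)))).cast rfl
      (expr_cost (by simp only [Expr.size]; omega) (by nlinarith)), ?_⟩
    · exact pow_le (Nat.lt_two_pow_self) (by simp only [Expr.size]; omega)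
    · exact pow_le h1 (by simp only [Expr.size]; omega)
    · exact pow_le h2 (by simp only [Expr.size]; omega)
    · omega
    · exact pow_le (Nat.lt_two_pow_self) (by simp only [Expr.size]; omega)
    · exact pow_le h1 (by simp only [Expr.size]; omega)
    · exact pow_le h2 (by simp only [Expr.size]; omega)
    · exact pow_le (memOf_lt hz _ _ _) (by omega)
  | add e₁ e₂ ih₁ ih₂ =>
    intro R
    obtain ⟨r1, h1⟩ := ih₁ R
    obtain ⟨r2, h2⟩ := ih₂ (nb (e₁.eval (memOf recs)) ++ none :: R)
    have h1' := pow_le h1 (b := z + (e₁.size + e₂.size)) (by omega)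
    have h2' := pow_le h2 (b := z + (e₁.size + e₂.size)) (by omega)
    refine ⟨(r1.seq (r2.seq (runs_plus h1' h2'))).cast rfl
      (expr_cost (by simp only [Expr.size]; omega) (linear_le_cost (by simp only [Expr.size]; omega))),
      ?_⟩
    simp only [Expr.eval, Expr.size, ← add_assoc, pow_succ] at h1' h2' ⊢
    omega
  | lt e₁ e₂ ih₁ ih₂ =>
    intro R
    obtain ⟨r1, h1⟩ := ih₁ R
    obtain ⟨r2, h2⟩ := ih₂ (nb (e₁.eval (memOf recs)) ++ none :: R)
    have h1' := pow_le h1 (b := z + (e₁.size + e₂.size)) (by omega)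
    have h2' := pow_le h2 (b := z + (e₁.size + e₂.size)) (by omega)
    refine ⟨(r1.seq (r2.seq (runs_compare (ρ := fun a b f => decide (a < b) || (decide (a = b) && f))
      (by simp) lt_recursion h1' h2' false))).cast (by simp [Expr.eval])
      (expr_cost (by simp only [Expr.size]; omega) (linear_le_cost (by simp only [Expr.size]; omega))),
      pow_le (a := 1) (by simp only [Expr.eval]; split <;> simp) (by simp only [Expr.size]; omega)⟩
  | eq e₁ e₂ ih₁ ih₂ =>
    intro R
    obtain ⟨r1, h1⟩ := ih₁ R
    obtain ⟨r2, h2⟩ := ih₂ (nb (e₁.eval (memOf recs)) ++ none :: R)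
    have h1' := pow_le h1 (b := z + (e₁.size + e₂.size)) (by omega)
    have h2' := pow_le h2 (b := z + (e₁.size + e₂.size)) (by omega)
    refine ⟨(r1.seq (r2.seq (runs_compare (ρ := fun a b f => decide (a = b) && f)
      (by simp) eq_recursion h1' h2' true))).cast (by simp [Expr.eval])
      (expr_cost (by simp only [Expr.size]; omega) (linear_le_cost (by simp only [Expr.size]; omega))),
      pow_le (a := 1) (by simp only [Expr.eval]; split <;> simp) (by simp only [Expr.size]; omega)⟩

end StackProg

/-! ### Compilation of commands and their running time -/

namespace StackProg

open WorkStack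
open Polynomial hiding X

theorem eval_le_eval (p : Polynomial ℕ) {a b : ℕ} (h : a ≤ b) : p.eval a ≤ p.eval b := by
  rw [eval_eq_sum_range, eval_eq_sum_range]
  gcongr

variable {inp : List (Option Bool)} {out : List Bool} {R : List Symb}
  {recs : List ((ℕ × ℕ × ℕ) × ℕ)} {N : ℕ} {C : List Symb}

/-- Append the record with the address on `X` and the value on `E` to the memory. -/
def store : Prog :=
  seq (mv M M2) <| seq (mv X M2) <| seq (pushc M2 none) <| seq (mvw E M2) <|
  seq (pop (.w E)) <| seq (pushc M2 none) (mv M2 M)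

/-- The memory passes through `M2` in reverse, so a record put on top of `M2` becomes the last one,
which prevails over older records. -/
theorem runs_store {t i j v k z : ℕ} (hz : MemBdd recs z) (hzk : z ≤ k) (ht : t < 2 ^ k)
    (hi : i < 2 ^ k) (hj : j < 2 ^ k) (hv : v < 2 ^ k) :
    Runs store {base inp out (nb v ++ none :: R) recs N C with X := keyWord (t, i, j)}
      (100 * (k + 1) ^ 2) (base inp out R (recs ++ [((t, i, j), v)]) N C) := by
  have hk := hz.mono hzk
  refine Runs.cast (Runs.seq (runs_mv (by simp) rfl) <| Runs.seq (runs_mv (by simp) rfl) <|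
    Runs.seq (runs_pushc _ _ _) <| Runs.seq (runs_mvw (by simp) (none_notMem_nb v) rfl) <|
    Runs.seq (Runs.pop _ _) <| Runs.seq (runs_pushc _ _ _) (runs_mv (by simp) rfl)) ?_ ?_
  · simp [base, memWord_append, memWord_cons]
    simp [memWord]
  · have h1 := length_memWord_le hk.2
    have h2 := length_keyWord_le ht hi hj
    have h3 := length_nb_le hv
    have h4 := hk.1
    have h6 : recs.length * (4 * k + 4) ≤ k * (4 * k + 4) := by gcongr
    simp [base] at h1 h2 h3 ⊢
    nlinarith

/-- The next input symbol. -/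
def topInp (v : ∀ k, Option (Alph k)) : Option (Option Bool) := v .inp

@[simp] theorem topInp_tops (s : Conf) : topInp (tops s.fn) = s.inp.head? := rfl

/-- Push the code of the next input symbol on `E`. -/
def readSymbol : Prog :=
  seq (pushc E none) <|
  seq (ite (fun v => topInp v == none) skip
    (ite (fun v => topInp v == some none) (pushList E (nb 1))
      (ite (fun v => topInp v == some (some false))
        (pushList E (nb 2)) (pushList E (nb 3)))))
  (pop .inp)

theorem runs_readSymbol :
    Runs readSymbol (base inp out R recs N C) 10
      (base inp.tail out (nb (inputCode inp.head?) ++ none :: R) recs N C) := by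
  have h2 : (nb 2).length ≤ 2 := length_nb_le (by norm_num)
  have h3 : (nb 3).length ≤ 2 := length_nb_le (by norm_num)
  have key : Runs (ite (fun v => topInp v == none) skip
    (ite (fun v => topInp v == some none) (pushList E (nb 1))
      (ite (fun v => topInp v == some (some false))
        (pushList E (nb 2)) (pushList E (nb 3))))) (base inp out (none :: R) recs N C) 8
      (base inp out (nb (inputCode inp.head?) ++ none :: R) recs N C) := by
    rcases h : inp.head? with _ | _ | _ | _
    · exact (Runs.ite_true (by simp [base, h]) (Runs.skip _)).cast
        (by simp [inputCode]) (by simp)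
    · exact (Runs.ite_false (by simp [base, h]) (Runs.ite_true
        (by simp [base, h]) (runs_pushList E _ _))).cast
        (by simp [inputCode, base]) (by simp [nb_one])
    · exact (Runs.ite_false (by simp [base, h]) (Runs.ite_false
        (by simp [base, h]) (Runs.ite_true
        (by simp [base, h]) (runs_pushList E _ _)))).cast
        (by simp [inputCode, base]) (by omega)
    · exact (Runs.ite_false (by simp [base, h]) (Runs.ite_false
        (by simp [base, h]) (Runs.ite_false
        (by simp [base, h]) (runs_pushList E _ _)))).cast
        (by simp [inputCode, base]) (by omega)
  exact Runs.cast (Runs.seq (runs_pushc _ _ _) (Runs.seq (key.cast rfl le_rfl) (Runs.pop_inp _)))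
    (by simp [base]) (by omega)

/-- Push as many commas as there are symbols on `N` to `C`, above an end marker. -/
def initLoop : Prog :=
  seq (pushc .C none) <|
  seq (.while (fun v => (top .N v).isSome) (seq (pushc .C (some none)) (moveTop .N T))) (mv T .N)

/-- The end marker separates the new counter from those of enclosing loops further down on `C`; `N`
is restored from `T` for later loops. -/
theorem runs_initLoop :
    Runs initLoop (base inp out R recs N C) (7 * N + 3)
      (base inp out R recs N (List.replicate N (some none) ++ none :: C)) := by
  have key : ∀ (n : ℕ) (s : Conf), s.N = List.replicate n none →
      Runs (.while (fun v => (top .N v).isSome) (seq (pushc .C (some none)) (moveTop .N T))) s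
        (4 * n + 1) {s with N := [], C := List.replicate n (some none) ++ s.C,
                            T := List.replicate n none ++ s.T} := by
    intro n
    induction n with
    | zero =>
      intro s hs
      refine (Runs.while_false (by simp [hs])).cast ?_ (by simp)
      obtain ⟨⟩ := s
      simp_all
    | succ n ih =>
      intro s hs
      rw [List.replicate_succ] at hs
      refine (Runs.while_true (by simp [hs]) ((runs_pushc .C _ _).seq (runs_moveTop (A := .N)
        (B := T) (by simp) (by simpa using hs))) (ih _ (by simp))).cast ?_ (by omega)
      simp [List.replicate_succ', List.append_assoc]
  refine Runs.cast (Runs.seq (runs_pushc _ _ _) <|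
    Runs.seq (key N _ (by simp [base])) (runs_mv (by simp) rfl)) ?_ ?_
  · simp [base]
  · simp [base]
    omega

/-- The stack program of a command. -/
def compile : Cmd → Prog
  | .skip => skip
  | .seq c d => seq (compile c) (compile d)
  | .set t e₁ e₂ e => seq (compileExpr e) <| seq (compileExpr e₁) <| seq (compileExpr e₂) <|
      seq (mkKey t) store
  | .ite e c d => seq (compileExpr e) <| seq (pull E X) <|
      ite (fun v => (top X v).isSome) (seq (clear X) (compile c)) (seq (clear X) (compile d))
  | .loop c => seq initLoop <| seq
      (.while (fun v => top WorkStack.C v == some (some none))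
        (seq (pop (.w WorkStack.C)) (compile c))) (pop (.w WorkStack.C))
  | .read t => seq readSymbol <| seq (pushList X (keyWord (t, 0, 0))) store
  | .out e => seq (compileExpr e) <| seq (pull E X) <|
      seq (push .out (fun v => (top X v).isSome)) (clear X)

/-- The compiled program simulates the command in polynomial time. -/
theorem runs_compile (c : Cmd) : ∃ g p : Polynomial ℕ, ∀ (N z : ℕ) (recs : List ((ℕ × ℕ × ℕ) × ℕ))
    (inp : List (Option Bool)) (out : List Bool) (R C : List Symb), N ≤ z → MemBdd recs z →
    ∃ recs' inp' out', MemBdd recs' (z + g.eval N) ∧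
      c.eval N ⟨memOf recs, inp, out⟩ = ⟨memOf recs', inp', out'⟩ ∧
      Runs (compile c) (base inp out R recs N C) (p.eval z) (base inp' out' R recs' N C) := by
  have pow_le : ∀ {a b x : ℕ}, x < 2 ^ a → a ≤ b → x < 2 ^ b := fun h hab =>
    h.trans_le (Nat.pow_le_pow_right (by norm_num) hab)
  -- The growth `g` depends on `N` and not on `z`. Successive iterations therefore add to the bound
  -- on the memory instead of compounding, which keeps nested loops polynomial.
  induction c with
  | skip =>
    exact ⟨0, 1, fun N z recs inp out R C hN hz => ⟨recs, inp, out, by simpa using hz, rfl,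
      (Runs.skip _).cast rfl (by simp)⟩⟩
  | seq c d ihc ihd =>
    obtain ⟨g1, p1, h1⟩ := ihc
    obtain ⟨g2, p2, h2⟩ := ihd
    -- The second command starts with the bound `z + g1.eval N`, which is at most `z + g1.eval z`.
    refine ⟨g1 + g2, p1 + p2.comp (Polynomial.X + g1), fun N z recs inp out R C hN hz => ?_⟩
    obtain ⟨recs1, inp1, out1, b1, e1, r1⟩ := h1 N z recs inp out R C hN hz
    obtain ⟨recs2, inp2, out2, b2, e2, r2⟩ := h2 N _ recs1 inp1 out1 R C
      (hN.trans (Nat.le_add_right _ _)) b1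
    refine ⟨recs2, inp2, out2, by simpa [add_assoc] using b2, by simp only [Cmd.eval, e1, e2],
      (r1.seq r2).cast rfl ?_⟩
    simp only [eval_add, eval_comp, eval_X]
    have := eval_le_eval p2 (Nat.add_le_add_left (eval_le_eval g1 hN) z)
    omega
  | set t e₁ e₂ e =>
    set c : ℕ := t + e₁.size + e₂.size + e.size + 1 with hc
    refine ⟨(c : Polynomial ℕ), 800 * (c : Polynomial ℕ) * (Polynomial.X + (c : Polynomial ℕ) + 1) ^ 2,
      fun N z recs inp out R C hN hz => ?_⟩
    obtain ⟨r1, l1⟩ := runs_compileExpr (inp := inp) (out := out) (N := N) (C := C) hz e R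
    obtain ⟨r2, l2⟩ := runs_compileExpr (inp := inp) (out := out) (N := N) (C := C) hz e₁
      (nb (e.eval (memOf recs)) ++ none :: R)
    obtain ⟨r3, l3⟩ := runs_compileExpr (inp := inp) (out := out) (N := N) (C := C) hz e₂
      (nb (e₁.eval (memOf recs)) ++ none :: (nb (e.eval (memOf recs)) ++ none :: R))
    have q0 : t < 2 ^ (z + c) := pow_le Nat.lt_two_pow_self (by omega)
    have q1 := pow_le l1 (b := z + c) (by omega)
    have q2 := pow_le l2 (b := z + c) (by omega)
    have q3 := pow_le l3 (b := z + c) (by omega)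
    refine ⟨recs ++ [((t, e₁.eval (memOf recs), e₂.eval (memOf recs)), e.eval (memOf recs))],
      inp, out, ?_, ?_, (r1.seq <| r2.seq <| r3.seq <| (runs_mkKey (k := z + c) q0 q2 q3).seq
        (runs_store hz (k := z + c) (by omega) q0 q2 q3 q1)).cast rfl ?_⟩
    · have h := hz.mono (Nat.le_add_right z c)
      rw [eval_natCast, Nat.cast_id]
      refine ⟨?_, fun r hr => ?_⟩
      · have := hz.1
        simp only [List.length_append, List.length_cons, List.length_nil]
        omega
      · rcases List.mem_append.1 hr with hr | hr
        · exact h.2 r hr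
        · obtain rfl := List.mem_singleton.1 hr
          exact ⟨q0, q2, q3, q1⟩
    · simp only [Cmd.eval, memOf_append]
    · have aux : ∀ a, a ≤ c → 200 * a * (z + a + 1) ^ 2 ≤ 200 * c * (z + c + 1) ^ 2 := by
        intro a ha
        gcongr
      have a1 := aux e.size (by omega)
      have a2 := aux e₁.size (by omega)
      have a3 := aux e₂.size (by omega)
      have a4 : 200 * 1 * (z + c + 1) ^ 2 ≤ 200 * c * (z + c + 1) ^ 2 := by gcongr; omega
      simp only [eval_mul, eval_pow, eval_add, eval_X, eval_natCast, Nat.cast_id, eval_one,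
        eval_ofNat]
      nlinarith
  | ite e c d ihc ihd =>
    obtain ⟨g1, p1, h1⟩ := ihc
    obtain ⟨g2, p2, h2⟩ := ihd
    obtain ⟨s, hs⟩ : ∃ s, e.size = s := ⟨_, rfl⟩
    refine ⟨g1 + g2, 200 * (s : Polynomial ℕ) * (Polynomial.X + (s : Polynomial ℕ) + 1) ^ 2 + 10 * (Polynomial.X + (s : Polynomial ℕ) + 1) +
      p1 + p2, fun N z recs inp out R C hN hz => ?_⟩
    obtain ⟨re, le⟩ := runs_compileExpr (inp := inp) (out := out) (N := N) (C := C) hz e R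
    rw [hs] at re le
    obtain ⟨recs1, inp1, out1, b1, e1, r1⟩ := h1 N z recs inp out R C hN hz
    obtain ⟨recs2, inp2, out2, b2, e2, r2⟩ := h2 N z recs inp out R C hN hz
    have hp : Runs (pull E WorkStack.X) (base inp out (nb (e.eval (memOf recs)) ++ none :: R) recs N C)
        (6 * (nb (e.eval (memOf recs))).length + 3)
        {base inp out R recs N C with X := nb (e.eval (memOf recs))} :=
      (runs_pull (A := E) (B := WorkStack.X) (by simp) (by simp) (by simp) (none_notMem_nb _) rfl
        rfl).cast (by simp [base]) le_rfl
    have hcl : Runs (clear WorkStack.X)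
        {base inp out R recs N C with X := nb (e.eval (memOf recs))}
        (2 * (nb (e.eval (memOf recs))).length + 1) (base inp out R recs N C) :=
      (runs_clear _ _).cast (by simp [base]) (by simp)
    have hl := length_nb_le le
    have ht : eval z (200 * (s : Polynomial ℕ) * (Polynomial.X + (s : Polynomial ℕ) + 1) ^ 2 + 10 * (Polynomial.X + (s : Polynomial ℕ) + 1) +
        p1 + p2) = 200 * s * (z + s + 1) ^ 2 + 10 * (z + s + 1) + p1.eval z + p2.eval z := by
      simp [eval_ofNat]
    rw [ht]
    by_cases h0 : e.eval (memOf recs) = 0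
    · refine ⟨recs2, inp2, out2, b2.mono (by simp), by simp only [Cmd.eval, h0, e2]; simp,
        (re.seq (hp.seq (Runs.ite_false (by simp [h0]) (hcl.seq r2)))).cast rfl (by omega)⟩
    · refine ⟨recs1, inp1, out1, b1.mono (by simp), by simp only [Cmd.eval, e1]; simp [h0],
        (re.seq (hp.seq (Runs.ite_true (by simp [h0]) (hcl.seq r1)))).cast rfl (by omega)⟩
  | loop c ih =>
    obtain ⟨g, p, h⟩ := ih
    refine ⟨Polynomial.X * g, Polynomial.X * p.comp (Polynomial.X + Polynomial.X * g) + 9 * Polynomial.X + 5, fun N z recs inp out R C hN hz => ?_⟩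
    -- Here `n` iterations remain and `i` are done. Each is charged the time that belongs to the
    -- final bound `z + N * g.eval N`.
    have key : ∀ (n i : ℕ) (recs : List ((ℕ × ℕ × ℕ) × ℕ)) (inp : List (Option Bool))
        (out : List Bool), n + i = N → MemBdd recs (z + i * g.eval N) →
        ∃ recs' inp' out', MemBdd recs' (z + N * g.eval N) ∧
        (c.eval N)^[n] ⟨memOf recs, inp, out⟩ = ⟨memOf recs', inp', out'⟩ ∧
        Runs (.while (fun v => top WorkStack.C v == some (some none))
          (seq (pop (.w WorkStack.C)) (compile c)))
          (base inp out R recs N (List.replicate n (some none) ++ none :: C))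
          (n * (p.eval (z + N * g.eval N) + 2) + 1) (base inp' out' R recs' N (none :: C)) := by
      intro n
      induction n with
      | zero =>
        intro i recs inp out hi hr
        rw [show i = N by omega] at hr
        refine ⟨recs, inp, out, hr, rfl,
          (Runs.while_false (by simp [base])).cast (by simp) (by simp)⟩
      | succ n ihn =>
        intro i recs inp out hi hr
        obtain ⟨recs1, inp1, out1, b1, e1, r1⟩ := h N _ recs inp out R
          (List.replicate n (some none) ++ none :: C) (hN.trans (Nat.le_add_right _ _)) hr
        obtain ⟨recs2, inp2, out2, b2, e2, r2⟩ := ihn (i + 1) recs1 inp1 out1 (by omega)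
          (by rw [add_mul, one_mul, ← add_assoc]; exact b1)
        refine ⟨recs2, inp2, out2, b2, ?_, ?_⟩
        · rw [Function.iterate_succ_apply, e1, e2]
        · have hpop : Runs (pop (.w WorkStack.C))
              (base inp out R recs N (List.replicate (n + 1) (some none) ++ none :: C)) 1
              (base inp out R recs N (List.replicate n (some none) ++ none :: C)) :=
            (Runs.pop _ _).cast (by simp [base, List.replicate_succ]) le_rfl
          refine (Runs.while_true (by simp [base, List.replicate_succ]) (hpop.seq r1) r2).cast
            rfl ?_
          have : z + i * g.eval N ≤ z + N * g.eval N := by gcongr; omega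
          have := eval_le_eval p this
          rw [add_mul]
          omega
    obtain ⟨recs', inp', out', b, e, r⟩ := key N 0 recs inp out (by simp) (by simpa using hz)
    refine ⟨recs', inp', out', by simpa using b, e, (runs_initLoop.seq (r.seq ((Runs.pop _ _).cast
      (s'' := base inp' out' R recs' N C) (by simp [base]) le_rfl))).cast rfl ?_⟩
    simp only [eval_add, eval_mul, eval_comp, eval_X, eval_ofNat]
    have h1 : z + N * g.eval N ≤ z + z * g.eval z := by
      have := eval_le_eval g hN
      gcongr
    have h2 := eval_le_eval p h1
    have h3 : N * (p.eval (z + N * g.eval N) + 2) ≤ z * (p.eval (z + z * g.eval z) + 2) := by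
      gcongr
    rw [mul_add z] at h3
    omega
  | read t =>
    refine ⟨((t + 2 : ℕ) : Polynomial ℕ),
      300 * (Polynomial.X + ((t + 2 : ℕ) : Polynomial ℕ) + 1) ^ 2, fun N z recs inp out R C hN hz => ?_⟩
    have q0 : t < 2 ^ (z + (t + 2)) := pow_le Nat.lt_two_pow_self (by omega)
    have q1 : inputCode inp.head? < 2 ^ (z + (t + 2)) :=
      pow_le (a := 2) (by rcases inp.head? with _ | _ | _ | _ <;> simp [inputCode]) (by omega)
    have q2 : 0 < 2 ^ (z + (t + 2)) := by positivity
    refine ⟨recs ++ [((t, 0, 0), inputCode inp.head?)], inp.tail, out, ?_, ?_,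
      (runs_readSymbol.seq <| ((runs_pushList WorkStack.X _ _).cast
        (s'' := {base inp.tail out (nb (inputCode inp.head?) ++ none :: R) recs N C with
          X := keyWord (t, 0, 0)}) (by simp [base]) le_rfl).seq
        (runs_store hz (k := z + (t + 2)) (by omega) q0 q2 q2 q1)).cast rfl ?_⟩
    · have h := hz.mono (Nat.le_add_right z (t + 2))
      rw [eval_natCast, Nat.cast_id]
      refine ⟨?_, fun r hr => ?_⟩
      · have := hz.1
        simp only [List.length_append, List.length_cons, List.length_nil]
        omega
      · rcases List.mem_append.1 hr with hr | hr
        · exact h.2 r hr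
        · obtain rfl := List.mem_singleton.1 hr
          exact ⟨q0, q2, q2, q1⟩
    · simp only [Cmd.eval, memOf_append]
    · have := length_keyWord_le q0 q2 q2
      simp only [eval_mul, eval_pow, eval_add, eval_X, eval_natCast, Nat.cast_id, eval_one,
        eval_ofNat]
      nlinarith
  | out e =>
    obtain ⟨s, hs⟩ : ∃ s, e.size = s := ⟨_, rfl⟩
    refine ⟨0, 200 * (s : Polynomial ℕ) * (Polynomial.X + (s : Polynomial ℕ) + 1) ^ 2 + 10 * (Polynomial.X + (s : Polynomial ℕ) + 1),
      fun N z recs inp out R C hN hz => ?_⟩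
    obtain ⟨re, le⟩ := runs_compileExpr (inp := inp) (out := out) (N := N) (C := C) hz e R
    rw [hs] at re le
    have hp : Runs (pull E WorkStack.X) (base inp out (nb (e.eval (memOf recs)) ++ none :: R) recs N C)
        (6 * (nb (e.eval (memOf recs))).length + 3)
        {base inp out R recs N C with X := nb (e.eval (memOf recs))} :=
      (runs_pull (A := E) (B := WorkStack.X) (by simp) (by simp) (by simp) (none_notMem_nb _) rfl
        rfl).cast (by simp [base]) le_rfl
    have hl := length_nb_le le
    refine ⟨recs, inp, decide (e.eval (memOf recs) ≠ 0) :: out, by simpa using hz, rfl,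
      (re.seq (hp.seq ((Runs.push_out _ _).seq (runs_clear _ _)))).cast (by simp [base]) ?_⟩
    simp [eval_ofNat]
    omega

end StackProg

/-! ### Complete programs: loop bound from the input length, and clean-up -/

namespace StackProg

open WorkStack
open Polynomial hiding X

/-- Count the input symbols on `N`, moving them to `T`. -/
def countLoop : Prog :=
  .while (fun v => (topInp v).isSome)
    (seq (push (.w T) topInp) (seq (pushc N none) (pop .inp)))

theorem runs_countLoop : ∀ (w : List (Option Bool)) (s : Conf), s.inp = w →
    Runs countLoop s (4 * w.length + 1) {s with
      inp := [], T := (w.map some).reverse ++ s.T, N := List.replicate w.length none ++ s.N}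
  | [], s, h => by
    refine (Runs.while_false (by simp [h])).cast ?_ (by simp)
    obtain ⟨⟩ := s
    simp_all
  | a :: w, s, h => by
    refine (Runs.while_true (by simp [h]) ((Runs.push T topInp s).seq ((runs_pushc _ _ _).seq
      (Runs.pop_inp _))) (runs_countLoop w _ (by simp [h]))).cast ?_ (by simp; omega)
    simp [h, List.replicate_succ']

/-- Move the symbols on `T` back to the input. -/
def restoreLoop : Prog :=
  .while (fun v => (top T v).isSome)
    (seq (push .inp (fun v => ((top T v).getD none).getD none)) (pop (.w T)))

theorem runs_restoreLoop : ∀ (w : List (Option Bool)) (s : Conf), s.T = w.map some →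
    Runs restoreLoop s (3 * w.length + 1) {s with inp := w.reverse ++ s.inp, T := []}
  | [], s, h => by
    refine (Runs.while_false (by simp [h])).cast ?_ (by simp)
    obtain ⟨⟩ := s
    simp_all
  | a :: w, s, h => by
    refine (Runs.while_true (by simp [h]) ((Runs.push_inp _ s).seq (Runs.pop T _))
      (runs_restoreLoop w _ (by simp [h]))).cast ?_ (by simp; omega)
    simp [h]

/-- Discard the remaining input. -/
def clearInp : Prog := .while (fun v => (topInp v).isSome) (pop .inp)

theorem runs_clearInp : ∀ (w : List (Option Bool)) (s : Conf), s.inp = w →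
    Runs clearInp s (2 * w.length + 1) {s with inp := []}
  | [], s, h => by
    refine (Runs.while_false (by simp [h])).cast ?_ (by simp)
    obtain ⟨⟩ := s
    simp_all
  | a :: w, s, h => by
    refine (Runs.while_true (by simp [h]) (Runs.pop_inp _)
      (runs_clearInp w _ (by simp [h]))).cast ?_ (by simp; omega)
    simp

/-- The complete program for a command: count the input symbols, run the command and empty all
stacks but the output. -/
def withLoopBound (c : Cmd) : Prog :=
  seq countLoop <| seq (pushc N none) <| seq restoreLoop <| seq (compile c) <|
  seq clearInp <| seq (clear M) (clear N)

/-- The output of a command on an input word of length `n`, with `n + 1` iterations of each loop. -/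
def _root_.Cmd.output (c : Cmd) (w : List (Option Bool)) : List Bool :=
  (c.eval (w.length + 1) ⟨fun _ _ _ => 0, w, []⟩).out

/-- This bounds the time for discarding unread input at the end. -/
theorem _root_.Cmd.length_inp_le (c : Cmd) (N : ℕ) :
    ∀ s : MemState, (c.eval N s).inp.length ≤ s.inp.length := by
  induction c with
  | skip => exact fun s => le_rfl
  | seq c d ihc ihd => exact fun s => (ihd _).trans (ihc _)
  | set => exact fun s => le_rfl
  | ite e c d ihc ihd =>
    intro s
    simp only [Cmd.eval]
    split
    · exact ihc s
    · exact ihd s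
  | loop c ih =>
    intro s
    simp only [Cmd.eval]
    generalize N = n at *
    suffices h : ∀ k, ((c.eval n)^[k] s).inp.length ≤ s.inp.length from h n
    intro k
    induction k with
    | zero => exact le_rfl
    | succ k ihk => rw [Function.iterate_succ_apply']; exact (ih _).trans ihk
  | read => exact fun s => by simp [Cmd.eval]
  | out => exact fun s => le_rfl

/-- The number `w.length + 1` serves both as the number of iterations and as the initial bound `z`
on the still empty memory. The last summand of the polynomial pays for clearing the memory. -/
theorem runs_withLoopBound (c : Cmd) : ∃ p : Polynomial ℕ, ∀ w : List (Option Bool),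
    Runs (withLoopBound c) {inp := w} (p.eval w.length) {out := c.output w} := by
  obtain ⟨g, p, h⟩ := runs_compile c
  refine ⟨p.comp (Polynomial.X + 1) + 20 * (Polynomial.X + 1) +
    3 * (Polynomial.X + 1 + g.comp (Polynomial.X + 1)) *
      (4 * (Polynomial.X + 1 + g.comp (Polynomial.X + 1)) + 4), fun w => ?_⟩
  obtain ⟨recs, inp, out, hb, he, hr⟩ := h (w.length + 1) (w.length + 1) [] w [] [] [] le_rfl
    ⟨by simp, by simp⟩
  have h0 : memOf [] = fun _ _ _ => 0 := rfl
  have hout : c.output w = out := by rw [Cmd.output, ← h0, he]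
  have hlen : inp.length ≤ w.length := by
    have := c.length_inp_le (w.length + 1) ⟨memOf [], w, []⟩
    rwa [he] at this
  rw [hout]
  refine Runs.cast (Runs.seq (runs_countLoop w _ rfl) <| Runs.seq (runs_pushc _ _ _) <|
    Runs.seq ((runs_restoreLoop w.reverse _ (by simp)).cast
      (s'' := base w [] [] [] (w.length + 1) [])
      (by simp [base, memWord, List.replicate_succ]) le_rfl) <|
    Runs.seq hr <| Runs.seq (runs_clearInp inp _ rfl) <|
    Runs.seq (runs_clear _ _) (runs_clear _ _)) ?_ ?_
  · simp [base]
  · have h1 := length_memWord_le hb.2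
    have h2 : recs.length * (4 * (w.length + 1 + g.eval (w.length + 1)) + 4) ≤
        (w.length + 1 + g.eval (w.length + 1)) *
        (4 * (w.length + 1 + g.eval (w.length + 1)) + 4) := Nat.mul_le_mul_right _ hb.1
    simp only [eval_add, eval_comp, eval_mul, eval_X, eval_one, eval_ofNat, base, Conf.get_M,
      Conf.get_N, Conf.set_M, List.length_replicate, List.length_reverse]
    rw [mul_assoc 3]
    omega

theorem update_nil_inp (w : List (Option Bool)) :
    Function.update (fun _ => [] : ∀ k, List (Alph k)) .inp w = ({inp := w} : Conf).fn := by
  funext k; rcases k with _ | _ | r <;> (try cases r) <;> rfl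

theorem update_nil_out (w : List Bool) :
    Function.update (fun _ => [] : ∀ k, List (Alph k)) .out w = ({out := w} : Conf).fn := by
  funext k; rcases k with _ | _ | r <;> (try cases r) <;> rfl

/-- The functions computed by commands are computable in polynomial time. -/
theorem computableInPolyTime {α : Type} (ea : α → List (Option Bool)) (c : Cmd) :
    Nonempty (Turing.TM2ComputableInPolyTime ea (fun l : List Bool => l)
      (fun a => c.output (ea a))) := by
  obtain ⟨p, h⟩ := runs_withLoopBound c
  refine ⟨{ tm := toFinTM2 (withLoopBound c) .inp .out
            inputAlphabet := Equiv.refl (Option Bool)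
            outputAlphabet := Equiv.refl Bool
            time := p + 1
            outputsFun := fun a => Classical.choice ?_ }⟩
  have h' := h (ea a)
  unfold Runs at h'
  rw [← update_nil_inp, ← update_nil_out] at h'
  have h2 := Exec.outputsInTime h'
  have e1 : List.map (Equiv.refl (Option Bool)).invFun (ea a) = ea a := List.map_id _
  have e2 : List.map (Equiv.refl Bool).invFun (c.output (ea a)) = c.output (ea a) :=
    List.map_id _
  have e3 : (p + 1).eval (ea a).length = p.eval (ea a).length + 1 := by simp
  rw [← e3] at h2
  obtain ⟨h2⟩ := h2
  refine ⟨?_⟩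
  convert h2 using 1
  exact congrArg₂ (fun a b => Turing.TM2OutputsInTime
    (toFinTM2 (withLoopBound c) .inp .out) a (some b) _) e1 e2

end StackProg

/-! ### Elimination of vertices in graphs of treewidth at most two -/

/-- The set `S` is nonempty and connected in `T`. -/
def SimpleGraph.ConnectedOn {ι : Type} (T : SimpleGraph ι) (S : Set ι) : Prop :=
  S.Nonempty ∧ ∀ a ∈ S, ∀ b ∈ S,
    Relation.ReflTransGen (fun p q => T.Adj p q ∧ p ∈ S ∧ q ∈ S) a b

theorem SimpleGraph.connectedOn_of_induce {ι : Type} {T : SimpleGraph ι} {S : Set ι}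
    (h : (T.induce S).Connected) : T.ConnectedOn S := by
  refine ⟨Set.nonempty_coe_sort.1 h.nonempty, fun a ha b hb => ?_⟩
  have := (SimpleGraph.reachable_iff_reflTransGen _ _).1 (h.preconnected ⟨a, ha⟩ ⟨b, hb⟩)
  exact this.lift Subtype.val fun p q hpq => ⟨hpq, p.2, q.2⟩

/-- All paths are led through the common node `c`. This provides the connectivity condition for a
vertex that arises by contraction. -/
theorem SimpleGraph.ConnectedOn.union {ι : Type} {T : SimpleGraph ι} {S S' : Set ι}
    (h : T.ConnectedOn S) (h' : T.ConnectedOn S') {c : ι} (hc : c ∈ S) (hc' : c ∈ S') :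
    T.ConnectedOn (S ∪ S') := by
  have l : ∀ a b, Relation.ReflTransGen (fun p q => T.Adj p q ∧ p ∈ S ∧ q ∈ S) a b →
      Relation.ReflTransGen (fun p q => T.Adj p q ∧ p ∈ S ∪ S' ∧ q ∈ S ∪ S') a b :=
    fun a b h => h.lift id fun p q hpq => ⟨hpq.1, Or.inl hpq.2.1, Or.inl hpq.2.2⟩
  have r : ∀ a b, Relation.ReflTransGen (fun p q => T.Adj p q ∧ p ∈ S' ∧ q ∈ S') a b →
      Relation.ReflTransGen (fun p q => T.Adj p q ∧ p ∈ S ∪ S' ∧ q ∈ S ∪ S') a b :=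
    fun a b h => h.lift id fun p q hpq => ⟨hpq.1, Or.inr hpq.2.1, Or.inr hpq.2.2⟩
  refine ⟨⟨c, Or.inl hc⟩, fun a ha b hb => Relation.ReflTransGen.trans (b := c) ?_ ?_⟩
  · rcases ha with ha | ha
    · exact l _ _ (h.2 a ha c hc)
    · exact r _ _ (h'.2 a ha c hc')
  · rcases hb with hb | hb
    · exact l _ _ (h.2 c hc b hb)
    · exact r _ _ (h'.2 c hc' b hb)

/-- The graph on `L` with the edges `R` has a tree decomposition with bags of size at most `3`. -/
def HasDecomp (L : Set ℕ) (R : ℕ → ℕ → Prop) : Prop :=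
  ∃ (ι : Type) (_ : Finite ι) (T : SimpleGraph ι) (bag : ι → Finset ℕ), T.IsTree ∧
    (∀ x, (bag x).card ≤ 3) ∧ (∀ x, ∀ v ∈ bag x, v ∈ L) ∧
    (∀ u ∈ L, ∀ v ∈ L, u ≠ v → R u v → ∃ x, u ∈ bag x ∧ v ∈ bag x) ∧
    ∀ v ∈ L, T.ConnectedOn {x | v ∈ bag x}

theorem HasDecomp.mono {L : Set ℕ} {R R' : ℕ → ℕ → Prop} (h : HasDecomp L R)
    (hR : ∀ u ∈ L, ∀ v ∈ L, u ≠ v → R' u v → R u v) : HasDecomp L R' := by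
  obtain ⟨ι, hι, T, bag, h1, h2, h3, h4, h5⟩ := h
  exact ⟨ι, hι, T, bag, h1, h2, h3,
    fun u hu v hv huv h => h4 u hu v hv huv (hR u hu v hv huv h), h5⟩

/-- Some vertex has all its neighbours in a set of size at most `3` that contains it. -/
theorem exists_small_neighborhood (L : Set ℕ) (hL : L.Nonempty) (R : ℕ → ℕ → Prop) :
    ∀ (n : ℕ) (ι : Type) (_ : Fintype ι) (T : SimpleGraph ι) (bag : ι → Finset ℕ),
    Fintype.card ι = n → T.IsTree → (∀ x, (bag x).card ≤ 3) → (∀ x, ∀ v ∈ bag x, v ∈ L) →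
    (∀ u ∈ L, ∀ v ∈ L, u ≠ v → R u v → ∃ x, u ∈ bag x ∧ v ∈ bag x) →
    (∀ v ∈ L, T.ConnectedOn {x | v ∈ bag x}) →
    ∃ v ∈ L, ∃ b : Finset ℕ, b.card ≤ 3 ∧ v ∈ b ∧ (∀ u ∈ b, u ∈ L) ∧
      ∀ u ∈ L, u ≠ v → R v u → u ∈ b := by
  classical
  intro n
  induction n with
  | zero =>
    intro ι _ T bag hn hT
    have := hT.connected.nonempty
    exact absurd hn Fintype.card_ne_zero
  | succ n ih =>
    intro ι _ T bag hn hT h2 h3 h4 h5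
    by_cases hnt : Nontrivial ι
    · obtain ⟨l, hl⟩ := hT.exists_vert_degree_one_of_nontrivial
      obtain ⟨p, hlp, hp⟩ := SimpleGraph.degree_eq_one_iff_existsUnique_adj.1 hl
      by_cases hsub : bag l ⊆ bag p
      -- The retraction that moves `l` to `p` loses no bag membership and maps each edge of the tree
      -- to an edge or a single node, so the connectivity of the node sets survives the pruning.
      · set r : ι → ({l}ᶜ : Set ι) := fun x =>
          if hx : x = l then ⟨p, fun h => hlp.ne h.symm⟩ else ⟨x, hx⟩ with hr
        have hrl : r l = ⟨p, fun h => hlp.ne h.symm⟩ := by simp [hr]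
        have hrn : ∀ x (hx : x ≠ l), r x = ⟨x, hx⟩ := fun x hx => by simp [hr, hx]
        have hmem : ∀ v x, v ∈ bag x → v ∈ bag (r x).1 := by
          intro v x hv
          by_cases hx : x = l
          · subst hx; rw [hrl]; exact hsub hv
          · rw [hrn x hx]; exact hv
        refine ih ({l}ᶜ : Set ι) inferInstance (T.induce {l}ᶜ) (fun x => bag x.1) ?_
          ⟨hT.connected.induce_compl_singleton_of_degree_eq_one hl, hT.isAcyclic.induce _⟩
          (fun x => h2 _) (fun x => h3 _) ?_ ?_
        · rw [Fintype.card_compl_set, hn]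
          simp
        · intro u hu v hv huv huR
          obtain ⟨x, hx1, hx2⟩ := h4 u hu v hv huv huR
          exact ⟨r x, hmem _ _ hx1, hmem _ _ hx2⟩
        · intro v hv
          obtain ⟨⟨x, hx⟩, hc⟩ := h5 v hv
          refine ⟨⟨r x, hmem _ _ hx⟩, fun a ha b hb => ?_⟩
          have key := (hc a.1 ha b.1 hb).lift' (p := fun p q => (T.induce {l}ᶜ).Adj p q ∧
            p ∈ {x : ({l}ᶜ : Set ι) | v ∈ bag x.1} ∧ q ∈ {x : ({l}ᶜ : Set ι) | v ∈ bag x.1}) r ?_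
          · unfold Function.onFun at key
            rwa [hrn a.1 a.2, hrn b.1 b.2] at key
          · rintro s t ⟨hst, hs, ht⟩
            unfold Function.onFun
            by_cases hsl : s = l
            · subst hsl
              rw [hrl, hp t hst, hrn p (fun h => hlp.ne h.symm)]
            · by_cases htl : t = l
              · subst htl
                rw [hrl, hp s hst.symm, hrn p (fun h => hlp.ne h.symm)]
              · refine Relation.ReflTransGen.single ⟨?_, hmem _ _ hs, hmem _ _ ht⟩
                rw [hrn s hsl, hrn t htl]
                exact hst
      -- The nodes of `v` are connected and any path leaving the leaf passes through `p`, so `v` is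
      -- in no other bag and all its neighbours are in this one.
      · obtain ⟨v, hvl, hvp⟩ := Finset.not_subset.1 hsub
        refine ⟨v, h3 _ _ hvl, bag l, h2 l, hvl, h3 l, fun u hu huv hR => ?_⟩
        obtain ⟨x, hx1, hx2⟩ := h4 v (h3 _ _ hvl) u hu huv.symm hR
        rcases Relation.ReflTransGen.cases_head ((h5 v (h3 _ _ hvl)).2 l hvl x hx1) with h | h
        · rwa [h]
        · obtain ⟨c, ⟨hc1, hc2, hc3⟩, -⟩ := h
          rw [hp c hc1] at hc3
          exact absurd hc3 hvp
    · rw [not_nontrivial_iff_subsingleton] at hnt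
      obtain ⟨v, hv⟩ := hL
      obtain ⟨⟨x, hx⟩, -⟩ := h5 v hv
      refine ⟨v, hv, bag x, h2 x, hx, h3 x, fun u hu huv hR => ?_⟩
      obtain ⟨y, -, hy⟩ := h4 v hv u hu huv.symm hR
      rwa [Subsingleton.elim x y]

/-- A nonempty graph of treewidth at most two has a vertex all whose neighbours are among two
vertices; if these differ, then they are neighbours. -/
theorem HasDecomp.exists_eliminable {L : Set ℕ} {R : ℕ → ℕ → Prop} (h : HasDecomp L R)
    (hL : L.Nonempty) :
    ∃ v ∈ L, (∀ u ∈ L, u ≠ v → ¬ R v u) ∨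
      ∃ x ∈ L, ∃ y ∈ L, x ≠ v ∧ y ≠ v ∧ x ≤ y ∧ R v x ∧ R v y ∧
        ∀ u ∈ L, u ≠ v → u ≠ x → u ≠ y → ¬ R v u := by
  classical
  obtain ⟨ι, hι, T, bag, h1, h2, h3, h4, h5⟩ := h
  obtain ⟨v, hv, b, hb, hvb, hbL, hR⟩ := exists_small_neighborhood L hL R _ ι
    (Fintype.ofFinite ι) T bag rfl h1 h2 h3 h4 h5
  refine ⟨v, hv, ?_⟩
  set N := (b.erase v).filter fun u => R v u with hN
  have hmem : ∀ u, u ∈ N ↔ u ∈ L ∧ u ≠ v ∧ R v u := by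
    intro u
    simp only [hN, Finset.mem_filter, Finset.mem_erase]
    exact ⟨fun h => ⟨hbL u h.1.2, h.1.1, h.2⟩, fun h => ⟨⟨h.2.1, hR u h.1 h.2.1 h.2.2⟩, h.2.2⟩⟩
  have hcard : N.card ≤ 2 := by
    refine (Finset.card_filter_le _ _).trans ?_
    rw [Finset.card_erase_of_mem hvb]
    omega
  rcases N.eq_empty_or_nonempty with h0 | h0
  · left
    intro u hu huv huR
    have := (hmem u).2 ⟨hu, huv, huR⟩
    simp [h0] at this
  · right
    -- The smallest and the largest neighbour are taken, which coincide if there is just one; a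
    -- further neighbour would lie strictly between them and be a third one.
    have hx := (hmem _).1 (N.min'_mem h0)
    have hy := (hmem _).1 (N.max'_mem h0)
    refine ⟨N.min' h0, hx.1, N.max' h0, hy.1, hx.2.1, hy.2.1, N.min'_le_max' h0, hx.2.2, hy.2.2,
      fun u hu huv hux huy huR => ?_⟩
    have hu := (hmem u).2 ⟨hu, huv, huR⟩
    have hlt1 := lt_of_le_of_ne (N.min'_le u hu) hux.symm
    have hlt2 := lt_of_le_of_ne (N.le_max' u hu) huy
    have hsub : ({N.min' h0, u, N.max' h0} : Finset ℕ) ⊆ N := by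
      intro a ha
      simp only [Finset.mem_insert, Finset.mem_singleton] at ha
      rcases ha with rfl | rfl | rfl
      · exact N.min'_mem h0
      · exact hu
      · exact N.max'_mem h0
    have := Finset.card_le_card hsub
    rw [Finset.card_eq_three.2 ⟨_, _, _, hlt1.ne, (hlt1.trans hlt2).ne, hlt2.ne, rfl⟩] at this
    omega

theorem HasDecomp.delete {L : Set ℕ} {R : ℕ → ℕ → Prop} (h : HasDecomp L R) (v : ℕ) :
    HasDecomp (L \ {v}) R := by
  classical
  obtain ⟨ι, hι, T, bag, h1, h2, h3, h4, h5⟩ := h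
  refine ⟨ι, hι, T, fun x => (bag x).erase v, h1,
    fun x => (Finset.card_le_card (Finset.erase_subset _ _)).trans (h2 x), ?_, ?_, ?_⟩
  · intro x u hu
    exact ⟨h3 x u (Finset.mem_of_mem_erase hu), Finset.ne_of_mem_erase hu⟩
  · intro a ha b hb hab hR
    obtain ⟨x, hx1, hx2⟩ := h4 a ha.1 b hb.1 hab hR
    exact ⟨x, Finset.mem_erase.2 ⟨ha.2, hx1⟩, Finset.mem_erase.2 ⟨hb.2, hx2⟩⟩
  · intro a ha
    have : {x | a ∈ (bag x).erase v} = {x | a ∈ bag x} := by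
      ext x
      exact ⟨fun h => Finset.mem_of_mem_erase h, fun h => Finset.mem_erase.2 ⟨ha.2, h⟩⟩
    rw [this]
    exact h5 a ha.1

/-- Contracting an edge `v x` yields a decomposition of the graph in which the neighbours of `v` are
joined with `x`. -/
theorem HasDecomp.contract {L : Set ℕ} {R : ℕ → ℕ → Prop} (h : HasDecomp L R) {v x : ℕ}
    (hv : v ∈ L) (hx : x ∈ L) (hxv : x ≠ v) (hR : R v x) :
    HasDecomp (L \ {v}) (fun a b => R a b ∨ a = x ∧ R v b) := by
  classical
  obtain ⟨ι, hι, T, bag, h1, h2, h3, h4, h5⟩ := h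
  -- Replacing `v` by `x` in every bag makes no bag larger. The nodes of the new `x` are those of
  -- `x` and of `v`, two connected sets that meet in a bag containing both ends of the edge.
  set f : ℕ → ℕ := fun u => if u = v then x else u with hf
  have hmem : ∀ t a, a ≠ v → (a ∈ (bag t).image f ↔ a ∈ bag t ∨ a = x ∧ v ∈ bag t) := by
    intro t a ha
    simp only [Finset.mem_image, hf]
    constructor
    · rintro ⟨u, hu, rfl⟩
      by_cases huv : u = v
      · subst huv; simp [hu]
      · simp [huv, hu]
    · rintro (h | ⟨rfl, h⟩)
      · exact ⟨a, h, by simp [ha]⟩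
      · exact ⟨v, h, by simp⟩
  refine ⟨ι, hι, T, fun t => (bag t).image f, h1, fun t => Finset.card_image_le.trans (h2 t),
    ?_, ?_, ?_⟩
  · intro t u hu
    obtain ⟨w, hw, rfl⟩ := Finset.mem_image.1 hu
    by_cases hwv : w = v
    · simpa [hf, hwv] using ⟨hx, hxv⟩
    · simpa [hf, hwv] using h3 t w hw
  · rintro a ⟨ha, hav⟩ b ⟨hb, hbv⟩ hab (hR' | ⟨rfl, hR'⟩)
    · obtain ⟨t, ht1, ht2⟩ := h4 a ha b hb hab hR'
      exact ⟨t, (hmem t a hav).2 (Or.inl ht1), (hmem t b hbv).2 (Or.inl ht2)⟩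
    · obtain ⟨t, ht1, ht2⟩ := h4 v hv b hb (Ne.symm hbv) hR'
      exact ⟨t, (hmem t a hav).2 (Or.inr ⟨rfl, ht1⟩), (hmem t b hbv).2 (Or.inl ht2)⟩
  · rintro a ⟨ha, hav⟩
    by_cases hax : a = x
    · subst hax
      have : {t | a ∈ (bag t).image f} = {t | a ∈ bag t} ∪ {t | v ∈ bag t} := by
        ext t
        exact (hmem t a hav).trans (or_congr Iff.rfl (and_iff_right rfl))
      rw [this]
      obtain ⟨t, ht1, ht2⟩ := h4 v hv a hx hxv.symm hR
      exact (h5 a ha).union (h5 v hv) ht2 ht1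
    · have : {t | a ∈ (bag t).image f} = {t | a ∈ bag t} := by
        ext t
        exact (hmem t a hav).trans (by simp [hax])
      rw [this]
      exact h5 a ha

/-- With natural numbers as vertices, the type stays the same while vertices are removed. -/
theorem TreewidthLE.hasDecomp {m : ℕ} {G : SimpleGraph (Fin m)} (h : TreewidthLE G 2) :
    HasDecomp {v | v < m} (fun a b => ∃ (ha : a < m) (hb : b < m), G.Adj ⟨a, ha⟩ ⟨b, hb⟩) := by
  obtain ⟨D, hD⟩ := h
  refine ⟨D.node, D.finite_node, D.tree, fun x => (D.bag x).map Fin.valEmbedding, D.isTree,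
    fun x => by simpa using hD x, ?_, ?_, ?_⟩
  · intro x v hv
    obtain ⟨w, -, rfl⟩ := Finset.mem_map.1 hv
    exact w.2
  · rintro u hu v hv - ⟨_, _, hR⟩
    obtain ⟨x, h1, h2⟩ := D.edge_mem _ _ hR
    exact ⟨x, Finset.mem_map.2 ⟨_, h1, rfl⟩, Finset.mem_map.2 ⟨_, h2, rfl⟩⟩
  · intro v hv
    have := SimpleGraph.connectedOn_of_induce (D.connected ⟨v, hv⟩)
    convert this using 2
    ext x
    refine Finset.mem_map.trans ?_
    constructor
    · rintro ⟨w, hw, rfl⟩; exact hw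
    · intro hw; exact ⟨_, hw, rfl⟩

/-! ### Derived commands -/

namespace Cmd

/-- The tables that a command may modify. -/
def writes : Cmd → List ℕ
  | skip => []
  | seq c d => c.writes ++ d.writes
  | set t _ _ _ => [t]
  | ite _ c d => c.writes ++ d.writes
  | loop c => c.writes
  | read t => [t]
  | out _ => []

/-- The frame rule for tables. Its hypothesis is syntactic, so that for concrete commands it can be
decided by computation. -/
theorem eval_mem_of_notMem (N : ℕ) {t : ℕ} (c : Cmd) :
    ∀ s : MemState, t ∉ c.writes → (c.eval N s).mem t = s.mem t := by
  induction c with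
  | skip => exact fun s _ => rfl
  | seq c d ihc ihd =>
    intro s h
    simp only [writes, List.mem_append, not_or] at h
    exact (ihd _ h.2).trans (ihc _ h.1)
  | set t' e₁ e₂ e =>
    intro s h
    simp only [writes, List.mem_singleton] at h
    funext i j
    simp [eval, setMem, h]
  | ite e c d ihc ihd =>
    intro s h
    simp only [writes, List.mem_append, not_or] at h
    simp only [eval]
    split
    · exact ihc s h.1
    · exact ihd s h.2
  | loop c ih =>
    intro s h
    simp only [eval]
    suffices h' : ∀ k, ((c.eval N)^[k] s).mem t = s.mem t from h' N
    intro k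
    induction k with
    | zero => rfl
    | succ k ihk => rw [Function.iterate_succ_apply']; exact (ih _ h).trans ihk
  | read t' =>
    intro s h
    simp only [writes, List.mem_singleton] at h
    funext i j
    simp [eval, setMem, h]
  | out => exact fun s _ => rfl

/-- The command writes no output. -/
def noOut : Cmd → Bool
  | seq c d => c.noOut && d.noOut
  | ite _ c d => c.noOut && d.noOut
  | loop c => c.noOut
  | out _ => false
  | _ => true

theorem eval_out_of_noOut (N : ℕ) (c : Cmd) :
    ∀ s : MemState, c.noOut = true → (c.eval N s).out = s.out := by
  induction c with
  | skip => exact fun s _ => rfl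
  | seq c d ihc ihd =>
    intro s h
    simp only [noOut, Bool.and_eq_true] at h
    exact (ihd _ h.2).trans (ihc _ h.1)
  | set => exact fun s _ => rfl
  | ite e c d ihc ihd =>
    intro s h
    simp only [noOut, Bool.and_eq_true] at h
    simp only [eval]
    split
    · exact ihc s h.1
    · exact ihd s h.2
  | loop c ih =>
    intro s h
    simp only [eval]
    suffices h' : ∀ k, ((c.eval N)^[k] s).out = s.out from h' N
    intro k
    induction k with
    | zero => rfl
    | succ k ihk => rw [Function.iterate_succ_apply']; exact (ih _ h).trans ihk
  | read => exact fun s _ => rfl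
  | out => intro s h; simp [noOut] at h

/-- An invariant of the body is an invariant of the loop. -/
theorem loop_induction {N : ℕ} {c : Cmd} (I : ℕ → MemState → Prop) {s : MemState} (h0 : I 0 s)
    (hstep : ∀ i < N, ∀ s, I i s → I (i + 1) (c.eval N s)) : I N ((loop c).eval N s) := by
  suffices h : ∀ k ≤ N, I k ((c.eval N)^[k] s) from h N le_rfl
  intro k
  induction k with
  | zero => exact fun _ => h0
  | succ k ih =>
    intro hk
    rw [Function.iterate_succ_apply']
    exact hstep k hk _ (ih (by omega))

/-- The value of a scalar variable. -/
def _root_.Expr.var (x : ℕ) : Expr := .get x (.const 0) (.const 0)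

@[simp] theorem _root_.Expr.eval_var (m : ℕ → ℕ → ℕ → ℕ) (x : ℕ) :
    (Expr.var x).eval m = m x 0 0 := rfl

/-- The truth value `1` or `0` of the negation. -/
def _root_.Expr.not (e : Expr) : Expr := .eq e (.const 0)

/-- Assignment to a scalar variable. -/
def asg (x : ℕ) (e : Expr) : Cmd := set x (.const 0) (.const 0) e

/-- The state after an assignment to a scalar variable. -/
def _root_.MemState.setVar (s : MemState) (x v : ℕ) : MemState :=
  {s with mem := setMem s.mem x 0 0 v}

@[simp] theorem eval_asg (N x : ℕ) (e : Expr) (s : MemState) :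
    (asg x e).eval N s = s.setVar x (e.eval s.mem) := rfl

/-- Run `c` for the values `0, …, N - 1` of the variable `x`. -/
def forIn (x : ℕ) (c : Cmd) : Cmd :=
  seq (asg x (.const 0)) (loop (seq c (asg x (.add (.var x) (.const 1)))))

@[simp] theorem mem_writes_forIn (x t : ℕ) (c : Cmd) :
    t ∈ (forIn x c).writes ↔ t = x ∨ t ∈ c.writes := by
  simp [forIn, writes, asg, or_comm]

/-- The invariant must survive arbitrary assignments to the counter `x`; the actual value of the
counter is handed to the step as a hypothesis. -/
theorem forIn_induction {N x : ℕ} {c : Cmd} (hx : x ∉ c.writes) (I : ℕ → MemState → Prop)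
    {s : MemState} (h0 : I 0 s) (hI : ∀ i s v, I i s → I i (s.setVar x v))
    (hstep : ∀ i < N, ∀ s, s.mem x 0 0 = i → I i s → I (i + 1) (c.eval N s)) :
    I N ((forIn x c).eval N s) := by
  refine (loop_induction (I := fun i s => s.mem x 0 0 = i ∧ I i s) (s := s.setVar x 0)
    ⟨by simp [MemState.setVar, setMem], hI _ _ _ h0⟩ ?_).2
  rintro i hi s ⟨h1, h2⟩
  have h3 : (c.eval N s).mem x 0 0 = i := by rw [eval_mem_of_notMem N c s hx, h1]
  refine ⟨?_, hI _ _ _ (hstep i hi s h1 h2)⟩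
  simp [eval, MemState.setVar, setMem, Expr.eval, h3]

/-- Run `c` if all conditions are nonzero. -/
def guard (es : List Expr) (c : Cmd) : Cmd := es.foldr (fun e d => ite e d skip) c

theorem eval_guard (N : ℕ) (c : Cmd) (s : MemState) : ∀ es : List Expr,
    (guard es c).eval N s = if ∀ e ∈ es, e.eval s.mem ≠ 0 then c.eval N s else s
  | [] => by simp [guard]
  | e :: es => by
    have ih := eval_guard N c s es
    simp only [guard, List.foldr_cons, eval] at ih ⊢
    rw [ih]
    by_cases h : e.eval s.mem = 0 <;> simp [h]

@[simp] theorem writes_guard (c : Cmd) : ∀ es : List Expr, (guard es c).writes = c.writes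
  | [] => rfl
  | e :: es => by
    have ih := writes_guard c es
    simp only [guard, List.foldr_cons, writes] at ih ⊢
    rw [ih, List.append_nil]

/-- For every `n`, process the indices `n - 1, …, 0` in this order. -/
def forDown (t i : ℕ) (n : Expr) (c : Cmd) : Cmd :=
  forIn t (forIn i (guard [.eq (.add (.add (.var t) (.var i)) (.const 1)) n] c))

/-- For each `t < n` exactly one `i` satisfies `t + i + 1 = n`, so the body sees descending indices
although both loops count upwards; `n ≤ N` makes all of them occur. -/
theorem forDown_induction {N t i n : ℕ} {e : Expr} {c : Cmd} (ht : t ∉ c.writes) (hi : i ∉ c.writes)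
    (hti : t ≠ i) (hn : n ≤ N) (I : ℕ → MemState → Prop) {s : MemState} (h0 : I n s)
    (he : ∀ k s, I k s → e.eval s.mem = n)
    (hI : ∀ k s v, I k s → I k (s.setVar t v) ∧ I k (s.setVar i v))
    (hstep : ∀ k < n, ∀ s, s.mem i 0 0 = k → I (k + 1) s → I k (c.eval N s)) :
    I 0 ((forDown t i e c).eval N s) := by
  have outer := forIn_induction (N := N) (x := t)
    (c := forIn i (guard [.eq (.add (.add (.var t) (.var i)) (.const 1)) e] c)) (s := s)
    (by simp [hti, ht]) (fun k s => I (n - k) s) (by simpa using h0) (fun k s v h => (hI _ _ _ h).1)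
    ?_
  · simpa [forDown, Nat.sub_eq_zero_of_le hn] using outer
  · intro k hk s hs h
    -- In pass `k` the body runs at `l = n - 1 - k`, and `k + l < n` says that this is still to
    -- come. In passes with `n ≤ k` both indices of the invariant are zero by truncated subtraction.
    have inner := forIn_induction (N := N) (x := i)
      (c := guard [.eq (.add (.add (.var t) (.var i)) (.const 1)) e] c) (s := s)
      (by simp [hi]) (fun l s => s.mem t 0 0 = k ∧ I (if k + l < n then n - k else n - (k + 1)) s)
      ⟨hs, by
        split
        · exact h
        · rwa [show n - (k + 1) = n - k by omega]⟩
      (fun l s v h => ⟨by simp [MemState.setVar, setMem, hti, h.1], (hI _ _ _ h.2).2⟩) ?_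
    · have h2 := inner.2
      rwa [if_neg (by omega)] at h2
    · rintro l hl s hsl ⟨h1, h2⟩
      rw [eval_guard]
      have hn := he _ _ h2
      by_cases hc : k + l + 1 = n
      · rw [if_pos (by simp [Expr.eval, hsl, h1, hn, hc])]
        refine ⟨by rw [eval_mem_of_notMem N c s ht, h1], ?_⟩
        rw [if_neg (by omega)]
        rw [if_pos (by omega)] at h2
        rw [show n - (k + 1) = l by omega]
        rw [show n - k = l + 1 by omega] at h2
        exact hstep l (by omega) s hsl h2
      · rw [if_neg (by simp [Expr.eval, hsl, h1, hn, hc])]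
        refine ⟨h1, ?_⟩
        by_cases h3 : k + l < n
        · rw [if_pos h3] at h2
          rwa [if_pos (by omega)]
        · rw [if_neg h3] at h2
          rwa [if_neg (by omega)]

end Cmd

/-! ### Elimination of variables in a sum of pairwise costs -/

theorem HasDecomp.symm_closure {L : Set ℕ} {R : ℕ → ℕ → Prop} (h : HasDecomp L R) :
    HasDecomp L fun a b => R a b ∨ R b a := by
  obtain ⟨ι, hι, T, bag, h1, h2, h3, h4, h5⟩ := h
  refine ⟨ι, hι, T, bag, h1, h2, h3, fun u hu v hv huv h => ?_, h5⟩
  rcases h with h | h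
  · exact h4 u hu v hv huv h
  · obtain ⟨x, hx⟩ := h4 v hv u hu huv.symm h
    exact ⟨x, hx.symm⟩

/-- A sum of pairwise costs `W` together with a log of `r` eliminations: in the `i`-th one the
vertex `V i` was removed, whose best value `D a b i` depends on the values `a` and `b` of `X i` and
`Y i`. -/
@[ext] structure Elim where
  W : Bool → Bool → ℕ → ℕ → ℕ
  D : Bool → Bool → ℕ → ℕ
  V : ℕ → ℕ
  X : ℕ → ℕ
  Y : ℕ → ℕ
  dead : ℕ → ℕ
  r : ℕ

namespace Elim

/-- The sum of the pairwise costs over the vertices in `L`. -/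
def total (W : Bool → Bool → ℕ → ℕ → ℕ) (L : Finset ℕ) (σ : ℕ → Bool) : ℕ :=
  ∑ k ∈ L, ∑ j ∈ L, W (σ k) (σ j) k j

variable (A : Elim)

/-- The joint cost of the value `d` of `v` and the value `a` of `u`. -/
def cross (d a : Bool) (v u : ℕ) : ℕ := A.W d a v u + A.W a d u v

/-- A number that is zero if there are no joint costs of `v` and `u`. -/
def adj (v u : ℕ) : ℕ := ∑ d, ∑ a, A.cross d a v u

theorem cross_eq_zero {v u : ℕ} (h : A.adj v u = 0) (d a : Bool) : A.cross d a v u = 0 := by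
  simp only [adj, Finset.sum_eq_zero_iff, Finset.mem_univ, true_implies] at h
  exact h d a

theorem adj_eq_zero {v u : ℕ} : A.adj v u = 0 ↔ ∀ d a, A.W d a v u = 0 ∧ A.W a d u v = 0 := by
  simp [adj, cross]
  tauto

/-- The second neighbour, or the dummy vertex `m` if it equals the first one. -/
def second (m x y : ℕ) : ℕ := if x = y then m else y

/-- The cost of the value `d` of `v`, if all neighbours of `v` are `x` and `y`, and these have the
values `a` and `b`. -/
def localCost (m v x y : ℕ) (d a b : Bool) : ℕ :=
  A.W d d v v + A.cross d a v x + A.cross d b v (second m x y)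

/-- The elimination of the vertex `v` with the neighbours `x` and `y`. -/
def eliminate (m v x y : ℕ) : Elim where
  -- If `x = y`, then sums over assignments read only the entries with `a = b`, so the other entries
  -- may receive anything.
  W a b k j := if k = x ∧ j = y then
    A.W a b k j + min (A.localCost m v x y false a b) (A.localCost m v x y true a b) else A.W a b k j
  D a b i := if i = A.r then
    if A.localCost m v x y true a b < A.localCost m v x y false a b then 1 else 0 else A.D a b i
  V i := if i = A.r then v else A.V i
  X i := if i = A.r then x else A.X i
  Y i := if i = A.r then y else A.Y i
  dead i := if i = v then 1 else A.dead i
  r := A.r + 1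

/-- The vertices up to `m` that have not been eliminated. -/
def live (m : ℕ) : Finset ℕ := (Finset.range (m + 1)).filter fun v => A.dead v = 0

theorem mem_live {m v : ℕ} : v ∈ A.live m ↔ v ≤ m ∧ A.dead v = 0 := by
  simp [live]

/-- The vertex `v` can be eliminated with neighbours `x` and `y`. -/
structure Elig (m v x y : ℕ) : Prop where
  lt : v < m
  mem_v : v ∈ A.live m
  mem_x : x ∈ A.live m
  mem_y : y ∈ A.live m
  le : x ≤ y
  ne_x : x ≠ v
  ne_y : y ≠ v
  adj_eq : ∀ u ∈ A.live m, u ≠ v → u ≠ x → u ≠ y → A.adj v u = 0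
  adj_ne : x ≠ y → A.adj v x ≠ 0 ∧ A.adj v y ≠ 0

/-- The assignment `σ` gives all eliminated vertices their best values. -/
def Obeys (σ : ℕ → Bool) : Prop :=
  ∀ i < A.r, σ (A.V i) = decide (A.D (σ (A.X i)) (σ (A.Y i)) i ≠ 0)

/-- The remaining costs are the minimum of `cost` over the values of the eliminated vertices. -/
structure Inv (m : ℕ) (cost : (ℕ → Bool) → ℕ) : Prop where
  dead_iff : ∀ v, A.dead v ≠ 0 ↔ ∃ i < A.r, A.V i = v
  lt : ∀ i < A.r, A.V i < m
  inj : ∀ i < A.r, ∀ j < i, A.V j ≠ A.V i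
  parents : ∀ i < A.r, ∀ j ≤ i, A.V j ≠ A.X i ∧ A.V j ≠ A.Y i
  le_cost : ∀ σ, total A.W (A.live m) σ ≤ cost σ
  eq_cost : ∀ σ, A.Obeys σ → total A.W (A.live m) σ = cost σ
  decomp : HasDecomp {v | v < m ∧ A.dead v = 0} fun u v => A.adj u v ≠ 0
  dummy : ∀ v < m, A.adj v m = 0

variable {A}

theorem total_insert (A : Elim) {L : Finset ℕ} {v : ℕ} (hv : v ∉ L) (σ : ℕ → Bool) :
    total A.W (insert v L) σ =
      total A.W L σ + A.W (σ v) (σ v) v v + ∑ u ∈ L, A.cross (σ v) (σ u) v u := by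
  simp only [total, Finset.sum_insert hv, cross, Finset.sum_add_distrib]
  ring

/-- Only `x` and `y` have joint costs with `v`. If they coincide, the second cross term is taken
with the dummy vertex and vanishes, so nothing is counted twice. -/
theorem Elig.sum_cross {m v x y : ℕ} (h : A.Elig m v x y) (hd : A.adj v m = 0) (σ : ℕ → Bool) :
    A.W (σ v) (σ v) v v + ∑ u ∈ (A.live m).erase v, A.cross (σ v) (σ u) v u =
      A.localCost m v x y (σ v) (σ x) (σ y) := by
  have hx : x ∈ (A.live m).erase v := Finset.mem_erase.2 ⟨h.ne_x, h.mem_x⟩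
  have hy : y ∈ (A.live m).erase v := Finset.mem_erase.2 ⟨h.ne_y, h.mem_y⟩
  have h0 : ∀ u ∈ (A.live m).erase v, u ≠ x → u ≠ y → A.cross (σ v) (σ u) v u = 0 :=
    fun u hu h1 h2 => A.cross_eq_zero
      (h.adj_eq u (Finset.mem_of_mem_erase hu) (Finset.ne_of_mem_erase hu) h1 h2) _ _
  rw [localCost, add_assoc]
  congr 1
  by_cases hxy : x = y
  · subst hxy
    rw [second, if_pos rfl, A.cross_eq_zero hd, Finset.sum_eq_single_of_mem x hx
      fun u hu hux => h0 u hu hux hux, add_zero]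
  · rw [second, if_neg hxy, ← Finset.add_sum_erase _ _ hx, Finset.sum_eq_single_of_mem y
      (Finset.mem_erase.2 ⟨fun h => hxy h.symm, hy⟩)]
    intro u hu huy
    rw [Finset.mem_erase] at hu
    exact h0 u hu.2 hu.1 huy

theorem total_eliminate (A : Elim) {m v x y : ℕ} {L : Finset ℕ} (hx : x ∈ L) (hy : y ∈ L)
    (σ : ℕ → Bool) : total (A.eliminate m v x y).W L σ = total A.W L σ +
      min (A.localCost m v x y false (σ x) (σ y)) (A.localCost m v x y true (σ x) (σ y)) := by
  have h : ∀ k j, (A.eliminate m v x y).W (σ k) (σ j) k j = A.W (σ k) (σ j) k j +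
      if j = y then if k = x then
        min (A.localCost m v x y false (σ x) (σ y)) (A.localCost m v x y true (σ x) (σ y)) else 0
      else 0 := by
    intro k j
    simp only [eliminate]
    by_cases hk : k = x <;> by_cases hj : j = y <;> simp [hk, hj]
  simp only [total, h, Finset.sum_add_distrib, Finset.sum_ite_eq', hx, hy, if_true]

theorem live_eliminate (A : Elim) (m v x y : ℕ) :
    (A.eliminate m v x y).live m = (A.live m).erase v := by
  ext u
  rw [Finset.mem_erase, mem_live, mem_live]
  by_cases h : u = v <;> simp [eliminate, h]

theorem Elig.adj_eliminate {m v x y a b : ℕ} (h : (A.eliminate m v x y).adj a b ≠ 0) :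
    A.adj a b ≠ 0 ∨ (a = x ∧ b = y) ∨ (a = y ∧ b = x) := by
  by_contra hc
  push Not at hc
  obtain ⟨h1, h2, h3⟩ := hc
  refine h ?_
  rw [adj_eq_zero] at h1 ⊢
  intro d e
  simp only [eliminate]
  rw [if_neg fun h => h2 h.1 h.2, if_neg fun h => h3 h.2 h.1]
  exact h1 d e

/-- The summands that involve `v` are replaced by their minimum over the two values of `v`. The
lower bound persists, and so does equality for assignments that follow the newly logged choice. -/
theorem Inv.eliminate {m : ℕ} {cost : (ℕ → Bool) → ℕ} (h : A.Inv m cost) {v x y : ℕ}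
    (he : A.Elig m v x y) : (A.eliminate m v x y).Inv m cost := by
  have hv := (A.mem_live.1 he.mem_v).2
  have hx := (A.mem_live.1 he.mem_x).2
  have hy := (A.mem_live.1 he.mem_y).2
  have hnot : ∀ u, A.dead u = 0 → ∀ i < A.r, A.V i ≠ u :=
    fun u hu i hi hi' => (h.dead_iff u).2 ⟨i, hi, hi'⟩ hu
  have htot : ∀ σ, total A.W (A.live m) σ = total A.W ((A.live m).erase v) σ +
      A.localCost m v x y (σ v) (σ x) (σ y) := by
    intro σ
    rw [← he.sum_cross (h.dummy v he.lt) σ, ← add_assoc, ← total_insert A (Finset.notMem_erase _ _),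
      Finset.insert_erase he.mem_v]
  have htot' : ∀ σ, total (A.eliminate m v x y).W ((A.eliminate m v x y).live m) σ =
      total A.W ((A.live m).erase v) σ +
      min (A.localCost m v x y false (σ x) (σ y)) (A.localCost m v x y true (σ x) (σ y)) := by
    intro σ
    rw [live_eliminate, total_eliminate A (Finset.mem_erase.2 ⟨he.ne_x, he.mem_x⟩)
      (Finset.mem_erase.2 ⟨he.ne_y, he.mem_y⟩)]
  have hold : ∀ i, i < A.r → i ≠ A.r := fun i hi => hi.ne
  constructor
  · intro u
    by_cases hu : u = v
    · subst hu
      simp only [Elim.eliminate, if_true]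
      exact ⟨fun _ => ⟨A.r, by omega, by simp⟩, fun _ => one_ne_zero⟩
    · simp only [Elim.eliminate, if_neg hu]
      rw [h.dead_iff]
      constructor
      · rintro ⟨i, hi, h1⟩
        exact ⟨i, by omega, by rwa [if_neg (hold i hi)]⟩
      · rintro ⟨i, hi, h1⟩
        split at h1
        · exact absurd h1.symm hu
        · exact ⟨i, by omega, h1⟩
  · intro i hi
    simp only [Elim.eliminate] at hi ⊢
    split
    · exact he.lt
    · exact h.lt i (by omega)
  · intro i hi j hj
    simp only [Elim.eliminate] at hi ⊢
    rw [if_neg (by omega : j ≠ A.r)]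
    split
    · exact hnot v hv j (by omega)
    · exact h.inj i (by omega) j hj
  · intro i hi j hj
    simp only [Elim.eliminate] at hi ⊢
    by_cases hi' : i = A.r
    · simp only [if_pos hi']
      split
      · exact ⟨he.ne_x.symm, he.ne_y.symm⟩
      · exact ⟨hnot x hx j (by omega), hnot y hy j (by omega)⟩
    · simp only [if_neg hi', if_neg (by omega : j ≠ A.r)]
      exact h.parents i (by omega) j hj
  · intro σ
    refine le_trans ?_ (h.le_cost σ)
    rw [htot, htot']
    gcongr
    cases σ v
    · exact min_le_left _ _
    · exact min_le_right _ _
  · intro σ hσ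
    have h1 : A.Obeys σ := by
      intro i hi
      have := hσ i (Nat.lt_succ_of_lt hi)
      simp only [Elim.eliminate, if_neg (hold i hi)] at this
      exact this
    have h2 := hσ A.r (Nat.lt_succ_self _)
    simp only [Elim.eliminate, if_true] at h2
    rw [← h.eq_cost σ h1, htot, htot', h2]
    congr 1
    by_cases hlt : A.localCost m v x y true (σ x) (σ y) < A.localCost m v x y false (σ x) (σ y)
    · simp [hlt, hlt.le]
    · simp [hlt, not_lt.1 hlt]
  · have hset : ({u | u < m ∧ (A.eliminate m v x y).dead u = 0} : Set ℕ) =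
        {u | u < m ∧ A.dead u = 0} \ {v} := by
      ext u
      change (u < m ∧ (if u = v then 1 else A.dead u) = 0) ↔ (u < m ∧ A.dead u = 0) ∧ u ≠ v
      by_cases hu : u = v <;> simp [hu]
    rw [hset]
    -- If `x = y`, no edge between distinct vertices is added and `v` can be deleted. Otherwise the
    -- new edge between `x` and `y` is the image of the edge between `v` and `y` when `v` is
    -- contracted into `x`.
    by_cases hxy : x = y
    · refine (h.decomp.delete v).mono fun a _ b _ hab hadj => ?_
      rcases Elig.adj_eliminate hadj with h1 | h1 | h1
      · exact h1
      · exact absurd (h1.1.trans (hxy.trans h1.2.symm)) hab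
      · exact absurd (h1.1.trans (hxy.symm.trans h1.2.symm)) hab
    · have hxm : x < m := by
        refine lt_of_le_of_ne (A.mem_live.1 he.mem_x).1 fun hxm => (he.adj_ne hxy).1 ?_
        rw [hxm]
        exact h.dummy v he.lt
      refine (h.decomp.contract (v := v) (x := x) ⟨he.lt, hv⟩ ⟨hxm, hx⟩ he.ne_x
        (he.adj_ne hxy).1).symm_closure.mono fun a _ b _ hab hadj => ?_
      rcases Elig.adj_eliminate hadj with h1 | h1 | h1
      · exact Or.inl (Or.inl h1)
      · exact Or.inl (Or.inr ⟨h1.1, h1.2 ▸ (he.adj_ne hxy).2⟩)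
      · exact Or.inr (Or.inr ⟨h1.2, h1.1 ▸ (he.adj_ne hxy).2⟩)
  -- The dummy vertex has no joint costs with `v`, so it is not one of two distinct neighbours of
  -- `v` and no new edge reaches it.
  · intro u hu
    by_contra hadj
    rcases Elig.adj_eliminate hadj with h1 | h1 | h1
    · exact h1 (h.dummy u hu)
    · have hxy : x ≠ y := by rw [← h1.1, ← h1.2]; exact hu.ne
      exact (he.adj_ne hxy).2 (h1.2 ▸ h.dummy v he.lt)
    · have hxy : x ≠ y := by rw [← h1.1, ← h1.2]; exact hu.ne'
      exact (he.adj_ne hxy).1 (h1.2 ▸ h.dummy v he.lt)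

theorem Inv.dead_dummy {m : ℕ} {cost : (ℕ → Bool) → ℕ} (h : A.Inv m cost) : A.dead m = 0 := by
  by_contra hc
  obtain ⟨i, hi, h1⟩ := (h.dead_iff m).1 hc
  exact (h.lt i hi).ne h1

/-- An isolated vertex takes the dummy vertex in both roles, a vertex with a single neighbour takes
this neighbour in both. -/
theorem Inv.exists_elig {m : ℕ} {cost : (ℕ → Bool) → ℕ} (h : A.Inv m cost) {w : ℕ} (hw : w < m)
    (hw' : A.dead w = 0) : ∃ v x y, A.Elig m v x y := by
  have hm : m ∈ A.live m := A.mem_live.2 ⟨le_rfl, h.dead_dummy⟩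
  obtain ⟨v, hv, h1 | ⟨x, hx, y, hy, hxv, hyv, hxy, h1, h2, h3⟩⟩ :=
    h.decomp.exists_eliminable ⟨w, hw, hw'⟩
  · refine ⟨v, m, m, hv.1, A.mem_live.2 ⟨hv.1.le, hv.2⟩, hm, hm, le_rfl, hv.1.ne', hv.1.ne', ?_,
      fun h => absurd rfl h⟩
    intro u hu huv hum _
    rw [mem_live] at hu
    exact not_not.1 (h1 u ⟨by omega, hu.2⟩ huv)
  · refine ⟨v, x, y, hv.1, A.mem_live.2 ⟨hv.1.le, hv.2⟩, A.mem_live.2 ⟨hx.1.le, hx.2⟩,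
      A.mem_live.2 ⟨hy.1.le, hy.2⟩, hxy, hxv, hyv, ?_, fun _ => ⟨h1, h2⟩⟩
    intro u hu huv hux huy
    rw [mem_live] at hu
    by_cases hum : u = m
    · rw [hum]
      exact h.dummy v hv.1
    · exact not_not.1 (h3 u ⟨by omega, hu.2⟩ huv hux huy)

theorem Inv.r_le {m : ℕ} {cost : (ℕ → Bool) → ℕ} (h : A.Inv m cost) : A.r ≤ m := by
  have : (Finset.range A.r).card ≤ (Finset.range m).card := by
    refine Finset.card_le_card_of_injOn A.V (fun i hi => ?_) fun i hi j hj hij => ?_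
    · simpa using h.lt i (by simpa using hi)
    · simp only [Finset.coe_range, Set.mem_Iio] at hi hj
      rcases lt_trichotomy i j with hlt | rfl | hlt
      · exact absurd hij (h.inj j hj i hlt)
      · rfl
      · exact absurd hij.symm (h.inj i hi j hlt)
  simpa using this

theorem Inv.exists_live {m : ℕ} {cost : (ℕ → Bool) → ℕ} (h : A.Inv m cost) (hr : A.r < m) :
    ∃ w < m, A.dead w = 0 := by
  by_contra hc
  push Not at hc
  have : (Finset.range m).card ≤ (Finset.range A.r).card := by
    refine Finset.card_le_card_of_surjOn A.V fun v hv => ?_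
    obtain ⟨i, hi, h1⟩ := (h.dead_iff v).1 (hc v (by simpa using hv))
    exact ⟨i, by simpa using hi, h1⟩
  simp at this
  omega

/-- Only the dummy vertex is left, so the remaining sum depends on its value alone. The sum equals
the cost of `σ` and is a lower bound of the cost of `τ`. -/
theorem Inv.optimal {m : ℕ} {cost : (ℕ → Bool) → ℕ} (h : A.Inv m cost) (hr : m ≤ A.r)
    {σ τ : ℕ → Bool} (hσ : A.Obeys σ) (hστ : σ m = τ m) : cost σ ≤ cost τ := by
  have hlive : A.live m = {m} := by
    ext v
    rw [mem_live, Finset.mem_singleton]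
    refine ⟨fun hv => ?_, fun hv => ⟨hv.le, hv ▸ h.dead_dummy⟩⟩
    by_contra hvm
    have hsurj : Finset.image A.V (Finset.range A.r) = Finset.range m := by
      refine Finset.eq_of_subset_of_card_le (fun u hu => ?_) ?_
      · obtain ⟨i, hi, rfl⟩ := Finset.mem_image.1 hu
        simpa using h.lt i (by simpa using hi)
      · rw [Finset.card_image_of_injOn]
        · simpa using hr
        · intro i hi j hj hij
          simp only [Finset.coe_range, Set.mem_Iio] at hi hj
          rcases lt_trichotomy i j with hlt | rfl | hlt
          · exact absurd hij (h.inj j hj i hlt)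
          · rfl
          · exact absurd hij.symm (h.inj i hi j hlt)
    have hv' : v ∈ Finset.image A.V (Finset.range A.r) := by
      rw [hsurj]
      simp only [Finset.mem_range]
      omega
    obtain ⟨i, hi, h1⟩ := Finset.mem_image.1 hv'
    exact (h.dead_iff v).2 ⟨i, by simpa using hi, h1⟩ hv.2
  rw [← h.eq_cost σ hσ]
  refine le_trans (le_of_eq ?_) (h.le_cost τ)
  rw [hlive]
  simp [total, hστ]

end Elim

/-! ### The elimination program

Table `0` holds the number `m` of issues, tables `7`, `8`, `9`, `13` the vertices of the current
elimination, and the tables of `Elim.ofMem` the costs and the log. -/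

/-- The table of the costs of the values `a` and `b`. -/
def tagW : Bool → Bool → ℕ
  | false, false => 20
  | false, true => 21
  | true, false => 22
  | true, true => 23

/-- The table of the best values for the values `a` and `b` of the neighbours. -/
def tagD : Bool → Bool → ℕ
  | false, false => 34
  | false, true => 35
  | true, false => 36
  | true, true => 37

/-- The tables that hold the costs and the log of eliminations. -/
def elimTags : List ℕ := [12, 20, 21, 22, 23, 30, 31, 32, 33, 34, 35, 36, 37]

/-- The costs and the log of eliminations that a memory holds. -/
def Elim.ofMem (mem : ℕ → ℕ → ℕ → ℕ) : Elim where
  W a b k j := mem (tagW a b) k j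
  D a b i := mem (tagD a b) i 0
  V i := mem 31 i 0
  X i := mem 32 i 0
  Y i := mem 33 i 0
  dead i := mem 30 i 0
  r := mem 12 0 0

theorem Elim.ofMem_congr {mem mem' : ℕ → ℕ → ℕ → ℕ} (h : ∀ t ∈ elimTags, mem' t = mem t) :
    Elim.ofMem mem' = Elim.ofMem mem := by
  simp only [elimTags, List.forall_mem_cons] at h
  obtain ⟨h0, h1, h2, h3, h4, h5, h6, h7, h8, h9, h10, h11, h12, -⟩ := h
  ext a b <;> try rcases a with _ | _ <;> try rcases b with _ | _
  all_goals simp only [ofMem, tagW, tagD, *]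

theorem MemState.setVar_mem_of_ne {s : MemState} {x v t : ℕ} (h : t ≠ x) :
    (s.setVar x v).mem t = s.mem t := by
  funext i j
  simp [setVar, setMem, h]

@[simp] theorem MemState.setVar_mem_self {s : MemState} {x v : ℕ} :
    (s.setVar x v).mem x 0 0 = v := by
  simp [setVar, setMem]

theorem Elim.ofMem_setVar {s : MemState} {x v : ℕ} (h : x ∉ elimTags) :
    Elim.ofMem (s.setVar x v).mem = Elim.ofMem s.mem :=
  ofMem_congr fun _ ht => MemState.setVar_mem_of_ne fun h' => h (h' ▸ ht)

theorem Elim.ofMem_eval {N : ℕ} {c : Cmd} {s : MemState} (h : ∀ t ∈ elimTags, t ∉ c.writes) :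
    Elim.ofMem (c.eval N s).mem = Elim.ofMem s.mem :=
  ofMem_congr fun t ht => c.eval_mem_of_notMem N s (h t ht)

namespace Elim

/-- The expression for the joint cost of the value `d` of the current vertex and the value `a` of
the vertex `u`. -/
def crossExpr (d a : Bool) (u : Expr) : Expr :=
  .add (.get (tagW d a) (.var 7) u) (.get (tagW a d) u (.var 7))

/-- The expression that is zero if there are no joint costs of the current vertex and `u`. -/
def adjExpr (u : Expr) : Expr :=
  .add (.add (crossExpr true true u) (crossExpr true false u))
    (.add (crossExpr false true u) (crossExpr false false u))

/-- The expression for the cost of the value `d` of the current vertex. -/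
def localExpr (d a b : Bool) : Expr :=
  .add (.add (.get (tagW d d) (.var 7) (.var 7)) (crossExpr d a (.var 8))) (crossExpr d b (.var 13))

theorem eval_adjExpr (mem : ℕ → ℕ → ℕ → ℕ) (u : Expr) :
    (adjExpr u).eval mem = (ofMem mem).adj (mem 7 0 0) (u.eval mem) := by
  simp [adjExpr, crossExpr, Expr.eval, adj, cross, ofMem]

theorem eval_localExpr {mem : ℕ → ℕ → ℕ → ℕ} {m v x y : ℕ} (hv : mem 7 0 0 = v) (hx : mem 8 0 0 = x)
    (hy : mem 13 0 0 = second m x y) (d a b : Bool) :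
    (localExpr d a b).eval mem = (ofMem mem).localCost m v x y d a b := by
  simp [localExpr, crossExpr, Expr.eval, localCost, cross, ofMem, hv, hx, hy]

/-- Log a best value `d` of the current vertex, and add its cost to the cost of the values `a` and
`b`. -/
def chooseCmd (d a b : Bool) : Cmd :=
  .seq (.set (tagD a b) (.var 12) (.const 0) (.const d.toNat))
    (.set (tagW a b) (.var 8) (.var 9)
      (.add (.get (tagW a b) (.var 8) (.var 9)) (localExpr d a b)))

/-- Choose a best value of the current vertex for the values `a` and `b`. -/
def chooseBest (a b : Bool) : Cmd :=
  .ite (.lt (localExpr true a b) (localExpr false a b)) (chooseCmd true a b) (chooseCmd false a b)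

/-- Log the removal of the current vertex. -/
def logCmd : Cmd :=
  .seq (.set 31 (.var 12) (.const 0) (.var 7)) (.seq (.set 32 (.var 12) (.const 0) (.var 8))
    (.seq (.set 33 (.var 12) (.const 0) (.var 9)) (.seq (.set 30 (.var 7) (.const 0) (.const 1))
    (.asg 12 (.add (.var 12) (.const 1))))))

/-- Eliminate the current vertex. -/
def eliminateCmd : Cmd :=
  .seq (.ite (.eq (.var 8) (.var 9)) (.asg 13 (.var 0)) (.asg 13 (.var 9)))
    (.seq (chooseBest false false) (.seq (chooseBest false true)
      (.seq (chooseBest true false) (.seq (chooseBest true true) logCmd))))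

/-- The effect of choosing best values for the pairs of values in `S`. -/
def choose (A : Elim) (S : Bool → Bool → Prop) [∀ a b, Decidable (S a b)] (m v x y : ℕ) : Elim :=
  {A with
    W := fun a b k j => if S a b then (A.eliminate m v x y).W a b k j else A.W a b k j
    D := fun a b i => if S a b then (A.eliminate m v x y).D a b i else A.D a b i}

/-- The updates touch only the entry of `x` and `y`, which differ from `v`, so the local costs can
be recomputed from the partly updated memory. -/
theorem localCost_choose (A : Elim) (S : Bool → Bool → Prop) [∀ a b, Decidable (S a b)]
    {m v x y : ℕ} (hx : x ≠ v) (hy : y ≠ v) (d a b : Bool) :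
    (A.choose S m v x y).localCost m v x y d a b = A.localCost m v x y d a b := by
  simp [localCost, cross, choose, eliminate, hx.symm, hy.symm]

/-- The memory holds the vertices of the current elimination. -/
def Current (mem : ℕ → ℕ → ℕ → ℕ) (m v x y : ℕ) : Prop :=
  mem 7 0 0 = v ∧ mem 8 0 0 = x ∧ mem 9 0 0 = y ∧ mem 13 0 0 = second m x y

theorem eval_chooseCmd (N : ℕ) (s : MemState) (d a b : Bool) :
    ((chooseCmd d a b).eval N s).mem =
      setMem (setMem s.mem (tagD a b) (s.mem 12 0 0) 0 d.toNat) (tagW a b)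
        (s.mem 8 0 0) (s.mem 9 0 0)
        (s.mem (tagW a b) (s.mem 8 0 0) (s.mem 9 0 0) + (localExpr d a b).eval s.mem) := by
  have h : ∀ t i j, t ∉ [34, 35, 36, 37] →
      setMem s.mem (tagD a b) (s.mem 12 0 0) 0 d.toNat t i j = s.mem t i j := by
    intro t i j ht
    simp only [List.mem_cons, List.not_mem_nil, or_false, not_or] at ht
    simp only [setMem]
    rw [if_neg]
    rintro ⟨h1, -⟩
    cases a <;> cases b <;> simp only [tagD] at h1 <;> omega
  have hW : ∀ a b, tagW a b ∉ [34, 35, 36, 37] := by decide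
  simp only [chooseCmd, Cmd.eval, Expr.eval_var, Expr.eval, localExpr, crossExpr]
  rw [h 8 _ _ (by simp), h 9 _ _ (by simp), h 7 _ _ (by simp), h 13 _ _ (by simp)]
  simp only [h _ _ _ (hW _ _)]

/-- `S` collects the pairs of values already handled. As the pair `a`, `b` is not among them, its
entries are still those of `A`. Four applications lead from the empty `S` to the full one. -/
theorem chooseBest_spec (N : ℕ) {A : Elim} {S : Bool → Bool → Prop} [∀ a b, Decidable (S a b)]
    {m v x y : ℕ} (hx : x ≠ v) (hy : y ≠ v) {s : MemState} (hs : Current s.mem m v x y)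
    (hA : ofMem s.mem = A.choose S m v x y) {a b : Bool} (hab : ¬ S a b) :
    Current ((chooseBest a b).eval N s).mem m v x y ∧
      ofMem ((chooseBest a b).eval N s).mem =
        A.choose (fun a' b' => S a' b' ∨ a' = a ∧ b' = b) m v x y := by
  have hframe : ∀ t, t ≠ tagW a b → t ≠ tagD a b →
      ((chooseBest a b).eval N s).mem t = s.mem t := fun t h1 h2 =>
    Cmd.eval_mem_of_notMem N _ s (by simp [chooseBest, chooseCmd, Cmd.writes, h1, h2])
  have hWt : ∀ t ∈ [7, 8, 9, 13, 12, 30, 31, 32, 33], ∀ a b, t ≠ tagW a b ∧ t ≠ tagD a b := by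
    decide
  have hframe' : ∀ t ∈ [7, 8, 9, 13, 12, 30, 31, 32, 33],
      ((chooseBest a b).eval N s).mem t = s.mem t :=
    fun t ht => hframe t (hWt t ht a b).1 (hWt t ht a b).2
  obtain ⟨h7, h8, h9, h13⟩ := hs
  refine ⟨⟨?_, ?_, ?_, ?_⟩, ?_⟩
  · rw [hframe' _ (by simp), h7]
  · rw [hframe' _ (by simp), h8]
  · rw [hframe' _ (by simp), h9]
  · rw [hframe' _ (by simp), h13]
  have hloc : ∀ d, (localExpr d a b).eval s.mem = A.localCost m v x y d a b := fun d => by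
    rw [eval_localExpr h7 h8 h13, hA, localCost_choose A S hx hy]
  have hr : s.mem 12 0 0 = A.r := congrArg Elim.r hA
  have hW : ∀ a b k j, s.mem (tagW a b) k j = (A.choose S m v x y).W a b k j := fun a b k j =>
    congrFun (congrFun (congrFun (congrFun (congrArg Elim.W hA) a) b) k) j
  have hD : ∀ a b i, s.mem (tagD a b) i 0 = (A.choose S m v x y).D a b i := fun a b i =>
    congrFun (congrFun (congrFun (congrArg Elim.D hA) a) b) i
  have hmem : ((chooseBest a b).eval N s).mem =
      setMem (setMem s.mem (tagD a b) A.r 0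
          (if A.localCost m v x y true a b < A.localCost m v x y false a b then 1 else 0))
        (tagW a b) x y (A.W a b x y +
          min (A.localCost m v x y false a b) (A.localCost m v x y true a b)) := by
    simp only [chooseBest, Cmd.eval, Expr.eval, hloc]
    by_cases hlt : A.localCost m v x y true a b < A.localCost m v x y false a b
    · simp only [hlt, if_true, ne_eq, one_ne_zero, not_false_eq_true]
      rw [eval_chooseCmd, hloc, hr, h8, h9, hW, min_eq_right hlt.le]
      simp [choose, hab]
    · simp only [hlt, if_false, ne_eq, not_true_eq_false]
      rw [eval_chooseCmd, hloc, hr, h8, h9, hW, min_eq_left (not_lt.1 hlt)]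
      simp [choose, hab]
  have tWW : ∀ a b a' b', tagW a' b' = tagW a b ↔ a' = a ∧ b' = b := by decide
  have tDD : ∀ a b a' b', tagD a' b' = tagD a b ↔ a' = a ∧ b' = b := by decide
  have tWD : ∀ a b a' b', tagW a' b' ≠ tagD a b := by decide
  have tDW : ∀ a b a' b', tagD a' b' ≠ tagW a b := by decide
  have e30 := congrArg Elim.dead hA
  have e31 := congrArg Elim.V hA
  have e32 := congrArg Elim.X hA
  have e33 := congrArg Elim.Y hA
  ext a' b' k j
  · change ((chooseBest a b).eval N s).mem (tagW a' b') k j = _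
    rw [hmem]
    simp only [setMem, tWW, tWD, false_and, if_false]
    rw [hW]
    by_cases h : a' = a ∧ b' = b
    · obtain ⟨rfl, rfl⟩ := h
      simp only [true_and, choose, hab, if_false, and_self, or_true, if_true, eliminate]
      by_cases hkj : k = x ∧ j = y
      · obtain ⟨rfl, rfl⟩ := hkj
        simp
      · simp [hkj]
    · simp [h, choose]
  · change ((chooseBest a b).eval N s).mem (tagD a' b') _ 0 = _
    rw [hmem]
    simp only [setMem, tDD, tDW, false_and, if_false, and_true]
    rw [hD]
    by_cases h : a' = a ∧ b' = b
    · obtain ⟨rfl, rfl⟩ := h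
      simp only [true_and, choose, hab, if_false, and_self, or_true, if_true, eliminate]
    · simp [h, choose]
  · exact (congrFun (congrFun (hframe' 31 (by simp)) _) _).trans (congrFun e31 _)
  · exact (congrFun (congrFun (hframe' 32 (by simp)) _) _).trans (congrFun e32 _)
  · exact (congrFun (congrFun (hframe' 33 (by simp)) _) _).trans (congrFun e33 _)
  · exact (congrFun (congrFun (hframe' 30 (by simp)) _) _).trans (congrFun e30 _)
  · exact (congrFun (congrFun (hframe' 12 (by simp)) _) _).trans hr

theorem logCmd_spec (N : ℕ) (A : Elim) {m v x y : ℕ} {s : MemState} (hs : Current s.mem m v x y)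
    (hA : ofMem s.mem = A.choose (fun _ _ => True) m v x y) :
    ofMem (logCmd.eval N s).mem = A.eliminate m v x y := by
  obtain ⟨h7, h8, h9, -⟩ := hs
  have hW : ∀ a b k j, s.mem (tagW a b) k j = (A.eliminate m v x y).W a b k j := fun a b k j =>
    congrFun (congrFun (congrFun (congrFun (congrArg Elim.W hA) a) b) k) j
  have hD : ∀ a b i, s.mem (tagD a b) i 0 = (A.eliminate m v x y).D a b i := fun a b i =>
    congrFun (congrFun (congrFun (congrArg Elim.D hA) a) b) i
  have e12 : s.mem 12 0 0 = A.r := congrArg Elim.r hA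
  have e30 : ∀ i, s.mem 30 i 0 = A.dead i := congrFun (congrArg Elim.dead hA)
  have e31 : ∀ i, s.mem 31 i 0 = A.V i := congrFun (congrArg Elim.V hA)
  have e32 : ∀ i, s.mem 32 i 0 = A.X i := congrFun (congrArg Elim.X hA)
  have e33 : ∀ i, s.mem 33 i 0 = A.Y i := congrFun (congrArg Elim.Y hA)
  have htags : ∀ t, t ∉ [31, 32, 33, 30, 12] → (logCmd.eval N s).mem t = s.mem t := fun t ht =>
    Cmd.eval_mem_of_notMem N _ s (by simpa [logCmd, Cmd.writes, Cmd.asg] using ht)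
  have tW : ∀ a b, tagW a b ∉ [31, 32, 33, 30, 12] := by decide
  have tD : ∀ a b, tagD a b ∉ [31, 32, 33, 30, 12] := by decide
  ext a b k j
  · exact (congrFun (congrFun (htags _ (tW a b)) k) j).trans (hW a b k j)
  · exact (congrFun (congrFun (htags _ (tD a b)) _) 0).trans (hD a b _)
  all_goals simp [ofMem, logCmd, Cmd.eval, Cmd.asg, Expr.eval, Expr.var, setMem, e12, e30, e31,
    e32, e33, h7, h8, h9, eliminate]

theorem eliminateCmd_spec (N : ℕ) {m v x y : ℕ} (hxv : x ≠ v) (hyv : y ≠ v) {s : MemState}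
    (hm : s.mem 0 0 0 = m) (hv : s.mem 7 0 0 = v) (hx : s.mem 8 0 0 = x) (hy : s.mem 9 0 0 = y) :
    ofMem (eliminateCmd.eval N s).mem = (ofMem s.mem).eliminate m v x y := by
  have h1 : (Cmd.ite (.eq (.var 8) (.var 9)) (.asg 13 (.var 0)) (.asg 13 (.var 9))).eval N s =
      s.setVar 13 (second m x y) := by
    simp only [Cmd.eval, Expr.eval, Expr.eval_var, hx, hy, Cmd.eval_asg, hm, second]
    by_cases hxy : x = y <;> simp [hxy]
  have hc0 : Current (s.setVar 13 (second m x y)).mem m v x y := by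
    refine ⟨?_, ?_, ?_, ?_⟩ <;> simp [MemState.setVar, setMem, hv, hx, hy]
  have hA0 : ofMem (s.setVar 13 (second m x y)).mem =
      (ofMem s.mem).choose (fun _ _ => False) m v x y := by
    rw [ofMem_setVar (by decide)]
    rfl
  obtain ⟨hc1, hA1⟩ := chooseBest_spec N hxv hyv hc0 hA0 (a := false) (b := false) (by simp)
  obtain ⟨hc2, hA2⟩ := chooseBest_spec N hxv hyv hc1 hA1 (a := false) (b := true) (by simp)
  obtain ⟨hc3, hA3⟩ := chooseBest_spec N hxv hyv hc2 hA2 (a := true) (b := false) (by simp)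
  obtain ⟨hc4, hA4⟩ := chooseBest_spec N hxv hyv hc3 hA3 (a := true) (b := true) (by simp)
  have hfinal := logCmd_spec N (ofMem s.mem) hc4 (by
    rw [hA4]
    ext a b
    · cases a <;> cases b <;> simp [choose]
    · cases a <;> cases b <;> simp [choose]
    all_goals rfl)
  rw [← hfinal, ← h1]
  rfl

end Elim

/-! ### The search for possible eliminations -/

namespace Elim

/-- Set variable `11` to a nonzero value if all neighbours of the current vertex are among `x` and
`y`, and these are neighbours if they differ. -/
def checkCmd : Cmd :=
  .seq (.asg 11 (.const 1))
    (.seq (.forIn 10 (.guard [.lt (.var 10) (.add (.var 0) (.const 1)),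
        .not (.get 30 (.var 10) (.const 0)), .not (.eq (.var 10) (.var 7)),
        .not (.eq (.var 10) (.var 8)), .not (.eq (.var 10) (.var 9)), adjExpr (.var 10)]
        (.asg 11 (.const 0))))
    (.seq (.guard [.not (.eq (.var 8) (.var 9)), .not (adjExpr (.var 8))] (.asg 11 (.const 0)))
      (.guard [.not (.eq (.var 8) (.var 9)), .not (adjExpr (.var 9))] (.asg 11 (.const 0)))))

/-- Eliminate the current vertex if this is possible. -/
def tryCmd : Cmd :=
  .guard [.lt (.var 7) (.var 0), .lt (.var 8) (.add (.var 0) (.const 1)),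
      .lt (.var 9) (.add (.var 0) (.const 1)), .lt (.var 8) (.add (.var 9) (.const 1)),
      .not (.eq (.var 8) (.var 7)), .not (.eq (.var 9) (.var 7)),
      .not (.get 30 (.var 7) (.const 0)), .not (.get 30 (.var 8) (.const 0)),
      .not (.get 30 (.var 9) (.const 0))]
    (.seq checkCmd (.guard [.var 11] eliminateCmd))

/-- Try all eliminations. -/
def sweepCmd : Cmd := .forIn 7 (.forIn 8 (.forIn 9 tryCmd))

theorem _root_.Expr.eval_not (mem : ℕ → ℕ → ℕ → ℕ) (e : Expr) :
    (Expr.not e).eval mem ≠ 0 ↔ e.eval mem = 0 := by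
  by_cases h : e.eval mem = 0 <;> simp [Expr.not, Expr.eval, h]

/-- The live vertices include the dummy `m`, so the scan needs `m + 1` iterations. -/
theorem checkCmd_spec {N m v x y : ℕ} (hN : m + 1 ≤ N) {s : MemState}
    (hm : s.mem 0 0 0 = m) (hv : s.mem 7 0 0 = v) (hx : s.mem 8 0 0 = x) (hy : s.mem 9 0 0 = y) :
    (checkCmd.eval N s).mem 11 0 0 ≠ 0 ↔
      (∀ u ∈ (ofMem s.mem).live m, u ≠ v → u ≠ x → u ≠ y → (ofMem s.mem).adj v u = 0) ∧
      (x ≠ y → (ofMem s.mem).adj v x ≠ 0 ∧ (ofMem s.mem).adj v y ≠ 0) := by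
  set A := ofMem s.mem with hA
  -- `F` gathers what assignments to the scratch variables `10` and `11` leave unchanged.
  let F : MemState → Prop := fun s' =>
    s'.mem 0 0 0 = m ∧ s'.mem 7 0 0 = v ∧ s'.mem 8 0 0 = x ∧ s'.mem 9 0 0 = y ∧ ofMem s'.mem = A
  have hF : ∀ s' t w, t = 10 ∨ t = 11 → F s' → F (s'.setVar t w) := by
    rintro s' t w ht ⟨h0, h7, h8, h9, hA'⟩
    have hs : ∀ t' ∈ [0, 7, 8, 9], (s'.setVar t w).mem t' = s'.mem t' := by
      intro t' ht'
      apply MemState.setVar_mem_of_ne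
      rintro rfl
      rcases ht with rfl | rfl <;> simp at ht'
    refine ⟨by rwa [hs _ (by simp)], by rwa [hs _ (by simp)], by rwa [hs _ (by simp)],
      by rwa [hs _ (by simp)], ?_⟩
    rw [ofMem_setVar, hA']
    rcases ht with rfl | rfl <;> decide
  have hdead : ∀ s', F s' → ∀ u, s'.mem 30 u 0 = A.dead u := fun s' h =>
    congrFun (congrArg Elim.dead h.2.2.2.2)
  set s₁ := s.setVar 11 1 with hs₁
  have hF₁ : F s₁ := hF _ _ _ (Or.inr rfl) ⟨hm, hv, hx, hy, rfl⟩
  have h₁ : s₁.mem 11 0 0 = 1 := MemState.setVar_mem_self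
  set c₁ : Cmd := .guard [.lt (.var 10) (.add (.var 0) (.const 1)),
        .not (.get 30 (.var 10) (.const 0)), .not (.eq (.var 10) (.var 7)),
        .not (.eq (.var 10) (.var 8)), .not (.eq (.var 10) (.var 9)), adjExpr (.var 10)]
        (.asg 11 (.const 0)) with hc₁
  have hloop := Cmd.forIn_induction (N := N) (x := 10) (c := c₁)
    (by simp [hc₁, Cmd.asg, Cmd.writes]) (fun i s' => F s' ∧ (s'.mem 11 0 0 ≠ 0 ↔
      ∀ u ∈ A.live m, u < i → u ≠ v → u ≠ x → u ≠ y → A.adj v u = 0)) (s := s₁)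
    ⟨hF₁, by simp [h₁]⟩
    (fun i s' w h => ⟨hF _ _ _ (Or.inl rfl) h.1, by
      rw [MemState.setVar_mem_of_ne (by decide)]; exact h.2⟩) ?_
  swap
  · rintro i hi s' hs' ⟨hFs, h2⟩
    rw [hc₁, Cmd.eval_guard]
    have hcond : (∀ e ∈ [Expr.lt (.var 10) (.add (.var 0) (.const 1)),
        .not (.get 30 (.var 10) (.const 0)), .not (.eq (.var 10) (.var 7)),
        .not (.eq (.var 10) (.var 8)), .not (.eq (.var 10) (.var 9)), adjExpr (.var 10)],
        e.eval s'.mem ≠ 0) ↔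
        i < m + 1 ∧ A.dead i = 0 ∧ i ≠ v ∧ i ≠ x ∧ i ≠ y ∧ A.adj v i ≠ 0 := by
      obtain ⟨h0, h7, h8, h9, hA'⟩ := id hFs
      simp only [List.forall_mem_cons, Expr.eval_not, eval_adjExpr,
        Expr.eval_var, Expr.eval, hs', h0, h7, h8, h9, hA', hdead s' hFs]
      simp
    simp only [hcond]
    split
    · next h =>
      refine ⟨hF _ _ _ (Or.inr rfl) hFs, ?_⟩
      rw [Cmd.eval_asg, MemState.setVar_mem_self]
      refine iff_of_false (fun h => h rfl) fun h' => h.2.2.2.2.2 ?_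
      exact h' i (A.mem_live.2 ⟨by omega, h.2.1⟩) (by omega) h.2.2.1 h.2.2.2.1 h.2.2.2.2.1
    · next h =>
      refine ⟨hFs, h2.trans ⟨fun h' u hu hui h3 h4 h5 => ?_, fun h' u hu hui => h' u hu (by omega)⟩⟩
      by_cases hui' : u = i
      · subst hui'
        by_contra h6
        rw [mem_live] at hu
        exact h ⟨by omega, hu.2, h3, h4, h5, h6⟩
      · exact h' u hu (by omega) h3 h4 h5
  set s₂ := (Cmd.forIn 10 c₁).eval N s₁ with hs₂
  obtain ⟨hF₂, h₂⟩ := hloop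
  have hguard : ∀ t, t = 8 ∨ t = 9 → ∀ s' w, s'.mem t 0 0 = w → F s' →
      F ((Cmd.guard [.not (.eq (.var 8) (.var 9)), .not (adjExpr (.var t))]
        (.asg 11 (.const 0))).eval N s') ∧
      (((Cmd.guard [.not (.eq (.var 8) (.var 9)), .not (adjExpr (.var t))]
        (.asg 11 (.const 0))).eval N s').mem 11 0 0 ≠ 0 ↔
        s'.mem 11 0 0 ≠ 0 ∧ (x ≠ y → A.adj v w ≠ 0)) := by
    rintro t ht s' w hw hFs
    rw [Cmd.eval_guard]
    obtain ⟨h0, h7, h8, h9, hA'⟩ := id hFs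
    simp only [List.forall_mem_cons, Expr.eval_not, eval_adjExpr, Expr.eval_var, Expr.eval,
      ite_eq_right_iff, one_ne_zero, imp_false, h7, h8, h9, hA', hw, List.not_mem_nil,
      false_imp_iff, implies_true, and_true]
    split
    · next h =>
      refine ⟨hF _ _ _ (Or.inr rfl) hFs, ?_⟩
      rw [Cmd.eval_asg, MemState.setVar_mem_self]
      exact iff_of_false (fun h => h rfl) fun h' => h'.2 h.1 h.2
    · next h =>
      exact ⟨hFs, ⟨fun h' => ⟨h', fun h1 h2 => h ⟨h1, h2⟩⟩, fun h' => h'.1⟩⟩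
  obtain ⟨hF₃, h₃⟩ := hguard 8 (Or.inl rfl) s₂ x hF₂.2.2.1 hF₂
  obtain ⟨hF₄, h₄⟩ := hguard 9 (Or.inr rfl) _ y hF₃.2.2.2.1 hF₃
  refine h₄.trans ?_
  rw [h₃, h₂]
  constructor
  · rintro ⟨⟨h1, h2⟩, h3⟩
    refine ⟨fun u hu => h1 u hu ?_, fun h => ⟨h2 h, h3 h⟩⟩
    rw [mem_live] at hu
    omega
  · rintro ⟨h1, h2⟩
    exact ⟨⟨fun u hu _ => h1 u hu, fun h => (h2 h).1⟩, fun h => (h2 h).2⟩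

theorem checkCmd_writes : checkCmd.writes = [11, 10, 11, 10, 11, 11] := rfl

theorem checkCmd_mem (N : ℕ) (s : MemState) (t : ℕ) (ht : t ∉ [10, 11]) :
    (checkCmd.eval N s).mem t = s.mem t := by
  refine Cmd.eval_mem_of_notMem N checkCmd s ?_
  rw [checkCmd_writes]
  simp only [List.mem_cons, List.not_mem_nil, or_false, not_or] at ht ⊢
  tauto

theorem ofMem_checkCmd (N : ℕ) (s : MemState) : ofMem (checkCmd.eval N s).mem = ofMem s.mem := by
  refine ofMem_congr fun t ht => checkCmd_mem N s t fun h => ?_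
  simp only [List.mem_cons, List.not_mem_nil, or_false] at h
  rcases h with rfl | rfl <;> revert ht <;> decide

open scoped Classical in
theorem tryCmd_spec {N m v x y : ℕ} (hN : m + 1 ≤ N) {s : MemState}
    (hm : s.mem 0 0 0 = m) (hv : s.mem 7 0 0 = v) (hx : s.mem 8 0 0 = x) (hy : s.mem 9 0 0 = y) :
    ofMem (tryCmd.eval N s).mem = if (ofMem s.mem).Elig m v x y then
      (ofMem s.mem).eliminate m v x y else ofMem s.mem := by
  have hdead : ∀ u, s.mem 30 u 0 = (ofMem s.mem).dead u := fun u => rfl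
  rw [tryCmd, Cmd.eval_guard]
  simp only [List.forall_mem_cons, Expr.eval_not, Expr.eval_var, Expr.eval,
    ne_eq, ite_eq_right_iff, one_ne_zero, imp_false, not_not, hm, hv, hx, hy, List.not_mem_nil,
    false_imp_iff, implies_true, and_true, hdead]
  by_cases hc : v < m ∧ x < m + 1 ∧ y < m + 1 ∧ x < y + 1 ∧ x ≠ v ∧ y ≠ v ∧
      (ofMem s.mem).dead v = 0 ∧ (ofMem s.mem).dead x = 0 ∧ (ofMem s.mem).dead y = 0
  · rw [if_pos hc]
    obtain ⟨h1, h2, h3, h4, h5, h6, h7, h8, h9⟩ := hc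
    have hcheck := checkCmd_spec hN hm hv hx hy
    have hof := ofMem_checkCmd N s
    change ofMem ((Cmd.guard [.var 11] eliminateCmd).eval N (checkCmd.eval N s)).mem = _
    rw [Cmd.eval_guard]
    simp only [List.forall_mem_cons, Expr.eval_var, List.not_mem_nil, false_imp_iff, implies_true,
      and_true]
    have helig : (checkCmd.eval N s).mem 11 0 0 ≠ 0 ↔ (ofMem s.mem).Elig m v x y := by
      rw [hcheck]
      exact ⟨fun h => ⟨h1, mem_live _ |>.2 ⟨h1.le, h7⟩, mem_live _ |>.2 ⟨by omega, h8⟩,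
        mem_live _ |>.2 ⟨by omega, h9⟩, by omega, h5, h6, h.1, h.2⟩, fun h => ⟨h.adj_eq, h.adj_ne⟩⟩
    simp only [helig]
    split
    · rw [eliminateCmd_spec N h5 h6 (m := m) (v := v) (x := x) (y := y), hof]
      · rw [checkCmd_mem N s 0 (by simp), hm]
      · rw [checkCmd_mem N s 7 (by simp), hv]
      · rw [checkCmd_mem N s 8 (by simp), hx]
      · rw [checkCmd_mem N s 9 (by simp), hy]
    · exact hof
  · rw [if_neg hc, if_neg]
    rintro ⟨h1, h2, h3, h4, h5, h6, h7, -, -⟩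
    rw [mem_live] at h2 h3 h4
    exact hc ⟨h1, by omega, by omega, by omega, h6, h7, h2.2, h3.2, h4.2⟩

/-- Some vertex was eliminated since the state `A₀`, or no elimination in `T` is possible. -/
def Swept (m : ℕ) (cost : (ℕ → Bool) → ℕ) (A₀ : Elim) (T : ℕ → ℕ → ℕ → Prop) (s : MemState) : Prop :=
  s.mem 0 0 0 = m ∧ (ofMem s.mem).Inv m cost ∧ (A₀.r < (ofMem s.mem).r ∨
    ofMem s.mem = A₀ ∧ ∀ v x y, T v x y → ¬ A₀.Elig m v x y)

theorem Swept.mono {m : ℕ} {cost : (ℕ → Bool) → ℕ} {A₀ : Elim} {T T' : ℕ → ℕ → ℕ → Prop}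
    {s : MemState} (h : Swept m cost A₀ T s) (hT : ∀ v x y, T' v x y → T v x y) :
    Swept m cost A₀ T' s :=
  ⟨h.1, h.2.1, h.2.2.imp id fun h => ⟨h.1, fun v x y h' => h.2 v x y (hT v x y h')⟩⟩

theorem Swept.setVar {m : ℕ} {cost : (ℕ → Bool) → ℕ} {A₀ : Elim} {T : ℕ → ℕ → ℕ → Prop}
    {s : MemState} (h : Swept m cost A₀ T s) {t w : ℕ} (ht : t ∉ elimTags) (ht' : t ≠ 0) :
    Swept m cost A₀ T (s.setVar t w) := by
  unfold Swept
  rw [ofMem_setVar ht, MemState.setVar_mem_of_ne ht'.symm]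
  exact h

theorem tryCmd_writes_notMem : ∀ t ∈ [0, 7, 8, 9], t ∉ tryCmd.writes := by decide

/-- As long as nothing was eliminated the state is still `A₀`, so a failed test refutes the triple
for `A₀` itself. After an elimination nothing more has to be recorded. -/
theorem tryCmd_swept {N m : ℕ} (hN : m + 1 ≤ N) {cost : (ℕ → Bool) → ℕ} {A₀ : Elim}
    {T : ℕ → ℕ → ℕ → Prop} {s : MemState} (h : Swept m cost A₀ T s) {v x y : ℕ}
    (hv : s.mem 7 0 0 = v) (hx : s.mem 8 0 0 = x) (hy : s.mem 9 0 0 = y) :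
    Swept m cost A₀ (fun v' x' y' => T v' x' y' ∨ v' = v ∧ x' = x ∧ y' = y) (tryCmd.eval N s) := by
  classical
  obtain ⟨h0, hinv, h1⟩ := h
  refine ⟨by rw [Cmd.eval_mem_of_notMem N _ s (tryCmd_writes_notMem 0 (by simp)), h0], ?_⟩
  rw [tryCmd_spec hN h0 hv hx hy]
  split
  · next he =>
    refine ⟨hinv.eliminate he, Or.inl ?_⟩
    have : ((ofMem s.mem).eliminate m v x y).r = (ofMem s.mem).r + 1 := rfl
    rcases h1 with h1 | h1
    · omega
    · rw [this, h1.1]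
      omega
  · next he =>
    refine ⟨hinv, h1.imp id fun h2 => ⟨h2.1, ?_⟩⟩
    rintro v' x' y' (h3 | ⟨rfl, rfl, rfl⟩)
    · exact h2.2 _ _ _ h3
    · rwa [← h2.1]

theorem sweepCmd_swept {N m : ℕ} (hN : m + 1 ≤ N) {cost : (ℕ → Bool) → ℕ} {s : MemState}
    (h0 : s.mem 0 0 0 = m) (h : (ofMem s.mem).Inv m cost) :
    Swept m cost (ofMem s.mem) (fun v x y => v < N ∧ x < N ∧ y < N) (sweepCmd.eval N s) := by
  set A₀ := ofMem s.mem with hA₀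
  have inner : ∀ (T : ℕ → ℕ → ℕ → Prop) (s : MemState) (v x : ℕ), s.mem 7 0 0 = v →
      s.mem 8 0 0 = x → Swept m cost A₀ T s →
      Swept m cost A₀ (fun v' x' y' => T v' x' y' ∨ v' = v ∧ x' = x ∧ y' < N)
        ((Cmd.forIn 9 tryCmd).eval N s) := by
    intro T s v x hv hx hs
    refine (Cmd.forIn_induction (N := N) (tryCmd_writes_notMem 9 (by simp)) (fun i s =>
      s.mem 7 0 0 = v ∧ s.mem 8 0 0 = x ∧
      Swept m cost A₀ (fun v' x' y' => T v' x' y' ∨ v' = v ∧ x' = x ∧ y' < i) s)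
      ⟨hv, hx, hs.mono (by simp)⟩ ?_ ?_).2.2
    · rintro i s w ⟨h1, h2, h3⟩
      refine ⟨?_, ?_, h3.setVar (by decide) (by decide)⟩
      · rwa [MemState.setVar_mem_of_ne (by decide)]
      · rwa [MemState.setVar_mem_of_ne (by decide)]
    · rintro i hi s h9 ⟨h1, h2, h3⟩
      refine ⟨?_, ?_, (tryCmd_swept hN h3 h1 h2 h9).mono ?_⟩
      · rwa [Cmd.eval_mem_of_notMem N _ s (tryCmd_writes_notMem 7 (by simp))]
      · rwa [Cmd.eval_mem_of_notMem N _ s (tryCmd_writes_notMem 8 (by simp))]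
      · rintro v' x' y' (h | ⟨rfl, rfl, h⟩)
        · exact Or.inl (Or.inl h)
        · rcases Nat.lt_succ_iff_lt_or_eq.1 h with h | h
          · exact Or.inl (Or.inr ⟨rfl, rfl, h⟩)
          · exact Or.inr ⟨rfl, rfl, h⟩
  have w9 : ∀ t, t = 7 ∨ t = 8 → t ∉ (Cmd.forIn 9 tryCmd).writes := by
    intro t ht
    rw [Cmd.mem_writes_forIn]
    rcases ht with rfl | rfl
    · exact not_or.2 ⟨by decide, tryCmd_writes_notMem 7 (by simp)⟩
    · exact not_or.2 ⟨by decide, tryCmd_writes_notMem 8 (by simp)⟩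
  have middle : ∀ (T : ℕ → ℕ → ℕ → Prop) (s : MemState) (v : ℕ), s.mem 7 0 0 = v →
      Swept m cost A₀ T s →
      Swept m cost A₀ (fun v' x' y' => T v' x' y' ∨ v' = v ∧ x' < N ∧ y' < N)
        ((Cmd.forIn 8 (Cmd.forIn 9 tryCmd)).eval N s) := by
    intro T s v hv hs
    refine (Cmd.forIn_induction (N := N) (w9 8 (Or.inr rfl)) (fun i s => s.mem 7 0 0 = v ∧
      Swept m cost A₀ (fun v' x' y' => T v' x' y' ∨ v' = v ∧ x' < i ∧ y' < N) s)
      ⟨hv, hs.mono (by simp)⟩ ?_ ?_).2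
    · rintro i s w ⟨h1, h3⟩
      refine ⟨?_, h3.setVar (by decide) (by decide)⟩
      rwa [MemState.setVar_mem_of_ne (by decide)]
    · rintro i hi s h8 ⟨h1, h3⟩
      refine ⟨?_, (inner _ s v i h1 h8 h3).mono ?_⟩
      · rwa [Cmd.eval_mem_of_notMem N _ s (w9 7 (Or.inl rfl))]
      · rintro v' x' y' (h | ⟨rfl, h, h'⟩)
        · exact Or.inl (Or.inl h)
        · rcases Nat.lt_succ_iff_lt_or_eq.1 h with h | h
          · exact Or.inl (Or.inr ⟨rfl, h, h'⟩)
          · exact Or.inr ⟨rfl, h, h'⟩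
  have w7 : 7 ∉ (Cmd.forIn 8 (Cmd.forIn 9 tryCmd)).writes := by
    rw [Cmd.mem_writes_forIn]
    exact not_or.2 ⟨by decide, w9 7 (Or.inl rfl)⟩
  refine Cmd.forIn_induction (N := N) w7 (fun i s =>
    Swept m cost A₀ (fun v x y => v < i ∧ x < N ∧ y < N) s) ⟨h0, h, Or.inr ⟨rfl, by simp⟩⟩ ?_ ?_
  · exact fun i s w h => h.setVar (by decide) (by decide)
  · intro i hi s h7 hs
    refine (middle _ s i h7 hs).mono ?_
    rintro v' x' y' ⟨h, h'⟩
    rcases Nat.lt_succ_iff_lt_or_eq.1 h with h | h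
    · exact Or.inl ⟨h, h'⟩
    · exact Or.inr ⟨h, h'⟩

/-- While an issue is live, `exists_elig` supplies an eligible triple with entries below `N`, so a
sweep cannot end without an elimination. Hence `m` sweeps suffice. -/
theorem loop_sweepCmd_spec {N m : ℕ} (hN : m + 1 ≤ N) {cost : (ℕ → Bool) → ℕ} {s : MemState}
    (h0 : s.mem 0 0 0 = m) (h : (ofMem s.mem).Inv m cost) :
    ((Cmd.loop sweepCmd).eval N s).mem 0 0 0 = m ∧
      (ofMem ((Cmd.loop sweepCmd).eval N s).mem).Inv m cost ∧
      (ofMem ((Cmd.loop sweepCmd).eval N s).mem).r = m := by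
  have key := Cmd.loop_induction (N := N) (c := sweepCmd) (fun i s => s.mem 0 0 0 = m ∧
    (ofMem s.mem).Inv m cost ∧ min i m ≤ (ofMem s.mem).r) ⟨h0, h, by simp⟩ ?_
  · refine ⟨key.1, key.2.1, le_antisymm key.2.1.r_le ?_⟩
    have := key.2.2
    rwa [min_eq_right (by omega)] at this
  · rintro i hi s ⟨h1, h2, h3⟩
    obtain ⟨h4, h5, h6⟩ := sweepCmd_swept hN h1 h2
    refine ⟨h4, h5, ?_⟩
    rcases h6 with h6 | ⟨h6, h7⟩
    · omega
    · rw [h6]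
      have : m ≤ (ofMem s.mem).r := by
        by_contra hlt
        obtain ⟨w, hw, hw'⟩ := h2.exists_live (not_le.1 hlt)
        obtain ⟨v, x, y, he⟩ := h2.exists_elig hw hw'
        have hx := (mem_live _ |>.1 he.mem_x).1
        have hy := (mem_live _ |>.1 he.mem_y).1
        have hv := he.lt
        exact h7 v x y ⟨by omega, by omega, by omega⟩ he
      omega

/-! ### Reading off an optimal assignment -/

/-- Give the vertex of the `i`-th elimination its best value, where `i` is variable `17`. -/
def assignCmd : Cmd :=
  .ite (.get 40 (.get 32 (.var 17) (.const 0)) (.const 0))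
    (.ite (.get 40 (.get 33 (.var 17) (.const 0)) (.const 0))
      (.set 40 (.get 31 (.var 17) (.const 0)) (.const 0) (.get (tagD true true) (.var 17) (.const 0)))
      (.set 40 (.get 31 (.var 17) (.const 0)) (.const 0)
        (.get (tagD true false) (.var 17) (.const 0))))
    (.ite (.get 40 (.get 33 (.var 17) (.const 0)) (.const 0))
      (.set 40 (.get 31 (.var 17) (.const 0)) (.const 0)
        (.get (tagD false true) (.var 17) (.const 0)))
      (.set 40 (.get 31 (.var 17) (.const 0)) (.const 0)
        (.get (tagD false false) (.var 17) (.const 0))))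

/-- The assignment held by table `40`. -/
def assignment (s : MemState) (v : ℕ) : Bool := decide (s.mem 40 v 0 ≠ 0)

theorem assignCmd_spec (N : ℕ) {s : MemState} {A : Elim} (hA : ofMem s.mem = A) {i : ℕ}
    (hi : s.mem 17 0 0 = i) (v : ℕ) : assignment (assignCmd.eval N s) v = if v = A.V i then
      decide (A.D (assignment s (A.X i)) (assignment s (A.Y i)) i ≠ 0) else assignment s v := by
  subst hA
  by_cases hx : s.mem 40 (s.mem 32 i 0) 0 = 0 <;> by_cases hy : s.mem 40 (s.mem 33 i 0) 0 = 0 <;>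
  by_cases hv : v = s.mem 31 i 0 <;>
  simp [assignment, assignCmd, Cmd.eval, Expr.eval, hi, hx, hy, hv, ofMem, setMem]

/-- Give all eliminated vertices their best values, the last one first. -/
def backtrackCmd : Cmd := .forDown 16 17 (.var 12) assignCmd

/-- The vertices `X i` and `Y i` are eliminated later than `V i` or never, so their values are final
when the log is read backwards: by `parents` and `inj`, assigning `V k` disturbs no equation with
index above `k`. The dummy vertex keeps the value zero because `V k < m`. -/
theorem backtrackCmd_spec {N m : ℕ} {cost : (ℕ → Bool) → ℕ} {s : MemState}
    (h : (ofMem s.mem).Inv m cost) (hN : (ofMem s.mem).r ≤ N) (hs : s.mem 40 m 0 = 0) :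
    (ofMem s.mem).Obeys (assignment (backtrackCmd.eval N s)) ∧
      (backtrackCmd.eval N s).mem 40 m 0 = 0 := by
  set A := ofMem s.mem with hA
  have key := Cmd.forDown_induction (N := N) (t := 16) (i := 17) (e := .var 12) (c := assignCmd)
    (n := A.r) (by decide) (by decide) (by decide) hN (fun k s => ofMem s.mem = A ∧
      s.mem 40 m 0 = 0 ∧ ∀ i < A.r, k ≤ i → assignment s (A.V i) =
        decide (A.D (assignment s (A.X i)) (assignment s (A.Y i)) i ≠ 0)) (s := s)
    ⟨rfl, hs, fun i h1 h2 => by omega⟩ (fun k s h => congrArg Elim.r h.1) ?_ ?_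
  · exact ⟨fun i hi => key.2.2 i hi (Nat.zero_le _), key.2.1⟩
  · rintro k s w ⟨h1, h2, h3⟩
    have aux : ∀ t, t = 16 ∨ t = 17 → ofMem (s.setVar t w).mem = A ∧
      (s.setVar t w).mem 40 m 0 = 0 ∧ ∀ i < A.r, k ≤ i → assignment (s.setVar t w) (A.V i) =
        decide (A.D (assignment (s.setVar t w) (A.X i)) (assignment (s.setVar t w) (A.Y i)) i ≠ 0) := by
      intro t ht
      have h40 : (s.setVar t w).mem 40 = s.mem 40 :=
        MemState.setVar_mem_of_ne (by rcases ht with rfl | rfl <;> decide)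
      simp only [assignment, h40]
      refine ⟨?_, h2, h3⟩
      rw [ofMem_setVar, h1]
      rcases ht with rfl | rfl <;> decide
    exact ⟨aux 16 (Or.inl rfl), aux 17 (Or.inr rfl)⟩
  · rintro k hk s h17 ⟨h1, h2, h3⟩
    refine ⟨by rw [ofMem_eval (by decide), h1], ?_, ?_⟩
    · have h4 := assignCmd_spec N h1 h17 m
      rw [if_neg (h.lt k hk).ne'] at h4
      simpa [assignment, h2] using h4
    · intro i hi hki
      rw [assignCmd_spec N h1 h17, assignCmd_spec N h1 h17, assignCmd_spec N h1 h17,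
        if_neg (h.parents i hi k hki).1.symm, if_neg (h.parents i hi k hki).2.symm]
      by_cases hik : i = k
      · rw [hik, if_pos rfl]
      · rw [if_neg (h.inj i hi k (by omega)).symm]
        exact h3 i hi (by omega)

/-- Write the assignment of the issues. -/
def writeCmd : Cmd := .forDown 16 17 (.var 0) (.out (.get 40 (.var 17) (.const 0)))

/-- Output grows at its front, so the issues are written in descending order. -/
theorem writeCmd_spec {N m : ℕ} (hN : m ≤ N) {s : MemState} (hm : s.mem 0 0 0 = m)
    (hs : s.out = []) : (writeCmd.eval N s).out = List.ofFn fun i : Fin m => assignment s i := by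
  have key := Cmd.forDown_induction (N := N) (t := 16) (i := 17) (e := .var 0)
    (c := .out (.get 40 (.var 17) (.const 0))) (n := m) (by decide) (by decide) (by decide) hN
    (fun k s' => s'.mem 0 0 0 = m ∧ s'.mem 40 = s.mem 40 ∧
      s'.out = ((List.range m).map (assignment s)).drop k) (s := s)
    ⟨hm, rfl, by rw [hs, List.drop_eq_nil_of_le (by simp)]⟩ (fun k s h => h.1) ?_ ?_
  · have h := key.2.2
    rw [List.drop_zero] at h
    refine h.trans (List.ext_getElem (by simp) fun i h1 h2 => by simp)
  · rintro k s' w ⟨h1, h2, h3⟩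
    have aux : ∀ t, t = 16 ∨ t = 17 → (s'.setVar t w).mem 0 0 0 = m ∧
        (s'.setVar t w).mem 40 = s.mem 40 ∧
        (s'.setVar t w).out = ((List.range m).map (assignment s)).drop k := by
      intro t ht
      refine ⟨?_, ?_, h3⟩
      · rwa [MemState.setVar_mem_of_ne (by rcases ht with rfl | rfl <;> decide)]
      · rwa [MemState.setVar_mem_of_ne (by rcases ht with rfl | rfl <;> decide)]
    exact ⟨aux 16 (Or.inl rfl), aux 17 (Or.inr rfl)⟩
  · rintro k hk s' h17 ⟨h1, h2, h3⟩
    refine ⟨h1, h2, ?_⟩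
    rw [List.drop_eq_getElem_cons (by simpa using hk)]
    simp [Cmd.eval, Expr.eval, h17, h2, h3, assignment]

end Elim

/-! ### Reading the profile -/

namespace Cmd

theorem eval_inp_of_nil (N : ℕ) (c : Cmd) : ∀ s : MemState, s.inp = [] → (c.eval N s).inp = [] := by
  induction c with
  | skip => exact fun s h => h
  | seq c d ihc ihd => exact fun s h => ihd _ (ihc _ h)
  | set => exact fun s h => h
  | ite e c d ihc ihd =>
    intro s h
    simp only [eval]
    split
    · exact ihc s h
    · exact ihd s h
  | loop c ih =>
    intro s h
    simp only [eval]
    suffices h' : ∀ k, ((c.eval N)^[k] s).inp = [] from h' N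
    intro k
    induction k with
    | zero => exact h
    | succ k ihk => rw [Function.iterate_succ_apply']; exact ih _ ihk
  | read => intro s h; simp [eval, h]
  | out => exact fun s h => h

/-- Read the number of issues into variable `0`. -/
def readIssues : Cmd :=
  loop (ite (.var 6) skip (seq (read 3)
    (ite (.eq (.var 3) (.const 3)) (asg 0 (.add (.var 0) (.const 1))) (asg 6 (.const 1)))))

/-- One iteration per unary digit and one for the separator, after which variable `6` makes all
further iterations idle. -/
theorem readIssues_spec {N m : ℕ} (hN : m + 1 ≤ N) {rest : List (Option Bool)} {s : MemState}
    (h0 : s.mem 0 0 0 = 0) (h6 : s.mem 6 0 0 = 0)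
    (hs : s.inp = List.replicate m (some true) ++ [none] ++ rest) :
    (readIssues.eval N s).mem 0 0 0 = m ∧ (readIssues.eval N s).inp = rest := by
  have key := loop_induction (N := N) (c := ite (.var 6) skip (seq (read 3)
    (ite (.eq (.var 3) (.const 3)) (asg 0 (.add (.var 0) (.const 1))) (asg 6 (.const 1)))))
    (fun i s => s.mem 0 0 0 = min i m ∧ if i ≤ m then s.mem 6 0 0 = 0 ∧
      s.inp = List.replicate (m - i) (some true) ++ [none] ++ rest
      else s.mem 6 0 0 = 1 ∧ s.inp = rest) (s := s) ⟨by simp [h0], by simp [h6, hs]⟩ ?_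
  · have h := key.2
    rw [if_neg (by omega)] at h
    exact ⟨by rw [readIssues, key.1]; omega, h.2⟩
  · rintro i hi s ⟨h1, h2⟩
    rcases lt_trichotomy i m with hlt | rfl | hlt
    · rw [if_pos hlt.le] at h2
      obtain ⟨h2, h3⟩ := h2
      rw [show m - i = m - (i + 1) + 1 by omega, List.replicate_succ] at h3
      simp only [eval, Expr.eval_var, h2, ne_eq, not_true_eq_false, if_false, h3]
      simp [Expr.eval, setMem, inputCode, MemState.setVar, h1, h2, Nat.succ_le_of_lt hlt, hlt.le]
    · rw [if_pos le_rfl] at h2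
      obtain ⟨h2, h3⟩ := h2
      simp only [eval, Expr.eval_var, h2, ne_eq, not_true_eq_false, if_false, h3]
      simp [Expr.eval, setMem, inputCode, MemState.setVar, h1]
    · rw [if_neg (by omega)] at h2
      rw [eval, if_pos (by simp [h2.1]), if_neg (by omega)]
      exact ⟨by rw [eval, h1]; omega, h2⟩

/-- Read the row of predecessors of the issue in variable `2`: set variable `5` to a nonzero value
if there is one, and variable `4` to the predecessor. -/
def readPreds : Cmd :=
  forIn 1 (guard [.lt (.var 1) (.var 0)] (seq (read 3)
    (guard [.eq (.var 3) (.const 3)] (seq (asg 4 (.var 1)) (asg 5 (.const 1))))))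

/-- Variable `4` enters with a default that survives if no bit is set. Uniqueness of the set bit is
not assumed; it is the bound on the in-degree that later identifies the predecessor found. -/
theorem readPreds_spec {N m j : ℕ} (hN : m ≤ N) (f : Fin m → Bool) {rest : List (Option Bool)}
    {s : MemState} (h0 : s.mem 0 0 0 = m) (h4 : s.mem 4 0 0 = j) (h5 : s.mem 5 0 0 = 0)
    (hs : s.inp = (List.ofFn fun k => some (f k)) ++ rest) :
    (readPreds.eval N s).inp = rest ∧
      (((readPreds.eval N s).mem 5 0 0 = 0 ∧ (readPreds.eval N s).mem 4 0 0 = j ∧ ∀ k, f k = false) ∨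
      ((readPreds.eval N s).mem 5 0 0 ≠ 0 ∧ ∃ k, f k = true ∧ (readPreds.eval N s).mem 4 0 0 = k)) := by
  have key := forIn_induction (N := N) (x := 1) (c := guard [.lt (.var 1) (.var 0)] (seq (read 3)
    (guard [.eq (.var 3) (.const 3)] (seq (asg 4 (.var 1)) (asg 5 (.const 1)))))) (by decide)
    (fun i s => s.mem 0 0 0 = m ∧ s.inp = (List.ofFn fun k => some (f k)).drop i ++ rest ∧
      ((s.mem 5 0 0 = 0 ∧ s.mem 4 0 0 = j ∧ ∀ k : Fin m, k < i → f k = false) ∨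
      (s.mem 5 0 0 ≠ 0 ∧ ∃ k, f k = true ∧ s.mem 4 0 0 = k))) (s := s)
    ⟨h0, by simp [hs], Or.inl ⟨h5, h4, by simp⟩⟩ ?_ ?_
  · obtain ⟨-, h1, h2⟩ := key
    rw [List.drop_eq_nil_of_le (by simpa using hN)] at h1
    refine ⟨h1, h2.imp ?_ id⟩
    exact fun h => ⟨h.1, h.2.1, fun k => h.2.2 k (k.2.trans_le hN)⟩
  · intro i s v h
    simpa [MemState.setVar, setMem] using h
  · rintro i hi s h1 ⟨h0, h2, h3⟩
    rw [eval_guard]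
    by_cases him : i < m
    · rw [if_pos (by simp [Expr.eval, h1, h0, him])]
      rw [List.drop_eq_getElem_cons (by simpa using him)] at h2
      simp only [List.getElem_ofFn, List.cons_append] at h2
      simp only [eval, eval_guard, h2, List.head?_cons, List.tail_cons]
      cases hf : f ⟨i, him⟩
      · rw [if_neg (by simp [Expr.eval, setMem, inputCode])]
        refine ⟨by simp [setMem, h0], rfl, ?_⟩
        refine h3.imp (fun h => ⟨by simpa [setMem] using h.1, by simpa [setMem] using h.2.1,
          fun k hk => ?_⟩) (fun h => by simpa [setMem] using h)
        rcases Nat.lt_succ_iff_lt_or_eq.1 hk with hk | hk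
        · exact h.2.2 k hk
        · rw [← hf]
          congr 1
          exact Fin.ext hk
      · rw [if_pos (by simp [Expr.eval, setMem, inputCode])]
        simp only [eval_asg]
        exact ⟨by simp [MemState.setVar, setMem, h0], rfl,
          Or.inr ⟨by simp [MemState.setVar, setMem, Expr.eval],
            ⟨i, him⟩, hf, by simp [MemState.setVar, setMem, h1]⟩⟩
    · rw [if_neg (by simp [Expr.eval, h1, h0, him])]
      refine ⟨h0, ?_, h3.imp (fun h => ⟨h.1, h.2.1, fun k _ => h.2.2 k (by omega)⟩) id⟩
      rw [h2, List.drop_eq_nil_of_le (by simpa using him),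
        List.drop_eq_nil_of_le (by simp; omega)]

/-- Read an entry of a truth table, and count it as a cost if it is `false`. -/
def readEntry (a b : Bool) : Cmd :=
  seq (read 3) (guard [.eq (.var 3) (.const 2)] (set (tagW a b) (.var 4) (.var 2)
    (.add (.get (tagW a b) (.var 4) (.var 2)) (.const 1))))

/-- The memory holds the current issue `j` with its predecessor `p`, and the costs `W` have been
increased by the entries of the table `bad` for the pairs of values in `S`. -/
def EntriesRead (m j p : ℕ) (W : Bool → Bool → ℕ → ℕ → ℕ) (bad : Bool → Bool → Bool)
    (S : Bool → Bool → Prop) (s : MemState) : Prop :=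
  s.mem 0 0 0 = m ∧ s.mem 2 0 0 = j ∧ s.mem 4 0 0 = p ∧ ∀ a b k l,
    (¬ (S a b ∧ k = p ∧ l = j ∧ bad a b = true) → s.mem (tagW a b) k l = W a b k l) ∧
    (S a b ∧ k = p ∧ l = j ∧ bad a b = true → s.mem (tagW a b) k l = W a b k l + 1)

theorem readEntry_spec (N : ℕ) {m j p : ℕ} {W : Bool → Bool → ℕ → ℕ → ℕ} {bad : Bool → Bool → Bool}
    {S : Bool → Bool → Prop} {s : MemState} {rest : List (Option Bool)}
    (h : EntriesRead m j p W bad S s) {a b : Bool} (hab : ¬ S a b)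
    (hs : s.inp = some (!bad a b) :: rest) :
    EntriesRead m j p W bad (fun a' b' => S a' b' ∨ a' = a ∧ b' = b) ((readEntry a b).eval N s) ∧
      ((readEntry a b).eval N s).inp = rest ∧
      ((readEntry a b).eval N s).mem 5 = s.mem 5 := by
  obtain ⟨h0, h2, h4, hW⟩ := h
  have tne : ∀ a b, tagW a b ≠ 3 ∧ 0 ≠ tagW a b ∧ 2 ≠ tagW a b ∧ 4 ≠ tagW a b ∧ 5 ≠ tagW a b := by
    decide
  have tWW : ∀ a b a' b', tagW a' b' = tagW a b ↔ a' = a ∧ b' = b := by decide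
  have hw : ∀ t, t ≠ 3 → t ≠ tagW a b → ((readEntry a b).eval N s).mem t = s.mem t := fun t h3 ht =>
    eval_mem_of_notMem N _ s (by simp [readEntry, writes, h3, ht])
  have hmem : ∀ a' b' k l, ((readEntry a b).eval N s).mem (tagW a' b') k l =
      s.mem (tagW a' b') k l + if (a' = a ∧ b' = b) ∧ k = p ∧ l = j ∧ bad a b = true then 1 else 0 := by
    intro a' b' k l
    simp only [readEntry, eval, eval_guard, hs]
    cases hbad : bad a b
    · simp [Expr.eval, inputCode, setMem, tne]
    · rw [if_pos (by simp [Expr.eval, setMem, inputCode])]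
      by_cases hk : (a' = a ∧ b' = b) ∧ k = p ∧ l = j
      · obtain ⟨⟨rfl, rfl⟩, rfl, rfl⟩ := hk
        simp [setMem, Expr.eval, h2, h4, (tne a' b').1]
      · simp [setMem, h2, h4, tne, tWW, hk]
  refine ⟨⟨?_, ?_, ?_, ?_⟩, ?_, hw 5 (by decide) (tne a b).2.2.2.2⟩
  · rw [hw 0 (by decide) (tne a b).2.1, h0]
  · rw [hw 2 (by decide) (tne a b).2.2.1, h2]
  · rw [hw 4 (by decide) (tne a b).2.2.2.1, h4]
  · intro a' b' k l
    rw [hmem]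
    by_cases hc : (a' = a ∧ b' = b) ∧ k = p ∧ l = j ∧ bad a b = true
    · rw [if_pos hc]
      obtain ⟨⟨rfl, rfl⟩, hc⟩ := hc
      rw [(hW a' b' k l).1 fun h => hab h.1]
      exact ⟨fun h => absurd ⟨Or.inr ⟨rfl, rfl⟩, hc⟩ h, fun _ => rfl⟩
    · rw [if_neg hc, add_zero]
      have : (S a' b' ∨ a' = a ∧ b' = b) ∧ k = p ∧ l = j ∧ bad a' b' = true ↔
          S a' b' ∧ k = p ∧ l = j ∧ bad a' b' = true := by
        constructor
        · rintro ⟨h | ⟨rfl, rfl⟩, h'⟩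
          · exact ⟨h, h'⟩
          · exact absurd ⟨⟨rfl, rfl⟩, h'⟩ hc
        · exact fun h => ⟨Or.inl h.1, h.2⟩
      rw [this]
      exact hW a' b' k l
  · simp only [readEntry, eval, eval_guard, hs]
    split <;> rfl

theorem readEntry_nil (N : ℕ) {a b : Bool} {s : MemState} (hs : s.inp = []) (a' b' : Bool) :
    ((readEntry a b).eval N s).mem (tagW a' b') = s.mem (tagW a' b') := by
  have tne : ∀ a b, tagW a b ≠ 3 := by decide
  simp only [readEntry, eval, eval_guard, hs]
  funext k l
  simp [Expr.eval, inputCode, setMem, tne]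

/-- Read the truth table of an issue. -/
def readTable : Cmd :=
  ite (.var 5) (seq (readEntry false false) (seq (readEntry false true)
    (seq (readEntry true false) (readEntry true true))))
    (seq (readEntry false false) (readEntry true true))

/-- An issue without predecessor acts as its own one, so its two entries belong to the pairs of
equal values, and the mixed pairs carry no cost. -/
theorem readTable_spec (N : ℕ) {m j p : ℕ} {W : Bool → Bool → ℕ → ℕ → ℕ} {bad : Bool → Bool → Bool}
    {s : MemState} {rest : List (Option Bool)} (h : EntriesRead m j p W bad (fun _ _ => False) s)
    (hs : s.mem 5 0 0 ≠ 0 ∧ s.inp = [some (!bad false false), some (!bad false true),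
        some (!bad true false), some (!bad true true)] ++ rest ∨
      s.mem 5 0 0 = 0 ∧ bad false true = false ∧ bad true false = false ∧
        s.inp = [some (!bad false false), some (!bad true true)] ++ rest) :
    EntriesRead m j p W bad (fun _ _ => True) (readTable.eval N s) ∧
      (readTable.eval N s).inp = rest := by
  rcases hs with ⟨h5, hs⟩ | ⟨h5, hb1, hb2, hs⟩
  · obtain ⟨h1, i1, -⟩ := readEntry_spec N h (a := false) (b := false) (by simp) hs
    obtain ⟨h2, i2, -⟩ := readEntry_spec N h1 (a := false) (b := true) (by simp) i1
    obtain ⟨h3, i3, -⟩ := readEntry_spec N h2 (a := true) (b := false) (by simp) i2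
    obtain ⟨h4, i4, -⟩ := readEntry_spec N h3 (a := true) (b := true) (by simp) i3
    rw [readTable, eval, if_pos (by exact h5)]
    refine ⟨⟨h4.1, h4.2.1, h4.2.2.1, fun a b k l => ?_⟩, i4⟩
    have := h4.2.2.2 a b k l
    cases a <;> cases b <;> simpa [eval] using this
  · obtain ⟨h1, i1, -⟩ := readEntry_spec N h (a := false) (b := false) (by simp) hs
    obtain ⟨h2, i2, -⟩ := readEntry_spec N h1 (a := true) (b := true) (by simp) i1
    rw [readTable, eval, if_neg (by exact not_not.2 h5)]
    refine ⟨⟨h2.1, h2.2.1, h2.2.2.1, fun a b k l => ?_⟩, i2⟩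
    have := h2.2.2.2 a b k l
    cases a <;> cases b <;> simpa [eval, hb1, hb2] using this

/-- Read the row of the issue in variable `2`. -/
def readRow : Cmd :=
  seq (seq (asg 4 (.var 2)) (asg 5 (.const 0))) (seq readPreds (seq (read 3) (seq readTable (read 3))))

/-- Read a ballot. -/
def readBallot : Cmd := seq (forIn 2 (guard [.lt (.var 2) (.var 0)] readRow)) (read 3)

/-- Reading an exhausted input gives the code `0`, which is not counted as a cost. This matters
because the loop over the ballots runs on after the last one. -/
theorem readRow_nil (N : ℕ) {s : MemState} (hs : s.inp = []) (a b : Bool) :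
    (readRow.eval N s).mem (tagW a b) = s.mem (tagW a b) := by
  have hnot : ∀ a b, tagW a b ∉ (seq (seq (asg 4 (.var 2)) (asg 5 (.const 0)))
    (seq readPreds (read 3))).writes := by decide
  set s₁ := (seq (seq (asg 4 (.var 2)) (asg 5 (.const 0))) (seq readPreds (read 3))).eval N s with hs₁
  have h1 : s₁.inp = [] := eval_inp_of_nil N _ s hs
  have h2 : ∀ a b, s₁.mem (tagW a b) = s.mem (tagW a b) := fun a b =>
    eval_mem_of_notMem N _ s (hnot a b)
  have h3 : (readTable.eval N s₁).mem (tagW a b) = s₁.mem (tagW a b) := by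
    rw [readTable, eval]
    split
    · have i1 := eval_inp_of_nil N (readEntry false false) _ h1
      have i2 := eval_inp_of_nil N (readEntry false true) _ i1
      have i3 := eval_inp_of_nil N (readEntry true false) _ i2
      exact (readEntry_nil N i3 a b).trans ((readEntry_nil N i2 a b).trans
        ((readEntry_nil N i1 a b).trans (readEntry_nil N h1 a b)))
    · have i1 := eval_inp_of_nil N (readEntry false false) _ h1
      exact (readEntry_nil N i1 a b).trans (readEntry_nil N h1 a b)
  have h4 : ((read 3).eval N (readTable.eval N s₁)).mem (tagW a b) =
      (readTable.eval N s₁).mem (tagW a b) :=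
    eval_mem_of_notMem N _ _ (by cases a <;> cases b <;> decide)
  exact h4.trans (h3.trans (h2 a b))

theorem readBallot_nil (N : ℕ) {s : MemState} (hs : s.inp = []) (a b : Bool) :
    (readBallot.eval N s).mem (tagW a b) = s.mem (tagW a b) := by
  have key := forIn_induction (N := N) (x := 2) (c := guard [.lt (.var 2) (.var 0)] readRow)
    (by decide) (fun _ s' => s'.inp = [] ∧ s'.mem (tagW a b) = s.mem (tagW a b)) (s := s) ⟨hs, rfl⟩
    (fun i s' v h => ⟨h.1, by
      rw [MemState.setVar_mem_of_ne (by cases a <;> cases b <;> decide), h.2]⟩) ?_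
  · refine Eq.trans ?_ key.2
    exact eval_mem_of_notMem N (read 3) _ (by cases a <;> cases b <;> decide)
  · rintro i hi s' - ⟨h1, h2⟩
    rw [eval_guard]
    split
    · exact ⟨eval_inp_of_nil N _ _ h1, (readRow_nil N h1 a b).trans h2⟩
    · exact ⟨h1, h2⟩

end Cmd

/-! ### The costs of a profile -/

namespace CondBallot

variable {m : ℕ} (B : CondBallot m)

open scoped Classical in
theorem dissatisfaction_eq_sum (s : Fin m → Bool) :
    B.dissatisfaction s = ∑ j, if B.Dissatisfied s j then 1 else 0 := by
  rw [dissatisfaction, Set.ncard_eq_toFinset_card', Finset.sum_boole]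
  simp

theorem inDegree_le (h : B.maxInDegree ≤ 1) (j : Fin m) : B.inDegree j ≤ 1 :=
  (Finset.le_sup (f := B.inDegree) (Finset.mem_univ j)).trans h

open scoped Classical in
/-- If an issue has at most one predecessor, then it has a truth table indexed by the values of the
predecessor and the issue; an issue without predecessor may be considered as its own one. -/
theorem exists_table {j : Fin m} (h : B.inDegree j ≤ 1) :
    ∃ (p : Fin m) (bad : Bool → Bool → Bool) (table : List (Option Bool)),
      B.encodeRow j = (List.ofFn fun k : Fin m => some (decide (B.graph.Adj k j))) ++
        (none :: (table ++ [none])) ∧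
      (∀ s, B.Dissatisfied s j ↔ bad (s p) (s j) = true) ∧
      ((∀ k, B.graph.Adj k j ↔ k = p) ∧ table = [some (!bad false false), some (!bad false true),
          some (!bad true false), some (!bad true true)] ∨
        (∀ k, ¬ B.graph.Adj k j) ∧ p = j ∧ bad false true = false ∧ bad true false = false ∧
          table = [some (!bad false false), some (!bad true true)]) := by
  rcases Nat.le_one_iff_eq_zero_or_eq_one.1 h with h | h
  · have hno : ∀ k, ¬ B.graph.Adj k j := by
      intro k hk
      have := (Set.ncard_eq_zero (Set.toFinite _)).1 h
      exact Set.notMem_empty k (this ▸ hk)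
    -- Only the pair formed by the value of `j` with itself is ever evaluated, so `bad` may be
    -- `false` on mixed pairs.
    refine ⟨j, fun a b => decide (a = b ∧ (B.predAssignment j 0, b) ∉ B.approved j), _, ?_, ?_,
      Or.inr ⟨hno, rfl, by simp, by simp, rfl⟩⟩
    · simp [encodeRow, h]
    · intro s
      have : (fun k : {k : Fin m // B.graph.Adj k j} => s k.1) = B.predAssignment j 0 :=
        funext fun k => absurd k.2 (hno k.1)
      simp [Dissatisfied, this]
  · obtain ⟨p, hp⟩ := Set.ncard_eq_one.1 h
    have hadj : ∀ k, B.graph.Adj k j ↔ k = p := fun k => Set.ext_iff.1 hp k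
    -- No other predecessor precedes `p`, so its value is digit `0` of the index of the assignment.
    have hempty : {q : Fin m | B.graph.Adj q j ∧ q < p} = ∅ := by
      refine Set.eq_empty_of_forall_notMem fun q hq => ?_
      obtain ⟨h1, h2⟩ := hq
      rw [hadj] at h1
      exact h2.ne h1
    have hassign : ∀ a : Bool, (fun _ => a) = B.predAssignment j a.toNat := by
      intro a
      funext k
      have hk : k.1 = p := (hadj _).1 k.2
      simp only [predAssignment, hk, hempty, Set.ncard_empty]
      cases a <;> rfl
    refine ⟨p, fun a b => decide ((B.predAssignment j a.toNat, b) ∉ B.approved j), _, ?_, ?_,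
      Or.inl ⟨hadj, rfl⟩⟩
    · simp [encodeRow, h, List.range_succ]
    · intro s
      have : (fun k : {k : Fin m // B.graph.Adj k j} => s k.1) = B.predAssignment j (s p).toNat := by
        rw [← hassign]
        funext k
        rw [(hadj _).1 k.2]
      simp [Dissatisfied, this]

end CondBallot

namespace VotingProfile

open Elim

/-- The memory holds pairwise costs between adjacent issues with the sum `cost`. -/
def HasCost (P : VotingProfile) (cost : (ℕ → Bool) → ℕ) (s : MemState) : Prop :=
  s.mem 0 0 0 = P.m ∧
    (∀ σ, total (ofMem s.mem).W (Finset.range (P.m + 1)) σ = cost σ) ∧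
    ∀ a b k l, (ofMem s.mem).W a b k l ≠ 0 →
      k = l ∨ ∃ hk hl, P.globalGraph.Adj ⟨k, hk⟩ ⟨l, hl⟩

variable {P : VotingProfile}

theorem HasCost.congr {cost : (ℕ → Bool) → ℕ} {s s' : MemState} (h : P.HasCost cost s)
    (h0 : s'.mem 0 = s.mem 0) (hW : ∀ a b, s'.mem (tagW a b) = s.mem (tagW a b)) :
    P.HasCost cost s' := by
  have : (ofMem s'.mem).W = (ofMem s.mem).W := by
    funext a b
    exact hW a b
  unfold HasCost
  rw [h0, this]
  exact h

open scoped Classical in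
-- The costs at `p` and `j` rise by one for the pairs of values that dissatisfy the voter, and an
-- assignment sees just the pair of its own values there. The place of the change is an edge of the
-- voter's graph or on the diagonal.
theorem readRow_hasCost {N : ℕ} (hN : P.m ≤ N) (i : Fin P.n)
    (hdeg : (P.ballot i).maxInDegree ≤ 1) (j : Fin P.m) {cost : (ℕ → Bool) → ℕ} {s : MemState}
    (h : P.HasCost cost s) (h2 : s.mem 2 0 0 = j) {rest : List (Option Bool)}
    (hs : s.inp = (P.ballot i).encodeRow j ++ rest) :
    P.HasCost (fun σ => cost σ + if (P.ballot i).Dissatisfied (fun k => σ k) j then 1 else 0)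
      (Cmd.readRow.eval N s) ∧ (Cmd.readRow.eval N s).inp = rest := by
  obtain ⟨p, bad, table, henc, hbad, htab⟩ := (P.ballot i).exists_table
    ((P.ballot i).inDegree_le hdeg j)
  have tne : ∀ a b, tagW a b ∉ [1, 3, 4, 5] := by decide
  set s₁ := (s.setVar 4 j).setVar 5 0 with hs₁
  have e₁ : ((Cmd.asg 4 (.var 2)).seq (.asg 5 (.const 0))).eval N s = s₁ := by
    rw [hs₁, ← h2]
    rfl
  have m₁ : ∀ t, t ≠ 4 → t ≠ 5 → s₁.mem t = s.mem t := fun t h4 h5 => by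
    rw [hs₁, MemState.setVar_mem_of_ne h5, MemState.setVar_mem_of_ne h4]
  obtain ⟨i₂, h₂⟩ := Cmd.readPreds_spec (N := N) hN (fun k => decide ((P.ballot i).graph.Adj k j))
    (s := s₁) (j := j) (rest := none :: (table ++ [none]) ++ rest)
    (by rw [m₁ 0 (by decide) (by decide), h.1]) (by simp [hs₁, MemState.setVar, setMem])
    MemState.setVar_mem_self (by
      change s.inp = _
      rw [hs, henc, List.append_assoc])
  set s₂ := Cmd.readPreds.eval N s₁ with hs₂
  set s₃ := (Cmd.read 3).eval N s₂ with hs₃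
  have i₃ : s₃.inp = table ++ ([none] ++ rest) := by
    simp [hs₃, Cmd.eval, i₂]
  have m₃ : ∀ t, t ≠ 3 → s₃.mem t = s₂.mem t := fun t ht =>
    Cmd.eval_mem_of_notMem N _ _ (by simpa [Cmd.writes] using ht)
  have m₂ : ∀ t, t ∉ [1, 3, 4, 5] → s₂.mem t = s₁.mem t := fun t ht =>
    Cmd.eval_mem_of_notMem N _ _ (by
      have : Cmd.readPreds.writes = [1, 3, 4, 5, 1] := rfl
      rw [this]
      simp only [List.mem_cons, List.not_mem_nil, or_false, not_or] at ht ⊢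
      tauto)
  have m₄ : ∀ t, t ∉ [1, 3, 4, 5] → s₃.mem t = s.mem t := fun t ht => by
    have ht' := ht
    simp only [List.mem_cons, List.not_mem_nil, or_false, not_or] at ht'
    rw [m₃ t ht'.2.1, m₂ t ht, m₁ t ht'.2.2.1 ht'.2.2.2]
  have hcase : s₃.mem 4 0 0 = p ∧ (s₃.mem 5 0 0 ≠ 0 ∧ s₃.inp = [some (!bad false false),
      some (!bad false true), some (!bad true false), some (!bad true true)] ++ ([none] ++ rest) ∨
      s₃.mem 5 0 0 = 0 ∧ bad false true = false ∧ bad true false = false ∧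
        s₃.inp = [some (!bad false false), some (!bad true true)] ++ ([none] ++ rest)) := by
    rw [m₃ 4 (by decide), m₃ 5 (by decide), i₃]
    rcases h₂ with ⟨h5, h4, hno⟩ | ⟨h5, k, hk, h4⟩
    · rcases htab with ⟨hadj, -⟩ | ⟨-, rfl, hb1, hb2, rfl⟩
      · exact absurd ((hadj p).2 rfl) (by simpa using hno p)
      · exact ⟨h4, Or.inr ⟨h5, hb1, hb2, rfl⟩⟩
    · rcases htab with ⟨hadj, rfl⟩ | ⟨hno, -⟩
      · rw [(hadj k).1 (by simpa using hk)] at h4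
        exact ⟨h4, Or.inl ⟨h5, rfl⟩⟩
      · exact absurd (by simpa using hk) (hno k)
  have hread : Cmd.EntriesRead P.m j p (ofMem s.mem).W bad (fun _ _ => False) s₃ := by
    refine ⟨?_, ?_, hcase.1, fun a b k l => ⟨fun _ => ?_, fun h => h.1.elim⟩⟩
    · rw [m₄ 0 (by decide), h.1]
    · rw [m₄ 2 (by decide), h2]
    · exact congrFun (congrFun (m₄ _ (tne a b)) k) l
  obtain ⟨h₅, i₅⟩ := Cmd.readTable_spec N hread hcase.2
  have heval : Cmd.readRow.eval N s = (Cmd.read 3).eval N (Cmd.readTable.eval N s₃) := by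
    rw [hs₃, hs₂, ← e₁]
    rfl
  set s₅ := Cmd.readTable.eval N s₃ with hs₅
  rw [heval]
  refine ⟨?_, by simp [Cmd.eval, i₅]⟩
  have hfin : P.HasCost (fun σ => cost σ +
      if (P.ballot i).Dissatisfied (fun k => σ k) j then 1 else 0) s₅ := by
    have hW : ∀ a b k l, (ofMem s₅.mem).W a b k l = (ofMem s.mem).W a b k l +
        if l = j then if k = p then if bad a b = true then 1 else 0 else 0 else 0 := by
      intro a b k l
      have h6 := h₅.2.2.2 a b k l
      by_cases hc : k = p ∧ l = j ∧ bad a b = true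
      · refine (h6.2 ⟨trivial, hc⟩).trans ?_
        simp [hc]
      · refine (h6.1 fun h => hc h.2).trans ?_
        by_cases hk : k = p <;> by_cases hl : l = j <;> simp_all
    refine ⟨h₅.1, fun σ => ?_, fun a b k l hkl => ?_⟩
    · beta_reduce
      rw [← h.2.1 σ]
      have hp : (p : ℕ) ∈ Finset.range (P.m + 1) := Finset.mem_range.2 (p.2.trans (Nat.lt_succ_self _))
      have hj : (j : ℕ) ∈ Finset.range (P.m + 1) := Finset.mem_range.2 (j.2.trans (Nat.lt_succ_self _))
      simp only [total, hW, Finset.sum_add_distrib, Finset.sum_ite_eq', hp, hj, if_true, hbad]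
    · rw [hW] at hkl
      by_cases h0 : (ofMem s.mem).W a b k l = 0
      · have hkl' : k = p ∧ l = j := by
          by_contra hc
          by_cases hk : k = p <;> by_cases hl : l = j <;> simp_all
        obtain ⟨rfl, rfl⟩ := hkl'
        rcases htab with ⟨hadj, -⟩ | ⟨-, rfl, -⟩
        · refine Or.inr ⟨p.2, j.2, ?_⟩
          rw [globalGraph, Digraph.iSup_adj]
          exact ⟨i, (hadj p).2 rfl⟩
        · exact Or.inl rfl
      · exact h.2.2 a b k l h0
  exact hfin.congr (Cmd.eval_mem_of_notMem N _ _ (by decide))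
    fun a b => Cmd.eval_mem_of_notMem N _ _ (by cases a <;> cases b <;> decide)

/-- The dissatisfaction is a sum over the issues, of which the first `l` summands have been added
after `l` rows. -/
theorem readBallot_hasCost {N : ℕ} (hN : P.m ≤ N) (i : Fin P.n)
    (hdeg : (P.ballot i).maxInDegree ≤ 1) {cost : (ℕ → Bool) → ℕ} {s : MemState}
    (h : P.HasCost cost s) {rest : List (Option Bool)} (hs : s.inp = (P.ballot i).encode ++ rest) :
    P.HasCost (fun σ => cost σ + (P.ballot i).dissatisfaction fun k => σ k)
      (Cmd.readBallot.eval N s) ∧ (Cmd.readBallot.eval N s).inp = rest := by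
  classical
  let diss : (ℕ → Bool) → List ℕ := fun σ => List.ofFn fun j =>
    if (P.ballot i).Dissatisfied (fun k => σ k) j then 1 else 0
  have hlen : ∀ σ, (diss σ).length = P.m := fun σ => by simp [diss]
  have key := Cmd.forIn_induction (N := N) (x := 2)
    (c := .guard [.lt (.var 2) (.var 0)] Cmd.readRow) (by decide)
    (fun l s => P.HasCost (fun σ => cost σ + ((diss σ).take l).sum) s ∧
      s.inp = ((List.finRange P.m).drop l).flatMap (P.ballot i).encodeRow ++ (none :: rest)) (s := s)
    ⟨by simpa using h, by simpa [CondBallot.encode] using hs⟩ ?_ ?_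
  · obtain ⟨h1, h2⟩ := key
    rw [List.drop_eq_nil_of_le (by simpa using hN)] at h2
    have hcost : (fun σ => cost σ + ((diss σ).take N).sum) =
        fun σ => cost σ + (P.ballot i).dissatisfaction fun k => σ k := by
      funext σ
      rw [List.take_of_length_le (by rw [hlen]; exact hN), CondBallot.dissatisfaction_eq_sum,
        ← List.sum_ofFn]
    rw [hcost] at h1
    refine ⟨h1.congr ?_ fun a b => ?_, ?_⟩
    · exact Cmd.eval_mem_of_notMem N (.read 3) _ (by decide)
    · exact Cmd.eval_mem_of_notMem N (.read 3) _ (by cases a <;> cases b <;> decide)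
    · simp only [Cmd.readBallot, Cmd.eval.eq_2]
      simp [Cmd.eval.eq_6, h2]
  · rintro l s v ⟨h1, h2⟩
    refine ⟨h1.congr ?_ fun a b => ?_, h2⟩
    · exact MemState.setVar_mem_of_ne (by decide)
    · exact MemState.setVar_mem_of_ne (by cases a <;> cases b <;> decide)
  · rintro l hl s hl2 ⟨h1, h2⟩
    rw [Cmd.eval_guard]
    by_cases hlm : l < P.m
    · rw [if_pos (by simp [Expr.eval, hl2, h1.1, hlm])]
      rw [List.drop_eq_getElem_cons (by simpa using hlm)] at h2
      simp only [List.getElem_finRange, List.flatMap_cons, List.append_assoc] at h2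
      obtain ⟨h3, h4⟩ := readRow_hasCost hN i hdeg ⟨l, hlm⟩ h1 hl2 h2
      refine ⟨?_, h4⟩
      convert h3 using 2 with σ
      rw [List.sum_take_succ _ _ (by rw [hlen]; exact hlm), add_assoc]
      simp [diss]
    · rw [if_neg (by simp [Expr.eval, hl2, h1.1, hlm])]
      rw [List.drop_eq_nil_of_le (by simpa using hlm)] at h2
      rw [List.drop_eq_nil_of_le (by simp; omega)]
      refine ⟨?_, h2⟩
      convert h1 using 2 with σ
      rw [List.take_of_length_le (by rw [hlen]; omega), List.take_of_length_le (by rw [hlen]; omega)]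

/-- The same argument with partial sums over the voters; iterations beyond the last ballot meet an
empty input and leave the costs alone. -/
theorem readBallots_hasCost {N : ℕ} (hm : P.m ≤ N) (hn : P.n ≤ N)
    (hdeg : ∀ i, (P.ballot i).maxInDegree ≤ 1) {s : MemState} (h : P.HasCost (fun _ => 0) s)
    (hs : s.inp = (List.finRange P.n).flatMap fun i => (P.ballot i).encode) :
    P.HasCost (fun σ => P.cost fun k => σ k) ((Cmd.loop Cmd.readBallot).eval N s) := by
  let diss : (ℕ → Bool) → List ℕ := fun σ => List.ofFn fun i =>
    (P.ballot i).dissatisfaction fun k => σ k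
  have hlen : ∀ σ, (diss σ).length = P.n := fun σ => by simp [diss]
  have key := Cmd.loop_induction (N := N) (c := Cmd.readBallot)
    (fun l s => P.HasCost (fun σ => ((diss σ).take l).sum) s ∧
      s.inp = ((List.finRange P.n).drop l).flatMap fun i => (P.ballot i).encode) (s := s)
    ⟨by simpa using h, by simpa using hs⟩ ?_
  · convert key.1 using 2 with σ
    rw [List.take_of_length_le (by rw [hlen]; exact hn), cost, ← List.sum_ofFn]
  · rintro l hl s ⟨h1, h2⟩
    by_cases hln : l < P.n
    · rw [List.drop_eq_getElem_cons (by simpa using hln)] at h2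
      simp only [List.getElem_finRange, List.flatMap_cons] at h2
      obtain ⟨h3, h4⟩ := readBallot_hasCost hm _ (hdeg _) h1 h2
      refine ⟨?_, h4⟩
      convert h3 using 2 with σ
      rw [List.sum_take_succ _ _ (by rw [hlen]; exact hln)]
      simp [diss]
    · rw [List.drop_eq_nil_of_le (by simpa using hln)] at h2
      rw [List.drop_eq_nil_of_le (by simp; omega)]
      refine ⟨?_, Cmd.eval_inp_of_nil N _ _ h2⟩
      have h3 := h1.congr (s' := Cmd.readBallot.eval N s)
        (Cmd.eval_mem_of_notMem N _ _ (by decide)) (Cmd.readBallot_nil N h2)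
      convert h3 using 2 with σ
      rw [List.take_of_length_le (by rw [hlen]; omega), List.take_of_length_le (by rw [hlen]; omega)]

/-- With an empty log only the graph conditions have content. Since `adj` looks at the costs of both
ordered pairs, it matches the undirected version of the dependency graph; the dummy is not an issue
and hence on no edge. -/
theorem HasCost.inv {cost : (ℕ → Bool) → ℕ} {s : MemState} (h : P.HasCost cost s)
    (htw : TreewidthLE P.globalGraph.toSimpleGraphInclusive 2) (hdead : s.mem 30 = fun _ _ => 0)
    (hr : s.mem 12 0 0 = 0) : (ofMem s.mem).Inv P.m cost := by
  have hd : ∀ v, (ofMem s.mem).dead v = 0 := fun v => congrFun (congrFun hdead v) 0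
  have hr' : (ofMem s.mem).r = 0 := hr
  have hlive : (ofMem s.mem).live P.m = Finset.range (P.m + 1) := by
    ext v
    simp [live, hd]
  have hW : ∀ u v, (ofMem s.mem).adj u v ≠ 0 → u ≠ v →
      ∃ hu hv, P.globalGraph.toSimpleGraphInclusive.Adj ⟨u, hu⟩ ⟨v, hv⟩ := by
    intro u v huv hne
    rw [Ne, adj_eq_zero] at huv
    push Not at huv
    obtain ⟨a, b, hab⟩ := huv
    by_cases h0 : (ofMem s.mem).W a b u v = 0
    · rcases h.2.2 _ _ _ _ (hab h0) with h1 | ⟨hk, hl, h1⟩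
      · exact absurd h1.symm hne
      · exact ⟨hl, hk, by simpa using hne, Or.inr h1⟩
    · rcases h.2.2 _ _ _ _ h0 with h1 | ⟨hk, hl, h1⟩
      · exact absurd h1 hne
      · exact ⟨hk, hl, by simpa using hne, Or.inl h1⟩
  refine ⟨fun v => by simp [hd, hr'], fun i hi => by omega, fun i hi => by omega,
    fun i hi => by omega, fun σ => ?_, fun σ _ => ?_, ?_, fun v hv => ?_⟩
  · rw [hlive, h.2.1]
  · rw [hlive, h.2.1]
  · have hset : {v | v < P.m ∧ (ofMem s.mem).dead v = 0} = {v | v < P.m} := by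
      ext v
      exact ⟨fun h => h.1, fun h => ⟨h, hd v⟩⟩
    rw [hset]
    exact htw.hasDecomp.mono fun u _ v _ huv hadj => hW u v hadj huv
  · by_contra hadj
    obtain ⟨-, hm, -⟩ := hW v P.m hadj hv.ne
    exact lt_irrefl _ hm

/-- Loops bounded by the input length are long enough for all issues, the dummy vertex and all
voters. -/
theorem length_encode_ge : P.m + 1 + P.n ≤ P.encode.length := by
  have h : ∀ l : List (Fin P.n), l.length ≤ (l.flatMap fun i => (P.ballot i).encode).length := by
    intro l
    induction l with
    | nil => simp
    | cons i l ih =>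
      rw [List.flatMap_cons, List.length_append, List.length_cons]
      have : 1 ≤ ((P.ballot i).encode).length := by simp [CondBallot.encode]
      omega
  have := h (List.finRange P.n)
  rw [List.length_finRange] at this
  simp only [encode, List.length_append, List.length_replicate, List.length_singleton]
  omega

end VotingProfile

/-! ### The algorithm and the main theorem -/

/-- The program for Conditional Minisum. -/
def Cmd.minisum : Cmd :=
  .seq .readIssues (.seq (.loop .readBallot)
    (.seq (.loop Elim.sweepCmd) (.seq Elim.backtrackCmd Elim.writeCmd)))

open Elim in
theorem Cmd.minisum_spec (P : VotingProfile) (hdeg : ∀ i, (P.ballot i).maxInDegree ≤ 1)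
    (htw : TreewidthLE P.globalGraph.toSimpleGraphInclusive 2) :
    ∃ s, P.IsOptimal s ∧ Cmd.minisum.output P.encode = List.ofFn s := by
  have hlen := P.length_encode_ge
  set N := P.encode.length + 1 with hN
  set s₀ : MemState := ⟨fun _ _ _ => 0, P.encode, []⟩ with hs₀
  obtain ⟨h0, hinp⟩ := readIssues_spec (N := N) (m := P.m) (s := s₀) (by omega) rfl rfl
    rfl
  set s₁ := readIssues.eval N s₀ with hs₁
  have m₁ : ∀ t, t ∉ [0, 3, 6] → s₁.mem t = fun _ _ => 0 := fun t ht =>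
    eval_mem_of_notMem N _ s₀ (by
      have : readIssues.writes = [3, 0, 6] := rfl
      rw [this]
      simp only [List.mem_cons, List.not_mem_nil, or_false, not_or] at ht ⊢
      tauto)
  have hcost₁ : P.HasCost (fun _ => 0) s₁ := by
    have hW : ∀ a b k l, (ofMem s₁.mem).W a b k l = 0 := fun a b k l =>
      congrFun (congrFun (m₁ _ (by cases a <;> cases b <;> decide)) k) l
    exact ⟨h0, fun σ => by simp [total, hW], fun a b k l h => absurd (hW a b k l) h⟩
  have hcost₂ := P.readBallots_hasCost (N := N) (by omega) (by omega) hdeg hcost₁ hinp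
  set s₂ := (loop readBallot).eval N s₁ with hs₂
  have m₂ : ∀ t ∈ [12, 30, 40], s₂.mem t = fun _ _ => 0 := fun t ht => by
    rw [hs₂, eval_mem_of_notMem N _ s₁ ((by decide : ∀ t ∈ [12, 30, 40], t ∉ (loop readBallot).writes)
      t ht)]
    exact m₁ t ((by decide : ∀ t ∈ [12, 30, 40], t ∉ [0, 3, 6]) t ht)
  have hinv₂ := hcost₂.inv htw (m₂ 30 (by simp)) (congrFun (congrFun (m₂ 12 (by simp)) 0) 0)
  obtain ⟨h0₃, hinv₃, hr₃⟩ := loop_sweepCmd_spec (N := N) (by omega) hcost₂.1 hinv₂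
  set s₃ := (loop sweepCmd).eval N s₂ with hs₃
  have h40 : s₃.mem 40 P.m 0 = 0 := by
    rw [hs₃, eval_mem_of_notMem N _ s₂ (by decide), m₂ 40 (by simp)]
  obtain ⟨hob, h40'⟩ := backtrackCmd_spec (N := N) hinv₃ (by omega) h40
  set s₄ := backtrackCmd.eval N s₃ with hs₄
  have hout : s₄.out = [] := by
    rw [hs₄, eval_out_of_noOut N _ _ (by decide), hs₃, eval_out_of_noOut N _ _ (by decide), hs₂,
      eval_out_of_noOut N _ _ (by decide), hs₁, eval_out_of_noOut N _ _ (by decide)]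
  have h0₄ : s₄.mem 0 0 0 = P.m := by
    rw [hs₄, eval_mem_of_notMem N _ s₃ (by decide), h0₃]
  refine ⟨fun j => assignment s₄ j, fun τ => ?_, writeCmd_spec (by omega) h0₄ hout⟩
  -- The competing outcome is extended by `false`, the value that the computed assignment has at the
  -- dummy vertex.
  have hopt := hinv₃.optimal hr₃.ge hob (τ := fun k => if hk : k < P.m then τ ⟨k, hk⟩ else false)
    (by simp [assignment, h40'])
  simpa using hopt

/-- The required function is the output of the command itself, so its running time comes from the
compilation and its correctness from the specification. -/
theorem theorem3 :
    MinisumSolvableInPolyTime (fun P : VotingProfile =>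
      (∀ i : Fin P.n, (P.ballot i).maxInDegree ≤ 1) ∧
      TreewidthLE P.globalGraph.toSimpleGraphInclusive 2) :=
  ⟨fun P => Cmd.minisum.output P.1.encode, fun P => Cmd.minisum_spec P.1 P.2.1 P.2.2,
    StackProg.computableInPolyTime _ Cmd.minisum⟩
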